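/- **Setting.** Let $a,c,T,H_1>0$ and $r,K,\beta\in\mathbb R$. For $0\le t\le u\le T$ and $v\in\mathbb R$ let $$V_u^{t,v}=v+a(u-t)-\tfrac12\log\Bigl(1+\tfrac{c}{2a}e^{2v}(e^{2a(u-t)}-1)\Bigr),$$ which is the solution of $dV_u=(a-\tfrac c2e^{2V_u})\,du$ with $V_t=v$. Let $\gamma(t,u,v)\ge 0$ be given by $\gamma^2(t,u,v)=\int_t^u e^{2V_s^{t,v}}\,ds$, and let $$\hat h(t,v)=H_1\exp\Bigl\{-r(T-t)+\tfrac{1+2\beta}{2}\gamma^2(t,T,v)\Bigr\}.$$ Let $\mathcal L_0=(a-\tfrac c2e^{2v})\partial_v+\tfrac{x^2}{2}e^{2v}\partial_x^2+rx\,\partial_x-r$. The *zero-order term* $\hat f_0(t,x,v)$ is the solution of the terminal and boundary value problem $$(\partial_t+\mathcal L_0)\hat f_0=0\ \ (0<t<T,\ x>\hat h(t,v)),\qquad \hat f_0(T,x,v)=(x-K)^+\ \ (x>\hat h(T,v)),\qquad \hat f_0(t,\hat h(t,v),v)=0\ \ (0\le t\le T).$$ Here a solution is a function that is $C^1$ in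 $(t,x,v)$ with continuous $\partial_x^2\hat f_0$ on $\{0<t<T,\ x>\hat h(t,v)\}$; that is continuous on $\{0\le t\le T,\ x\ge\hat h(t,v)\}$ (if $K<H_1$, where the data are incompatible at $t=T$, $x=\hat h(T,v)$, except at these points); and that has at most polynomial growth in $x$, locally uniformly in $v$ and uniformly in $t\in[0,T]$. In the martingale approach the same quantity is defined, for $0\le t\le T$ and $x>\hat h(t,v)$, by $$\hat f_0(t,x,v)=e^{-r(T-t)}\,\mathbb E\bigl[(S_T^{t,v}-K)^+\mathbf 1_{\{\tau\ge T\}}\bigm| S_t^{t,v}=x\bigr],\qquad \tau=\inf\{u\in[t,T]:S_u^{t,v}\le\hat h(u,V_u^{t,v})\}\quad(\inf\emptyset=\infty),$$ where, given $S_t^{t,v}=x$, $S_u^{t,v}=x\exp\{r(u-t)-\tfrac12\gamma^2(t,u,v)+\int_t^u e^{V_l^{t,v}}\,dW_l\}$ for a standard Brownian motion $W$. **Proposition.** The terminal and boundary value problem has a solution; the payoff $(S_T^{t,v}-K)^+\mathbf 1_{\{\tau\ge T\}}$ is integrable; and, under either definition, for all $v\in\mathbb R$, $t\in[0,T)$ and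 $x>\hat h(t,v)$, $$\hat f_0(t,x,v)=x\,\mathcal N(d_1)-Ke^{-r(T-t)}\mathcal N(d_2)-\Bigl(\frac{\hat h(t,v)}{x}\Bigr)^{2+2\beta}x\,\mathcal N(d_3)+\Bigl(\frac{\hat h(t,v)}{x}\Bigr)^{2\beta}Ke^{-r(T-t)}\mathcal N(d_4),$$ where $\mathcal N$ is the standard normal cumulative distribution function and, with $\gamma=\gamma(t,T,v)$, $$d_1=\frac1\gamma\Bigl(\log\frac{x}{K\vee H_1}+r(T-t)+\tfrac12\gamma^2\Bigr),\quad d_2=d_1-\gamma,\quad d_3=d_1+\frac2\gamma\log\frac{\hat h(t,v)}{x},\quad d_4=d_2+\frac2\gamma\log\frac{\hat h(t,v)}{x}.$$ For $t=T$ and $x>\hat h(T,v)$ the right-hand side, where $\gamma(T,T,v)=0$, is read as its limit for $t\uparrow T$, and this limit equals $\hat f_0(T,x,v)$. -/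

import Mathlib

open MeasureTheory ProbabilityTheory Filter Topology Set
open scoped NNReal

namespace SmallVolOfVol

noncomputable section

/-- The deterministic log-volatility `V_u^{t,v}`: the solution of
`dV_u = (a - (c/2) e^{2 V_u}) du` with `V_t = v`. -/
def logVol (a c t v u : ℝ) : ℝ :=
  v + a * (u - t)
    - 1 / 2 * Real.log (1 + c / (2 * a) * Real.exp (2 * v) * (Real.exp (2 * a * (u - t)) - 1))

/-- `logVol` starts at `v` at time `t`. -/
lemma logVol_self (a c t v : ℝ) : logVol a c t v t = v := by
  simp [logVol]

/-- `logVol` solves the ordinary differential equation of the noiseless model. -/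
lemma hasDerivAt_logVol {a c : ℝ} (ha : 0 < a) (hc : 0 < c) {t u : ℝ} (htu : t ≤ u) (v : ℝ) :
    HasDerivAt (logVol a c t v) (a - c / 2 * Real.exp (2 * logVol a c t v u)) u := by
  have h1 : 1 ≤ Real.exp (2 * a * (u - t)) :=
    Real.one_le_exp (mul_nonneg (by positivity) (by linarith))
  have hpos : 0 < 1 + c / (2 * a) * Real.exp (2 * v) * (Real.exp (2 * a * (u - t)) - 1) := by
    have : 0 ≤ c / (2 * a) * Real.exp (2 * v) * (Real.exp (2 * a * (u - t)) - 1) :=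
      mul_nonneg (by positivity) (by linarith)
    linarith
  have hexp : Real.exp (2 * logVol a c t v u)
      = Real.exp (2 * v) * Real.exp (2 * a * (u - t))
        / (1 + c / (2 * a) * Real.exp (2 * v) * (Real.exp (2 * a * (u - t)) - 1)) := by
    have h2 : 2 * logVol a c t v u = 2 * v + 2 * a * (u - t)
        - Real.log (1 + c / (2 * a) * Real.exp (2 * v) * (Real.exp (2 * a * (u - t)) - 1)) := by
      unfold logVol
      ring
    rw [h2, Real.exp_sub, Real.exp_add, Real.exp_log hpos]
  have hl : HasDerivAt (fun w => 2 * a * (w - t)) (2 * a) u := by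
    simpa using ((hasDerivAt_id u).sub_const t).const_mul (2 * a)
  have hm : HasDerivAt (fun w => v + a * (w - t)) a u := by
    simpa using (((hasDerivAt_id u).sub_const t).const_mul a).const_add v
  have hd := hm.sub (((((hl.exp.sub_const 1).const_mul
    (c / (2 * a) * Real.exp (2 * v))).const_add 1).log hpos.ne').const_mul (1 / 2))
  refine hd.congr_deriv ?_
  rw [hexp]
  field_simp

/-- The integrated variance `γ²(t,u,v) = ∫_t^u e^{2 V_s^{t,v}} ds`. -/
def gammaSq (a c t u v : ℝ) : ℝ :=
  ∫ s in t..u, Real.exp (2 * logVol a c t v s)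

/-- `γ(t,u,v)`. -/
def gamma (a c t u v : ℝ) : ℝ := Real.sqrt (gammaSq a c t u v)

/-- The barrier `ĥ(t,v) = H₁ exp(-r(T-t) + (1+2β)/2 γ²(t,T,v))`. -/
def barrier (a c r T H₁ β t v : ℝ) : ℝ :=
  H₁ * Real.exp (-r * (T - t) + (1 + 2 * β) / 2 * gammaSq a c t T v)

/-- The standard normal cumulative distribution function. -/
def normalCDF (z : ℝ) : ℝ := cdf (gaussianReal 0 1) z

def d1 (a c r T K H₁ t x v : ℝ) : ℝ :=
  1 / gamma a c t T v
    * (Real.log (x / max K H₁) + r * (T - t) + 1 / 2 * gammaSq a c t T v)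

def d2 (a c r T K H₁ t x v : ℝ) : ℝ :=
  d1 a c r T K H₁ t x v - gamma a c t T v

def d3 (a c r T K H₁ β t x v : ℝ) : ℝ :=
  d1 a c r T K H₁ t x v
    + 2 / gamma a c t T v * Real.log (barrier a c r T H₁ β t v / x)

def d4 (a c r T K H₁ β t x v : ℝ) : ℝ :=
  d2 a c r T K H₁ t x v
    + 2 / gamma a c t T v * Real.log (barrier a c r T H₁ β t v / x)

/-- The closed-form expression (meaningful for `t < T`, where `γ(t,T,v) > 0`). -/
def closedForm (a c r T K H₁ β t x v : ℝ) : ℝ :=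
  x * normalCDF (d1 a c r T K H₁ t x v)
    - K * Real.exp (-r * (T - t)) * normalCDF (d2 a c r T K H₁ t x v)
    - (barrier a c r T H₁ β t v / x) ^ (2 + 2 * β) * x * normalCDF (d3 a c r T K H₁ β t x v)
    + (barrier a c r T H₁ β t v / x) ^ (2 * β) * (K * Real.exp (-r * (T - t)))
        * normalCDF (d4 a c r T K H₁ β t x v)

/-- `f(t,x,v)` is given by the closed form for `t ∈ [0,T]`, `x > ĥ(t,v)`. At maturity, where
`γ(T,T,v) = 0`, the closed form is read as its limit for `t ↑ T`. -/
def IsGivenByClosedForm (a c r T K H₁ β : ℝ) (f : ℝ → ℝ → ℝ → ℝ) : Prop :=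
  (∀ t x v : ℝ, 0 ≤ t → t < T → barrier a c r T H₁ β t v < x →
    f t x v = closedForm a c r T K H₁ β t x v) ∧
  (∀ x v : ℝ, barrier a c r T H₁ β T v < x →
    Tendsto (fun t => closedForm a c r T K H₁ β t x v) (𝓝[<] T) (𝓝 (f T x v)))

/-! ### The terminal and boundary value problem -/

/-- The differential operator `𝓛₀` acting on a function of `(x,v)`. -/
def opL0 (a c r : ℝ) (g : ℝ → ℝ → ℝ) (x v : ℝ) : ℝ :=
  (a - c / 2 * Real.exp (2 * v)) * deriv (fun w => g x w) v
    + x ^ 2 / 2 * Real.exp (2 * v) * iteratedDeriv 2 (fun y => g y v) x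
    + r * x * deriv (fun y => g y v) x
    - r * g x v

/-- The open domain `{(t,x,v) : 0 < t < T, x > ĥ(t,v)}`. -/
def openDomain (a c r T H₁ β : ℝ) : Set (ℝ × ℝ × ℝ) :=
  {p | 0 < p.1 ∧ p.1 < T ∧ barrier a c r T H₁ β p.1 p.2.2 < p.2.1}

/-- The closed domain `{(t,x,v) : 0 ≤ t ≤ T, x ≥ ĥ(t,v)}`. -/
def closedDomain (a c r T H₁ β : ℝ) : Set (ℝ × ℝ × ℝ) :=
  {p | 0 ≤ p.1 ∧ p.1 ≤ T ∧ barrier a c r T H₁ β p.1 p.2.2 ≤ p.2.1}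

/-- `f` is a classical solution, of at most polynomial growth in `x` locally uniformly in `v`, of
the terminal and boundary value problem that defines the zero-order term. -/
structure IsZeroOrderTerm (a c r T K H₁ β : ℝ) (f : ℝ → ℝ → ℝ → ℝ) : Prop where
  /-- `f` is of class `C¹` in the interior, -/
  contDiffOn : ContDiffOn ℝ 1 (fun p : ℝ × ℝ × ℝ => f p.1 p.2.1 p.2.2)
    (openDomain a c r T H₁ β)
  /-- is twice differentiable in `x` there, -/
  differentiableAt_deriv : ∀ t x v : ℝ, (t, x, v) ∈ openDomain a c r T H₁ β →
    DifferentiableAt ℝ (deriv (fun y => f t y v)) x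
  /-- and its second derivative in `x` is continuous there. -/
  continuousOn_deriv2 : ContinuousOn
    (fun p : ℝ × ℝ × ℝ => iteratedDeriv 2 (fun y => f p.1 y p.2.2) p.2.1)
    (openDomain a c r T H₁ β)
  /-- `f` is continuous up to the boundary. If `K < H₁`, then the terminal and the boundary data
  disagree where `t = T` and `x = ĥ(T,v)`, and continuity is required elsewhere. -/
  continuousOn : ContinuousOn (fun p : ℝ × ℝ × ℝ => f p.1 p.2.1 p.2.2)
    {p ∈ closedDomain a c r T H₁ β |
      H₁ ≤ K ∨ p.1 ≠ T ∨ p.2.1 ≠ barrier a c r T H₁ β T p.2.2}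
  growth : ∀ M : ℝ, ∃ (C : ℝ) (k : ℕ), ∀ t x v : ℝ,
    (t, x, v) ∈ closedDomain a c r T H₁ β → |v| ≤ M → |f t x v| ≤ C * (1 + x ^ k)
  pde : ∀ t x v : ℝ, (t, x, v) ∈ openDomain a c r T H₁ β →
    deriv (fun s => f s x v) t + opL0 a c r (f t) x v = 0
  terminal : ∀ x v : ℝ, barrier a c r T H₁ β T v < x → f T x v = max (x - K) 0
  boundary : ∀ t v : ℝ, 0 ≤ t → t ≤ T → f t (barrier a c r T H₁ β t v) v = 0

/-! ### The martingale approach -/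

/-- Left-point Riemann sum, over the uniform partition of `[t,u]` into `n` intervals, of the
integral of `σ` against the path `w`. -/
def riemannSum (σ : ℝ → ℝ) (w : ℝ≥0 → ℝ) (t u : ℝ) (n : ℕ) : ℝ :=
  ∑ i ∈ Finset.range n, σ (t + i * ((u - t) / n))
    * (w (t + (i + 1 : ℕ) * ((u - t) / n)).toNNReal - w (t + i * ((u - t) / n)).toNNReal)

/-- The Wiener integral `∫_t^u σ(l) dW_l` of a deterministic continuously differentiable `σ`,
taken along the path `w` of `W`: the limit of the left-point Riemann sums. -/
def wienerIntegral (σ : ℝ → ℝ) (w : ℝ≥0 → ℝ) (t u : ℝ) : ℝ :=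
  limUnder atTop (riemannSum σ w t u)

/-- The Riemann sums do converge along every continuous path, so that `wienerIntegral` is the
Riemann-Stieltjes integral that integration by parts gives. -/
lemma tendsto_riemannSum {σ σ' : ℝ → ℝ} {w : ℝ≥0 → ℝ} {t u : ℝ} (htu : t ≤ u)
    (hw : Continuous w) (hσ : ∀ l ∈ Icc t u, HasDerivAt σ (σ' l) l)
    (hσ' : ContinuousOn σ' (Icc t u)) :
    Tendsto (riemannSum σ w t u) atTop
      (𝓝 (σ u * w u.toNNReal - σ t * w t.toNNReal
        - ∫ l in t..u, w l.toNNReal * σ' l)) := by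
  set g : ℝ → ℝ := fun l => w l.toNNReal with hg
  have hgc : Continuous g := hw.comp continuous_real_toNNReal
  obtain ⟨B, hB⟩ := isCompact_Icc.exists_bound_of_continuousOn hσ'
  have hB0 : 0 ≤ B := (norm_nonneg _).trans (hB t (left_mem_Icc.2 htu))
  have huc : UniformContinuousOn g (Icc t u) :=
    isCompact_Icc.uniformContinuousOn_of_continuous hgc.continuousOn
  rw [Metric.tendsto_atTop]
  intro ε hε
  obtain ⟨η, hη, hη'⟩ : ∃ η : ℝ, 0 < η ∧ η * B * (u - t) < ε := by
    refine ⟨ε / (2 * (B * (u - t) + 1)), ?_, ?_⟩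
    · have : 0 ≤ B * (u - t) := mul_nonneg hB0 (by linarith)
      positivity
    · have h0 : 0 ≤ B * (u - t) := mul_nonneg hB0 (by linarith)
      rw [mul_assoc, div_mul_eq_mul_div, div_lt_iff₀ (by positivity)]
      nlinarith
  obtain ⟨δ, hδ, hδ'⟩ := Metric.uniformContinuousOn_iff.1 huc η hη
  obtain ⟨N, hN⟩ := exists_nat_gt ((u - t) / δ)
  refine ⟨N + 1, fun n hn => ?_⟩
  have hn0 : (0 : ℝ) < n := by exact_mod_cast (by omega : 0 < n)
  have hNn : (N : ℝ) ≤ n := by exact_mod_cast (by omega : N ≤ n)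
  set h : ℝ := (u - t) / n with hh
  have hh0 : 0 ≤ h := div_nonneg (by linarith) hn0.le
  have hhδ : h < δ := by
    rw [div_lt_iff₀ hδ] at hN
    rw [hh, div_lt_iff₀ hn0]
    nlinarith
  have hnh : n * h = u - t := by rw [hh]; field_simp
  set p : ℕ → ℝ := fun i => t + i * h with hp
  have hps : ∀ i, p (i + 1) = p i + h := fun i => by simp only [hp]; push_cast; ring
  have hp0 : p 0 = t := by simp [hp]
  have hpn : p n = u := by simp only [hp]; linarith
  have hpt : ∀ i, t ≤ p i := fun i => by
    simp only [hp]; have : 0 ≤ (i : ℝ) * h := by positivity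
    linarith
  have hpu : ∀ i, i ≤ n → p i ≤ u := fun i hi => by
    have : (i : ℝ) * h ≤ n * h := by gcongr
    simp only [hp]; linarith
  have hsub : ∀ i, i < n → Icc (p i) (p (i + 1)) ⊆ Icc t u := fun i hi =>
    Icc_subset_Icc (hpt i) (hpu _ hi)
  have hle : ∀ i, p i ≤ p (i + 1) := fun i => by rw [hps]; linarith
  have hci : ∀ i, i < n → ContinuousOn σ' (uIcc (p i) (p (i + 1))) := fun i hi => by
    rw [uIcc_of_le (hle i)]; exact hσ'.mono (hsub i hi)
  have hftc : ∀ i, i < n → ∫ l in p i..p (i + 1), σ' l = σ (p (i + 1)) - σ (p i) := by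
    intro i hi
    refine intervalIntegral.integral_eq_sub_of_hasDerivAt (fun l hl => hσ l ?_)
      (hci i hi).intervalIntegrable
    rw [uIcc_of_le (hle i)] at hl
    exact hsub i hi hl
  have hint : ∀ i, i < n →
      IntervalIntegrable (fun l => g l * σ' l) volume (p i) (p (i + 1)) := fun i hi =>
    (hgc.continuousOn.mul (hci i hi)).intervalIntegrable
  have hsum : ∫ l in t..u, g l * σ' l
      = ∑ i ∈ Finset.range n, ∫ l in p i..p (i + 1), g l * σ' l := by
    rw [intervalIntegral.sum_integral_adjacent_intervals hint, hp0, hpn]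
  have htel : σ u * g u - σ t * g t
      = ∑ i ∈ Finset.range n, (σ (p (i + 1)) * g (p (i + 1)) - σ (p i) * g (p i)) := by
    rw [Finset.sum_range_sub (fun i => σ (p i) * g (p i)), hp0, hpn]
  have hkey : riemannSum σ w t u n - (σ u * g u - σ t * g t - ∫ l in t..u, g l * σ' l)
      = ∑ i ∈ Finset.range n, ∫ l in p i..p (i + 1), (g l - g (p (i + 1))) * σ' l := by
    have hr : riemannSum σ w t u n
        = ∑ i ∈ Finset.range n, σ (p i) * (g (p (i + 1)) - g (p i)) := rfl
    rw [hr, hsum, htel, ← Finset.sum_sub_distrib, ← Finset.sum_sub_distrib]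
    refine Finset.sum_congr rfl fun i hi => ?_
    have hi' := Finset.mem_range.1 hi
    simp_rw [sub_mul]
    rw [intervalIntegral.integral_sub (hint i hi')
      ((hci i hi').intervalIntegrable.const_mul _), intervalIntegral.integral_const_mul,
      hftc i hi']
    ring
  rw [Real.dist_eq, hkey]
  calc |∑ i ∈ Finset.range n, ∫ l in p i..p (i + 1), (g l - g (p (i + 1))) * σ' l|
      ≤ ∑ i ∈ Finset.range n, |∫ l in p i..p (i + 1), (g l - g (p (i + 1))) * σ' l| :=
        Finset.abs_sum_le_sum_abs _ _
    _ ≤ ∑ i ∈ Finset.range n, η * B * h := by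
        refine Finset.sum_le_sum fun i hi => ?_
        have hi' := Finset.mem_range.1 hi
        have hb := intervalIntegral.norm_integral_le_of_norm_le_const
          (a := p i) (b := p (i + 1)) (C := η * B)
          (f := fun l => (g l - g (p (i + 1))) * σ' l) (fun l hl => by
            rw [uIoc_of_le (hle i)] at hl
            have hl' : l ∈ Icc t u := hsub i hi' ⟨hl.1.le, hl.2⟩
            have hr' : p (i + 1) ∈ Icc t u := ⟨hpt _, hpu _ hi'⟩
            rw [norm_mul]
            refine mul_le_mul ?_ (hB l hl') (norm_nonneg _) hη.le
            rw [← dist_eq_norm]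
            refine (hδ' l hl' _ hr' ?_).le
            rw [Real.dist_eq, abs_sub_comm, abs_of_nonneg (by linarith [hl.2])]
            have := hps i
            linarith [hl.1])
        rw [Real.norm_eq_abs, hps, add_sub_cancel_left, abs_of_nonneg hh0] at hb
        rwa [hps]
    _ = η * B * (u - t) := by
        rw [Finset.sum_const, Finset.card_range, nsmul_eq_mul, ← hnh]
        ring
    _ < ε := hη'

/-- The geometric Brownian motion `S^{t,v}` with drift `r` and deterministic volatility
`e^{V_u^{t,v}}`, driven by `W` and started from `x` at time `t`. -/
def price {Ω : Type*} (a c r : ℝ) (W : ℝ≥0 → Ω → ℝ) (t x v u : ℝ) (ω : Ω) : ℝ :=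
  x * Real.exp (r * (u - t) - 1 / 2 * gammaSq a c t u v
    + wienerIntegral (fun l => Real.exp (logVol a c t v l)) (fun s => W s ω) t u)

/-- `τ = inf {u ∈ [t,T] : S_u^{t,v} ≤ ĥ(u, V_u^{t,v})}`, with `inf ∅ = ∞`. -/
def hitTime {Ω : Type*} (a c r T H₁ β : ℝ) (W : ℝ≥0 → Ω → ℝ) (t x v : ℝ) (ω : Ω) : EReal :=
  sInf ((fun u : ℝ => (u : EReal)) ''
    {u : ℝ | t ≤ u ∧ u ≤ T ∧
      price a c r W t x v u ω ≤ barrier a c r T H₁ β u (logVol a c t v u)})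

/-- The payoff `(S_T - K)⁺ 𝟙{τ ≥ T}` of the down-and-out call. -/
def payoff {Ω : Type*} (a c r T K H₁ β : ℝ) (W : ℝ≥0 → Ω → ℝ) (t x v : ℝ) : Ω → ℝ :=
  {ω | (T : EReal) ≤ hitTime a c r T H₁ β W t x v ω}.indicator
    (fun ω => max (price a c r W t x v T ω - K) 0)

/-- The discounted expected payoff `e^{-r(T-t)} 𝔼[(S_T^{t,v} - K)⁺ 𝟙{τ ≥ T} | S_t^{t,v} = x]`. -/
def martingalePrice {Ω : Type*} [MeasurableSpace Ω] (a c r T K H₁ β : ℝ) (W : ℝ≥0 → Ω → ℝ)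
    (P : Measure Ω) (t x v : ℝ) : ℝ :=
  Real.exp (-r * (T - t)) * ∫ ω, payoff a c r T K H₁ β W t x v ω ∂P

end

end SmallVolOfVol

/-!
Along the characteristics `v = V_u` of the transport part of `∂_t + 𝓛₀` the volatility is a
deterministic function of time. In the variables `s = γ²(t,T,v)` and
`z = log(x/H₁) + r(T-t) - γ²(t,T,v)/2` the pricing equation becomes the heat equation
`G_s = ½ G_zz` up to the discount factor (`IsCaloric.solvesAt_heatLift`), maturity becomes `s = 0`,
and the barrier, whose shape is chosen for this purpose, becomes the line `z = β s`. If the terminal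
value `g` on `z > 0` is extended by `g(-z) = -e^{2βz} g(z)` (`callExt`), then its heat flow vanishes
on that line (`heatEval_callExt_boundary`). The extended call is a sum of four exponentials on
half-lines, and their heat flows are the four terms of the closed form
(`heatEval_expStep`, `zeroOrderTerm_eq_closedForm`). This gives existence
(`isZeroOrderTerm_zeroOrderTerm`).

Uniqueness is a maximum principle along one characteristic, where only `t` and `x` vary. The
difference of two solutions is at most a combination of three positive supersolutions, which tends
to zero with a parameter `ε`. The first makes the inequality strict, and the second, a power of
`x`, dominates the polynomial growth. The third is the heat kernel issued from time `-ε` at the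
corner `t = T`, `x = ĥ(T,v)`, where nothing but boundedness is known of a solution: it has size
one at the corner and tends to zero elsewhere as `ε → 0` (`IsZeroOrderTerm.sub_le`).

In the martingale approach, `log(S_u / ĥ(u,V_u)) = y + β q(u) + M_u` where `q(u) = γ²(t,u,v)` and
where `M` is a Wiener integral, that is, a Brownian motion in the clock `q`
(`price_eq_barrier_mul_exp`, `isClockedBM_logMartingale`). The law of `M` and the independence of its
increments are read off from Riemann sums (`IsC1On.hasLaw_wienerIntegral`,
`indepFun_wienerIntegral`). The process `𝔼[g(X_T) | X_u]`, with `X_u = y + β q(u) + M_u`, is the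
heat flow of `g` and is zero when `X_u = 0`, so that stopping it when `X` reaches zero gives
`𝔼[g(X_T) 𝟙{X > 0 on [t,T]}] = 𝔼[g(X_T)]` (`IsClockedBM.integral_indicator_pos`). Optional stopping
is needed only for the first point of a finite grid at which `X ≤ 0`, where it amounts to averaging
over one independent Gaussian increment (`IsClockedBM.integral_firstPassageSum`); as the grid is
refined, the stopped values tend to zero almost surely and are bounded in `L²`. That the limit of the
grid events is the event `X > 0` requires that `X` almost surely does not touch zero without
becoming negative. For such a path the process started from `y + δ` survives and the one started
from `y - δ` does not, and the difference of the survival probabilities, which are already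
known in the limit, tends to zero with `δ` (`IsClockedBM.measure_touch_eq_zero`).
-/

namespace SmallVolOfVol

noncomputable section

/-! ### Gaussian integrals and the normal distribution function -/

lemma normalCDF_eq_integral (z : ℝ) : normalCDF z = ∫ x in Iic z, gaussianPDFReal 0 1 x := by
  rw [normalCDF, cdf_eq_real, measureReal_def, gaussianReal_apply_eq_integral 0 one_ne_zero,
    ENNReal.toReal_ofReal]
  exact integral_nonneg fun x => gaussianPDFReal_nonneg _ _ _

lemma continuous_gaussianPDFReal (m : ℝ) (v : ℝ≥0) : Continuous (gaussianPDFReal m v) := by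
  unfold gaussianPDFReal
  fun_prop

lemma hasDerivAt_normalCDF (z : ℝ) : HasDerivAt normalCDF (gaussianPDFReal 0 1 z) z := by
  have hc := continuous_gaussianPDFReal 0 1
  have hi := integrable_gaussianPDFReal 0 1
  have h : normalCDF = fun y => (∫ x in Iic (0 : ℝ), gaussianPDFReal 0 1 x)
      + ∫ x in (0 : ℝ)..y, gaussianPDFReal 0 1 x := by
    funext y
    rw [normalCDF_eq_integral,
      ← intervalIntegral.integral_Iic_sub_Iic hi.integrableOn hi.integrableOn]
    ring
  rw [h]
  exact (intervalIntegral.integral_hasDerivAt_right hi.intervalIntegrable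
    (hc.stronglyMeasurableAtFilter _ _) hc.continuousAt).const_add _

lemma hasDerivAt_gaussianPDFReal (z : ℝ) :
    HasDerivAt (gaussianPDFReal 0 1) (-z * gaussianPDFReal 0 1 z) z := by
  have h1 : HasDerivAt (fun x : ℝ => -(x - 0) ^ 2 / (2 * ((1 : ℝ≥0) : ℝ))) (-z) z := by
    have := (((hasDerivAt_id z).pow 2).neg.div_const 2)
    refine (this.congr_deriv ?_).congr_of_eventuallyEq (Eventually.of_forall fun x => ?_)
    · simp only [id_eq]; ring
    · simp
  have h2 := h1.exp.const_mul (√(2 * Real.pi * ((1 : ℝ≥0) : ℝ)))⁻¹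
  refine h2.congr_deriv ?_
  rw [gaussianPDFReal]
  ring

/-- Exponential tilting of the standard normal distribution is a translation. -/
lemma integral_exp_mul_gaussianReal (b : ℝ) (h : ℝ → ℝ) :
    ∫ ξ, Real.exp (b * ξ) * h ξ ∂gaussianReal 0 1
      = Real.exp (b ^ 2 / 2) * ∫ ξ, h (ξ + b) ∂gaussianReal 0 1 := by
  rw [integral_gaussianReal_eq_integral_smul one_ne_zero,
    integral_gaussianReal_eq_integral_smul one_ne_zero, ← integral_const_mul,
    ← integral_add_right_eq_self _ b]
  congr 1
  funext ξ
  simp only [gaussianPDFReal, smul_eq_mul]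
  have : Real.exp (-(ξ + b - 0) ^ 2 / (2 * ((1 : ℝ≥0) : ℝ))) * Real.exp (b * (ξ + b))
      = Real.exp (b ^ 2 / 2) * Real.exp (-(ξ - 0) ^ 2 / (2 * ((1 : ℝ≥0) : ℝ))) := by
    rw [← Real.exp_add, ← Real.exp_add]
    congr 1
    push_cast
    ring
  linear_combination (√(2 * Real.pi * ((1 : ℝ≥0) : ℝ)))⁻¹ * h (ξ + b) * this

lemma gaussianReal_real_lt (d : ℝ) : (gaussianReal 0 1).real {ξ | ξ < d} = normalCDF d := by
  have : NullSingletonClass (gaussianReal 0 1) := nullSingletonClass_gaussianReal one_ne_zero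
  rw [normalCDF, cdf_eq_real]
  exact congrArg ENNReal.toReal (measure_congr Iio_ae_eq_Iic)

lemma gaussianReal_real_neg_lt (d : ℝ) :
    (gaussianReal 0 1).real {ξ | -ξ < d} = normalCDF d := by
  rw [← gaussianReal_real_lt]
  have h : (gaussianReal 0 1).map (fun x => -x) = gaussianReal 0 1 := by
    rw [gaussianReal_map_neg, neg_zero]
  conv_rhs => rw [← h]
  exact (map_measureReal_apply (f := fun x : ℝ => -x) measurable_neg measurableSet_Iio).symm

lemma integrable_exp_abs_gaussianReal (k : ℝ) :
    Integrable (fun ξ => Real.exp (k * |ξ|)) (gaussianReal 0 1) := by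
  have h := (integrable_exp_mul_gaussianReal (μ := 0) (v := 1) k).add
    (integrable_exp_mul_gaussianReal (μ := 0) (v := 1) (-k))
  refine h.mono' (by fun_prop) (ae_of_all _ fun ξ => ?_)
  rw [Real.norm_eq_abs, abs_of_pos (Real.exp_pos _)]
  rcases abs_cases ξ with ⟨h, _⟩ | ⟨h, _⟩ <;> rw [h]
  · exact le_add_of_nonneg_right (Real.exp_pos _).le
  · simp only [Pi.add_apply, neg_mul, mul_neg]
    exact le_add_of_nonneg_left (Real.exp_pos _).le

/-! ### The heat semigroup -/

/-- The heat semigroup at time `s`: `(heatEval g s z) = 𝔼[g(z + √s ξ)]` with `ξ` standard normal. -/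
def heatEval (g : ℝ → ℝ) (s z : ℝ) : ℝ := ∫ ξ, g (z + √s * ξ) ∂gaussianReal 0 1

/-- `g` is measurable and grows at most exponentially. -/
structure ExpGrowth (g : ℝ → ℝ) : Prop where
  measurable : Measurable g
  exists_bound : ∃ C k : ℝ, 0 ≤ k ∧ ∀ z, |g z| ≤ C * Real.exp (k * |z|)

lemma heatEval_zero (g : ℝ → ℝ) (z : ℝ) : heatEval g 0 z = g z := by
  simp [heatEval]

lemma ExpGrowth.exists_dominating {g : ℝ → ℝ} (hg : ExpGrowth g) :
    ∃ C k : ℝ, 0 ≤ C ∧ 0 ≤ k ∧ ∀ s z b ξ : ℝ, √s ≤ b →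
      |g (z + √s * ξ)| ≤ C * Real.exp (k * |z|) * Real.exp (k * b * |ξ|) := by
  obtain ⟨C, k, hk, h⟩ := hg.exists_bound
  have hC : 0 ≤ C := by simpa using (abs_nonneg _).trans (h 0)
  refine ⟨C, k, hC, hk, fun s z b ξ hs => (h _).trans ?_⟩
  rw [mul_assoc, ← Real.exp_add]
  gcongr
  calc k * |z + √s * ξ| ≤ k * (|z| + b * |ξ|) := by
        gcongr
        refine (abs_add_le _ _).trans ?_
        rw [abs_mul, abs_of_nonneg (Real.sqrt_nonneg s)]
        gcongr
    _ = k * |z| + k * b * |ξ| := by ring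

lemma ExpGrowth.integrable {g : ℝ → ℝ} (hg : ExpGrowth g) (s z : ℝ) :
    Integrable (fun ξ => g (z + √s * ξ)) (gaussianReal 0 1) := by
  obtain ⟨C, k, -, -, h⟩ := hg.exists_dominating
  exact ((integrable_exp_abs_gaussianReal _).const_mul _).mono'
    (hg.measurable.comp (by fun_prop)).aestronglyMeasurable
    (ae_of_all _ fun ξ => h s z (√s) ξ le_rfl)

lemma ExpGrowth.sq {g : ℝ → ℝ} (hg : ExpGrowth g) : ExpGrowth fun z => g z ^ 2 := by
  obtain ⟨C, k, hk, h⟩ := hg.exists_bound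
  refine ⟨hg.measurable.pow_const 2, C ^ 2, 2 * k, by positivity, fun z => ?_⟩
  have : Real.exp (2 * k * |z|) = Real.exp (k * |z|) ^ 2 := by
    rw [← Real.exp_nat_mul]; push_cast; ring_nf
  rw [this, ← mul_pow, abs_pow]
  exact pow_le_pow_left₀ (abs_nonneg _) (h z) 2

lemma ExpGrowth.add {f g : ℝ → ℝ} (hf : ExpGrowth f) (hg : ExpGrowth g) :
    ExpGrowth fun z => f z + g z := by
  obtain ⟨C, k, hk, h⟩ := hf.exists_bound
  obtain ⟨C', k', hk', h'⟩ := hg.exists_bound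
  have hC : 0 ≤ C := by simpa using (abs_nonneg _).trans (h 0)
  have hC' : 0 ≤ C' := by simpa using (abs_nonneg _).trans (h' 0)
  refine ⟨hf.measurable.add hg.measurable, C + C', k + k', by positivity, fun z => ?_⟩
  refine (abs_add_le _ _).trans ((add_le_add (h z) (h' z)).trans ?_)
  rw [add_mul]
  gcongr
  · linarith
  · linarith

lemma ExpGrowth.const_mul {g : ℝ → ℝ} (hg : ExpGrowth g) (m : ℝ) :
    ExpGrowth fun z => m * g z := by
  obtain ⟨C, k, hk, h⟩ := hg.exists_bound
  refine ⟨hg.measurable.const_mul m, |m| * C, k, hk, fun z => ?_⟩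
  rw [abs_mul, mul_assoc]
  gcongr
  exact h z

/-- At positive times the semigroup is jointly continuous for `g` with countably many
discontinuities, and so it is at time `0` at the points where `g` is continuous. -/
lemma ExpGrowth.continuousAt_heatEval {g : ℝ → ℝ} (hg : ExpGrowth g)
    (hD : {z | ¬ ContinuousAt g z}.Countable) {s₀ z₀ : ℝ} (h0 : 0 < s₀ ∨ ContinuousAt g z₀) :
    ContinuousAt (fun p : ℝ × ℝ => heatEval g p.1 p.2) (s₀, z₀) := by
  obtain ⟨C, k, hC, hk, h⟩ := hg.exists_dominating
  have : NullSingletonClass (gaussianReal 0 1) := nullSingletonClass_gaussianReal one_ne_zero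
  have hsq : ContinuousAt (fun p : ℝ × ℝ => √p.1) (s₀, z₀) := by fun_prop
  have hab : ContinuousAt (fun p : ℝ × ℝ => |p.2|) (s₀, z₀) := by fun_prop
  unfold heatEval
  refine tendsto_integral_filter_of_dominated_convergence
    (fun ξ => C * Real.exp (k * (|z₀| + 1)) * Real.exp (k * (√s₀ + 1) * |ξ|))
    (Eventually.of_forall fun p => (hg.measurable.comp (by fun_prop)).aestronglyMeasurable)
    ?_ ((integrable_exp_abs_gaussianReal _).const_mul _) ?_
  · filter_upwards [hsq.eventually_lt_const (lt_add_one _),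
      hab.eventually_lt_const (lt_add_one _)] with p hp1 hp2
    refine ae_of_all _ fun ξ => (h p.1 p.2 _ ξ hp1.le).trans ?_
    gcongr
  · have hae : ∀ᵐ ξ ∂gaussianReal 0 1, ContinuousAt g (z₀ + √s₀ * ξ) := by
      rcases le_or_gt s₀ 0 with hs | hs
      · have hc := h0.resolve_left hs.not_gt
        simpa [Real.sqrt_eq_zero_of_nonpos hs] using hc
      · have hinj : Function.Injective fun ξ => z₀ + √s₀ * ξ := fun x y hxy => by
          have := Real.sqrt_pos.2 hs
          simpa [this.ne'] using hxy
        have hN := (hD.preimage hinj).measure_zero (gaussianReal 0 1)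
        filter_upwards [compl_mem_ae_iff.2 hN] with ξ hξ
        simpa using hξ
    filter_upwards [hae] with ξ hξ
    have hin : ContinuousAt (fun p : ℝ × ℝ => p.2 + √p.1 * ξ) (s₀, z₀) := by fun_prop
    exact ContinuousAt.comp_of_eq (g := g) hξ hin rfl

lemma ExpGrowth.exists_heatEval_le {g : ℝ → ℝ} (hg : ExpGrowth g) (s₁ : ℝ) :
    ∃ (C : ℝ) (k : ℕ), ∀ s z : ℝ, s ≤ s₁ → |heatEval g s z| ≤ C * Real.exp (k * |z|) := by
  obtain ⟨C, k, hC, hk, h⟩ := hg.exists_dominating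
  refine ⟨C * ∫ ξ, Real.exp (k * √s₁ * |ξ|) ∂gaussianReal 0 1, ⌈k⌉₊, fun s z hs => ?_⟩
  have hb := norm_integral_le_of_norm_le (f := fun ξ => g (z + √s * ξ))
    ((integrable_exp_abs_gaussianReal (k * √s₁)).const_mul
    (C * Real.exp (k * |z|))) (ae_of_all (gaussianReal 0 1) fun ξ =>
      h s z (√s₁) ξ (Real.sqrt_le_sqrt hs))
  rw [integral_const_mul] at hb
  refine hb.trans ?_
  have hI : 0 ≤ ∫ ξ, Real.exp (k * √s₁ * |ξ|) ∂gaussianReal 0 1 :=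
    integral_nonneg fun ξ => (Real.exp_pos _).le
  calc _ = C * (∫ ξ, Real.exp (k * √s₁ * |ξ|) ∂gaussianReal 0 1) * Real.exp (k * |z|) := by ring
    _ ≤ _ := by
      gcongr
      exact Nat.le_ceil k

/-- `expBlock κ ε L` is the solution of the heat equation with initial value
`e^{κ z} 𝟙{ε z > L}`, where `ε = ±1`. -/
def expBlock (κ ε L s z : ℝ) : ℝ :=
  Real.exp (κ * z + κ ^ 2 / 2 * s) * normalCDF ((ε * (z + κ * s) - L) / √s)

/-- The initial value of `expBlock`. -/
def expStep (κ ε L z : ℝ) : ℝ := if L < ε * z then Real.exp (κ * z) else 0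

lemma expGrowth_expStep (κ ε L : ℝ) : ExpGrowth (expStep κ ε L) := by
  refine ⟨Measurable.ite (measurableSet_lt measurable_const (by fun_prop)) (by fun_prop)
    measurable_const, 1, |κ|, abs_nonneg _, fun z => ?_⟩
  rw [one_mul]
  unfold expStep
  split_ifs
  · rw [abs_of_pos (Real.exp_pos _), Real.exp_le_exp, ← abs_mul]
    exact le_abs_self _
  · simpa using (Real.exp_pos _).le

lemma heatEval_expStep (κ L : ℝ) {ε s : ℝ} (hε : ε = 1 ∨ ε = -1) (hs : 0 < s) (z : ℝ) :
    heatEval (expStep κ ε L) s z = expBlock κ ε L s z := by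
  have hsq : 0 < √s := Real.sqrt_pos.2 hs
  have hss : √s * √s = s := Real.mul_self_sqrt hs.le
  have h1 : ∀ ξ, expStep κ ε L (z + √s * ξ) = Real.exp (κ * z)
      * (Real.exp (κ * √s * ξ) * indicator {ξ | L < ε * (z + √s * ξ)} (fun _ => 1) ξ) := by
    intro ξ
    simp only [expStep, indicator, mem_ofPred_eq]
    split_ifs
    · rw [mul_one, ← Real.exp_add]
      ring_nf
    · simp
  have h2 : ∀ ξ, indicator {ξ | L < ε * (z + √s * ξ)} (fun _ => (1 : ℝ)) (ξ + κ * √s)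
      = indicator {ξ | -(ε * ξ) < (ε * (z + κ * s) - L) / √s} (fun _ => (1 : ℝ)) ξ := by
    intro ξ
    have : L < ε * (z + √s * (ξ + κ * √s)) ↔ -(ε * ξ) < (ε * (z + κ * s) - L) / √s := by
      rw [lt_div_iff₀ hsq]
      have e : ε * (z + √s * (ξ + κ * √s)) = ε * (z + κ * s) + ε * ξ * √s := by
        linear_combination ε * κ * hss
      rw [e]
      constructor <;> intro h <;> linarith
    simp only [indicator, mem_ofPred_eq, this]
  have hm : MeasurableSet {ξ : ℝ | -(ε * ξ) < (ε * (z + κ * s) - L) / √s} :=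
    measurableSet_lt (by fun_prop) measurable_const
  unfold heatEval expBlock
  simp_rw [h1]
  rw [integral_const_mul, integral_exp_mul_gaussianReal]
  simp_rw [h2]
  rw [integral_indicator hm, setIntegral_const, smul_eq_mul, mul_one, Real.exp_add, mul_assoc]
  congr 1
  congr 1
  · rw [mul_pow, Real.sq_sqrt hs.le]; ring_nf
  · rcases hε with rfl | rfl
    · simpa using gaussianReal_real_neg_lt _
    · simpa using gaussianReal_real_lt _

/-! ### Caloric functions -/

/-- `G` solves the heat equation `G_s = ½ G_zz` for `s > 0`. The derivatives `Gz = G_z` and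
`Gzz = G_zz` are part of the data; `G` is of class `C¹`, and `G_z` and `G_zz` are continuous. -/
structure IsCaloric (G Gz Gzz : ℝ → ℝ → ℝ) : Prop where
  contDiffAt : ∀ s z : ℝ, 0 < s → ContDiffAt ℝ 1 (fun p : ℝ × ℝ => G p.1 p.2) (s, z)
  hasDerivAt_time : ∀ s z : ℝ, 0 < s → HasDerivAt (fun w => G w z) (1 / 2 * Gzz s z) s
  hasDerivAt_space : ∀ s z : ℝ, 0 < s → HasDerivAt (G s) (Gz s z) z
  hasDerivAt_space2 : ∀ s z : ℝ, 0 < s → HasDerivAt (Gz s) (Gzz s z) z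
  continuousAt_space : ∀ s z : ℝ, 0 < s → ContinuousAt (fun p : ℝ × ℝ => Gz p.1 p.2) (s, z)
  continuousAt_space2 : ∀ s z : ℝ, 0 < s → ContinuousAt (fun p : ℝ × ℝ => Gzz p.1 p.2) (s, z)

namespace IsCaloric

variable {G Gz Gzz G' Gz' Gzz' : ℝ → ℝ → ℝ}

lemma one : IsCaloric (fun _ _ => 1) (fun _ _ => 0) (fun _ _ => 0) where
  contDiffAt _ _ _ := contDiffAt_const
  hasDerivAt_time s _ _ := by simpa using hasDerivAt_const s (1 : ℝ)
  hasDerivAt_space _ z _ := hasDerivAt_const z (1 : ℝ)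
  hasDerivAt_space2 _ z _ := hasDerivAt_const z (0 : ℝ)
  continuousAt_space _ _ _ := continuousAt_const
  continuousAt_space2 _ _ _ := continuousAt_const

lemma add (h : IsCaloric G Gz Gzz) (h' : IsCaloric G' Gz' Gzz') :
    IsCaloric (fun s z => G s z + G' s z) (fun s z => Gz s z + Gz' s z)
      (fun s z => Gzz s z + Gzz' s z) where
  contDiffAt s z hs := (h.contDiffAt s z hs).add (h'.contDiffAt s z hs)
  hasDerivAt_time s z hs := by
    rw [mul_add]
    exact (h.hasDerivAt_time s z hs).add (h'.hasDerivAt_time s z hs)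
  hasDerivAt_space s z hs := (h.hasDerivAt_space s z hs).add (h'.hasDerivAt_space s z hs)
  hasDerivAt_space2 s z hs := (h.hasDerivAt_space2 s z hs).add (h'.hasDerivAt_space2 s z hs)
  continuousAt_space s z hs := (h.continuousAt_space s z hs).add (h'.continuousAt_space s z hs)
  continuousAt_space2 s z hs := (h.continuousAt_space2 s z hs).add (h'.continuousAt_space2 s z hs)

lemma const_mul (h : IsCaloric G Gz Gzz) (m : ℝ) :
    IsCaloric (fun s z => m * G s z) (fun s z => m * Gz s z) (fun s z => m * Gzz s z) where
  contDiffAt s z hs := contDiffAt_const.mul (h.contDiffAt s z hs)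
  hasDerivAt_time s z hs := by
    rw [mul_left_comm]
    exact (h.hasDerivAt_time s z hs).const_mul m
  hasDerivAt_space s z hs := (h.hasDerivAt_space s z hs).const_mul m
  hasDerivAt_space2 s z hs := (h.hasDerivAt_space2 s z hs).const_mul m
  continuousAt_space s z hs := continuousAt_const.mul (h.continuousAt_space s z hs)
  continuousAt_space2 s z hs := continuousAt_const.mul (h.continuousAt_space2 s z hs)

lemma continuousAt (h : IsCaloric G Gz Gzz) {s z : ℝ} (hs : 0 < s) :
    ContinuousAt (fun p : ℝ × ℝ => G p.1 p.2) (s, z) :=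
  (h.contDiffAt s z hs).continuousAt

/-- The chain rule along a curve. -/
lemma hasDerivAt_comp (h : IsCaloric G Gz Gzz) {p q : ℝ → ℝ} {p' q' w : ℝ} (hw : 0 < p w)
    (hp : HasDerivAt p p' w) (hq : HasDerivAt q q' w) :
    HasDerivAt (fun y => G (p y) (q y))
      (1 / 2 * Gzz (p w) (q w) * p' + Gz (p w) (q w) * q') w := by
  have hd := ((h.contDiffAt (p w) (q w) hw).differentiableAt one_ne_zero).hasFDerivAt
  set A := fderiv ℝ (fun p : ℝ × ℝ => G p.1 p.2) (p w, q w)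
  have h1 : A (1, 0) = 1 / 2 * Gzz (p w) (q w) := by
    have e : HasDerivAt (fun y => (y, q w)) ((1 : ℝ), (0 : ℝ)) (p w) :=
      (hasDerivAt_id _).prodMk (hasDerivAt_const _ _)
    have h3 : HasDerivAt (fun y => G y (q w)) (A (1, 0)) (p w) :=
      hd.comp_hasDerivAt_of_eq (p w) e rfl
    exact h3.unique (h.hasDerivAt_time _ _ hw)
  have h2 : A (0, 1) = Gz (p w) (q w) := by
    have e : HasDerivAt (fun y => (p w, y)) ((0 : ℝ), (1 : ℝ)) (q w) :=
      (hasDerivAt_const _ _).prodMk (hasDerivAt_id _)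
    have h3 : HasDerivAt (G (p w)) (A (0, 1)) (q w) :=
      hd.comp_hasDerivAt_of_eq (q w) e rfl
    exact h3.unique (h.hasDerivAt_space _ _ hw)
  have h3 := HasFDerivAt.comp_hasDerivAt w hd (hp.prodMk hq)
  refine h3.congr_deriv ?_
  have e : ((p', q') : ℝ × ℝ) = p' • ((1 : ℝ), (0 : ℝ)) + q' • ((0 : ℝ), (1 : ℝ)) := by simp
  rw [e, map_add, map_smul, map_smul, h1, h2, smul_eq_mul, smul_eq_mul]
  ring

/-- The Galilean symmetry of the heat equation. -/
lemma galilean (h : IsCaloric G Gz Gzz) (κ : ℝ) :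
    IsCaloric (fun s z => Real.exp (κ * z + κ ^ 2 / 2 * s) * G s (z + κ * s))
      (fun s z => Real.exp (κ * z + κ ^ 2 / 2 * s) *
        (κ * G s (z + κ * s) + Gz s (z + κ * s)))
      (fun s z => Real.exp (κ * z + κ ^ 2 / 2 * s) *
        (κ ^ 2 * G s (z + κ * s) + 2 * κ * Gz s (z + κ * s) + Gzz s (z + κ * s))) where
  contDiffAt s z hs := by
    have h1 : ContDiffAt ℝ 1 (fun p : ℝ × ℝ => (p.1, p.2 + κ * p.1)) (s, z) := by fun_prop
    exact ContDiffAt.mul (by fun_prop)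
      (ContDiffAt.comp (g := fun p : ℝ × ℝ => G p.1 p.2) (s, z) (h.contDiffAt s _ hs) h1)
  hasDerivAt_time s z hs := by
    have h1 : HasDerivAt (fun w => κ * z + κ ^ 2 / 2 * w) (κ ^ 2 / 2) s := by
      simpa using ((hasDerivAt_id s).const_mul (κ ^ 2 / 2)).const_add (κ * z)
    have h2 : HasDerivAt (fun w => z + κ * w) κ s := by
      simpa using ((hasDerivAt_id s).const_mul κ).const_add z
    refine (h1.exp.mul (h.hasDerivAt_comp hs (hasDerivAt_id s) h2)).congr_deriv ?_
    simp only [id_eq]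
    ring
  hasDerivAt_space s z hs := by
    have h1 : HasDerivAt (fun w => κ * w + κ ^ 2 / 2 * s) κ z := by
      simpa using ((hasDerivAt_id z).const_mul κ).add_const (κ ^ 2 / 2 * s)
    refine (h1.exp.mul ((h.hasDerivAt_space s (z + κ * s) hs).comp_add_const z (κ * s))).congr_deriv
      ?_
    ring
  hasDerivAt_space2 s z hs := by
    have h1 : HasDerivAt (fun w => κ * w + κ ^ 2 / 2 * s) κ z := by
      simpa using ((hasDerivAt_id z).const_mul κ).add_const (κ ^ 2 / 2 * s)
    refine (h1.exp.mul ((((h.hasDerivAt_space s (z + κ * s) hs).comp_add_const z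
      (κ * s)).const_mul κ).add
      ((h.hasDerivAt_space2 s (z + κ * s) hs).comp_add_const z (κ * s)))).congr_deriv ?_
    simp only [Pi.add_apply]
    ring
  continuousAt_space s z hs := by
    have h1 : ContinuousAt (fun p : ℝ × ℝ => (p.1, p.2 + κ * p.1)) (s, z) := by fun_prop
    have hG := ContinuousAt.comp_of_eq (y := (s, z + κ * s)) (g := fun p : ℝ × ℝ => G p.1 p.2)
      (h.continuousAt hs) h1 rfl
    have hG1 := ContinuousAt.comp_of_eq (y := (s, z + κ * s)) (g := fun p : ℝ × ℝ => Gz p.1 p.2)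
      (h.continuousAt_space s _ hs) h1 rfl
    exact ContinuousAt.mul (by fun_prop) ((continuousAt_const.mul hG).add hG1)
  continuousAt_space2 s z hs := by
    have h1 : ContinuousAt (fun p : ℝ × ℝ => (p.1, p.2 + κ * p.1)) (s, z) := by fun_prop
    have hG := ContinuousAt.comp_of_eq (y := (s, z + κ * s)) (g := fun p : ℝ × ℝ => G p.1 p.2)
      (h.continuousAt hs) h1 rfl
    have hG1 := ContinuousAt.comp_of_eq (y := (s, z + κ * s)) (g := fun p : ℝ × ℝ => Gz p.1 p.2)
      (h.continuousAt_space s _ hs) h1 rfl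
    have hG2 := ContinuousAt.comp_of_eq (y := (s, z + κ * s)) (g := fun p : ℝ × ℝ => Gzz p.1 p.2)
      (h.continuousAt_space2 s _ hs) h1 rfl
    exact ContinuousAt.mul (by fun_prop)
      (((continuousAt_const.mul hG).add (continuousAt_const.mul hG1)).add hG2)

lemma exp (κ : ℝ) : ∃ Gz Gzz, IsCaloric (fun s z => Real.exp (κ * z + κ ^ 2 / 2 * s)) Gz Gzz := by
  have h := one.galilean κ
  simp only [mul_one] at h
  exact ⟨_, _, h⟩

end IsCaloric

lemma contDiff_normalCDF : ContDiff ℝ 1 normalCDF := by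
  have hd : deriv normalCDF = gaussianPDFReal 0 1 := funext fun z => (hasDerivAt_normalCDF z).deriv
  rw [contDiff_one_iff_deriv, hd]
  exact ⟨fun z => (hasDerivAt_normalCDF z).differentiableAt, continuous_gaussianPDFReal 0 1⟩

lemma isCaloric_normalCDF {ε : ℝ} (hε : ε ^ 2 = 1) (L : ℝ) :
    IsCaloric (fun s z => normalCDF ((ε * z - L) / √s))
      (fun s z => gaussianPDFReal 0 1 ((ε * z - L) / √s) * (ε / √s))
      (fun s z => -((ε * z - L) / √s) * gaussianPDFReal 0 1 ((ε * z - L) / √s) / s) where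
  contDiffAt s z hs := by
    refine contDiff_normalCDF.contDiffAt.comp (s, z)
      (ContDiffAt.div (by fun_prop) (contDiffAt_fst.sqrt hs.ne') (Real.sqrt_pos.2 hs).ne')
  hasDerivAt_time s z hs := by
    have hsq := Real.sqrt_pos.2 hs
    have h1 := ((hasDerivAt_const s (ε * z - L)).div ((hasDerivAt_id s).sqrt hs.ne') hsq.ne')
    refine ((hasDerivAt_normalCDF ((ε * z - L) / √s)).comp s h1).congr_deriv ?_
    have e : √s ^ 2 = s := Real.sq_sqrt hs.le
    simp only [id_eq, e]
    field_simp
    ring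
  hasDerivAt_space s z hs := by
    have h1 : HasDerivAt (fun w => (ε * w - L) / √s) (ε / √s) z := by
      simpa using (((hasDerivAt_id z).const_mul ε).sub_const L).div_const (√s)
    exact (hasDerivAt_normalCDF ((ε * z - L) / √s)).comp z h1
  hasDerivAt_space2 s z hs := by
    have h1 : HasDerivAt (fun w => (ε * w - L) / √s) (ε / √s) z := by
      simpa using (((hasDerivAt_id z).const_mul ε).sub_const L).div_const (√s)
    refine (((hasDerivAt_gaussianPDFReal ((ε * z - L) / √s)).comp z h1).mul_const
      (ε / √s)).congr_deriv ?_
    have e : (ε / √s) * (ε / √s) = 1 / s := by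
      rw [div_mul_div_comm, Real.mul_self_sqrt hs.le, ← sq, hε]
    rw [mul_assoc, e]
    ring
  continuousAt_space s z hs := by
    have hsq := (Real.sqrt_pos.2 hs).ne'
    have hc := continuous_gaussianPDFReal 0 1
    fun_prop (disch := assumption)
  continuousAt_space2 s z hs := by
    have hsq := (Real.sqrt_pos.2 hs).ne'
    have hs' := hs.ne'
    have hc := continuous_gaussianPDFReal 0 1
    fun_prop (disch := assumption)

lemma isCaloric_expBlock (κ : ℝ) {ε : ℝ} (hε : ε ^ 2 = 1) (L : ℝ) :
    ∃ Gz Gzz, IsCaloric (expBlock κ ε L) Gz Gzz :=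
  ⟨_, _, (isCaloric_normalCDF hε L).galilean κ⟩

/-- The heat kernel issued from `(-δ, 0)`, normalised to be `1` at the origin:
`√(δ / (s + δ)) e^{-z² / (2 (s + δ))}`. -/
def heatBump (δ s z : ℝ) : ℝ := Real.exp (-(Real.log ((s + δ) / δ) + z ^ 2 / (s + δ)) / 2)

lemma isCaloric_heatBump {δ : ℝ} (hδ : 0 < δ) :
    ∃ Gz Gzz, IsCaloric (heatBump δ) Gz Gzz := by
  refine ⟨fun s z => heatBump δ s z * (-(z / (s + δ))),
    fun s z => heatBump δ s z * (z ^ 2 / (s + δ) ^ 2 - 1 / (s + δ)), ?_⟩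
  have hpos : ∀ s : ℝ, 0 < s → (s + δ) / δ ≠ 0 := fun s hs => by positivity
  have hne : ∀ s : ℝ, 0 < s → s + δ ≠ 0 := fun s hs => by positivity
  have hne2 : ∀ s : ℝ, 0 < s → (s + δ) ^ 2 ≠ 0 := fun s hs => by positivity
  have hC : ∀ s z : ℝ, 0 < s → ContDiffAt ℝ 1 (fun p : ℝ × ℝ => heatBump δ p.1 p.2) (s, z) := by
    intro s z hs
    have h1 := hpos s hs
    have h2 := hne s hs
    unfold heatBump
    fun_prop (disch := assumption)
  have hz : ∀ s z : ℝ, HasDerivAt (heatBump δ s) (heatBump δ s z * (-(z / (s + δ)))) z := by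
    intro s z
    refine (((((hasDerivAt_id z).pow 2).div_const (s + δ)).const_add
      (Real.log ((s + δ) / δ))).neg.div_const 2).exp.congr_deriv ?_
    simp only [heatBump, id_eq, Pi.pow_apply, Pi.neg_apply]
    ring
  refine ⟨hC, fun s z hs => ?_, fun s z hs => hz s z, fun s z hs => ?_, fun s z hs => ?_,
    fun s z hs => ?_⟩
  · have h2 := hne s hs
    have e1 : HasDerivAt (fun w => w + δ) 1 s := (hasDerivAt_id s).add_const δ
    refine ((((e1.div_const δ).log (hpos s hs)).add
      ((hasDerivAt_const s (z ^ 2)).div e1 h2)).neg.div_const 2).exp.congr_deriv ?_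
    simp only [heatBump, Pi.add_apply, Pi.neg_apply, Pi.div_apply]
    field_simp
    ring
  · have h2 := hne s hs
    refine ((hz s z).mul ((hasDerivAt_id z).div_const (s + δ)).neg).congr_deriv ?_
    simp only [id_eq, Pi.neg_apply]
    field_simp
    ring
  · have h2 := hne s hs
    exact (hC s z hs).continuousAt.mul (by fun_prop (disch := assumption))
  · have h2 := hne s hs
    have h3 := hne2 s hs
    exact (hC s z hs).continuousAt.mul (by fun_prop (disch := assumption))

/-! ### The integrated variance in closed form -/

section Variance

variable {a c r T H₁ β t u v x : ℝ}

/-- The argument of the logarithm in `logVol`. -/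
def volDenom (a c t v u : ℝ) : ℝ :=
  1 + c / (2 * a) * Real.exp (2 * v) * (Real.exp (2 * a * (u - t)) - 1)

lemma one_le_volDenom (ha : 0 < a) (hc : 0 < c) (htu : t ≤ u) (v : ℝ) :
    1 ≤ volDenom a c t v u := by
  have h1 : 1 ≤ Real.exp (2 * a * (u - t)) :=
    Real.one_le_exp (mul_nonneg (by positivity) (by linarith))
  exact le_add_of_nonneg_right (mul_nonneg (by positivity) (by linarith))

lemma one_lt_volDenom (ha : 0 < a) (hc : 0 < c) (htu : t < u) (v : ℝ) :
    1 < volDenom a c t v u := by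
  have h1 : 1 < Real.exp (2 * a * (u - t)) :=
    Real.one_lt_exp_iff.2 (mul_pos (by positivity) (by linarith))
  exact lt_add_of_pos_right _ (mul_pos (by positivity) (by linarith))

lemma exp_two_mul_logVol (ha : 0 < a) (hc : 0 < c) (htu : t ≤ u) (v : ℝ) :
    Real.exp (2 * logVol a c t v u)
      = Real.exp (2 * v) * Real.exp (2 * a * (u - t)) / volDenom a c t v u := by
  have h2 : 2 * logVol a c t v u = 2 * v + 2 * a * (u - t) - Real.log (volDenom a c t v u) := by
    unfold logVol volDenom
    ring
  rw [h2, Real.exp_sub, Real.exp_add,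
    Real.exp_log (zero_lt_one.trans_le (one_le_volDenom ha hc htu v))]

lemma hasDerivAt_log_volDenom (ha : 0 < a) (hc : 0 < c) (htu : t ≤ u) (v : ℝ) :
    HasDerivAt (fun w => 1 / c * Real.log (volDenom a c t v w))
      (Real.exp (2 * logVol a c t v u)) u := by
  have hpos := zero_lt_one.trans_le (one_le_volDenom ha hc htu v)
  have hl : HasDerivAt (fun w => 2 * a * (w - t)) (2 * a) u := by
    simpa using ((hasDerivAt_id u).sub_const t).const_mul (2 * a)
  have hd := ((((hl.exp.sub_const 1).const_mul
    (c / (2 * a) * Real.exp (2 * v))).const_add 1).log hpos.ne').const_mul (1 / c)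
  refine hd.congr_deriv ?_
  rw [exp_two_mul_logVol ha hc htu]
  unfold volDenom
  field_simp

lemma continuousOn_logVol (ha : 0 < a) (hc : 0 < c) (t v : ℝ) :
    ContinuousOn (logVol a c t v) (Ici t) := fun _ hu =>
  (hasDerivAt_logVol ha hc hu v).continuousAt.continuousWithinAt

lemma gammaSq_eq (ha : 0 < a) (hc : 0 < c) (htu : t ≤ u) (v : ℝ) :
    gammaSq a c t u v = 1 / c * Real.log (volDenom a c t v u) := by
  have hsub : uIcc t u ⊆ Ici t := by
    rw [uIcc_of_le htu]; exact Icc_subset_Ici_self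
  rw [gammaSq, intervalIntegral.integral_eq_sub_of_hasDerivAt
    (fun w hw => hasDerivAt_log_volDenom ha hc (hsub hw) v)
    (((continuousOn_logVol ha hc t v).mono hsub).const_mul 2 |>.rexp.intervalIntegrable)]
  simp [volDenom]

lemma gammaSq_self : gammaSq a c t t v = 0 := by simp [gammaSq]

lemma gammaSq_nonneg (htu : t ≤ u) : 0 ≤ gammaSq a c t u v :=
  intervalIntegral.integral_nonneg htu fun _ _ => (Real.exp_pos _).le

lemma gammaSq_pos (ha : 0 < a) (hc : 0 < c) (htu : t < u) (v : ℝ) :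
    0 < gammaSq a c t u v := by
  rw [gammaSq_eq ha hc htu.le]
  exact mul_pos (by positivity) (Real.log_pos (one_lt_volDenom ha hc htu v))

/-- The integrated variance is additive along the path of the log-volatility. -/
lemma gammaSq_logVol (ha : 0 < a) (hc : 0 < c) (htu : t ≤ u) (huT : u ≤ T) (v : ℝ) :
    gammaSq a c u T (logVol a c t v u) = gammaSq a c t T v - gammaSq a c t u v := by
  have h1 := zero_lt_one.trans_le (one_le_volDenom ha hc htu v)
  have h2 := zero_lt_one.trans_le (one_le_volDenom ha hc (htu.trans huT) v)
  rw [gammaSq_eq ha hc huT, gammaSq_eq ha hc (htu.trans huT), gammaSq_eq ha hc htu,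
    ← mul_sub, ← Real.log_div h2.ne' h1.ne']
  congr 2
  have e : Real.exp (2 * a * (T - t))
      = Real.exp (2 * a * (u - t)) * Real.exp (2 * a * (T - u)) := by
    rw [← Real.exp_add]; ring_nf
  rw [volDenom, exp_two_mul_logVol ha hc htu, eq_div_iff h1.ne']
  have e2 : ∀ A B D : ℝ, D ≠ 0 → (1 + c / (2 * a) * (A / D) * B) * D = D + c / (2 * a) * A * B := by
    intro A B D hD
    field_simp
  rw [e2 _ _ _ h1.ne']
  unfold volDenom
  rw [e]
  ring

lemma contDiff_volDenom : ContDiff ℝ 1 fun p : ℝ × ℝ => volDenom a c p.1 p.2 T := by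
  unfold volDenom
  fun_prop

lemma contDiffAt_gammaSq (ha : 0 < a) (hc : 0 < c) (htT : t < T) (v : ℝ) :
    ContDiffAt ℝ 1 (fun p : ℝ × ℝ => gammaSq a c p.1 T p.2) (t, v) := by
  have h1 : ContDiffAt ℝ 1 (fun p : ℝ × ℝ => 1 / c * Real.log (volDenom a c p.1 p.2 T)) (t, v) :=
    contDiffAt_const.mul (contDiff_volDenom.contDiffAt.log
      (zero_lt_one.trans (one_lt_volDenom ha hc htT v)).ne')
  refine h1.congr_of_eventuallyEq ?_
  filter_upwards [continuousAt_fst.eventually_lt_const htT] with p hp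
  exact gammaSq_eq ha hc hp.le _

lemma continuousOn_gammaSq (ha : 0 < a) (hc : 0 < c) :
    ContinuousOn (fun p : ℝ × ℝ => gammaSq a c p.1 T p.2) {p | p.1 ≤ T} := by
  have h1 : ContinuousOn (fun p : ℝ × ℝ => 1 / c * Real.log (volDenom a c p.1 p.2 T))
      {p | p.1 ≤ T} :=
    continuousOn_const.mul (contDiff_volDenom.continuous.continuousOn.log fun p hp =>
      (zero_lt_one.trans_le (one_le_volDenom ha hc hp p.2)).ne')
  exact h1.congr fun p hp => gammaSq_eq ha hc hp _

lemma hasDerivAt_gammaSq_time (ha : 0 < a) (hc : 0 < c) (htT : t < T) (v : ℝ) :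
    HasDerivAt (fun w => gammaSq a c w T v)
      (-(Real.exp (2 * v) * Real.exp (2 * a * (T - t)) / volDenom a c t v T)) t := by
  have hpos := zero_lt_one.trans (one_lt_volDenom ha hc htT v)
  have hl : HasDerivAt (fun w => 2 * a * (T - w)) (-(2 * a)) t := by
    simpa using ((hasDerivAt_id t).const_sub T).const_mul (2 * a)
  have hd := ((((hl.exp.sub_const 1).const_mul
    (c / (2 * a) * Real.exp (2 * v))).const_add 1).log hpos.ne').const_mul (1 / c)
  refine (hd.congr_deriv ?_).congr_of_eventuallyEq ?_
  · unfold volDenom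
    field_simp
  · filter_upwards [eventually_lt_nhds htT] with w hw
    exact gammaSq_eq ha hc hw.le _

lemma hasDerivAt_gammaSq_vol (ha : 0 < a) (hc : 0 < c) (htT : t < T) (v : ℝ) :
    HasDerivAt (fun w => gammaSq a c t T w)
      (Real.exp (2 * v) * (Real.exp (2 * a * (T - t)) - 1) / (a * volDenom a c t v T)) v := by
  have hpos := zero_lt_one.trans (one_lt_volDenom ha hc htT v)
  have hl : HasDerivAt (fun w : ℝ => 2 * w) 2 v := by
    simpa using (hasDerivAt_id v).const_mul 2
  have hd := ((((hl.exp.const_mul (c / (2 * a))).mul_const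
    (Real.exp (2 * a * (T - t)) - 1)).const_add 1).log hpos.ne').const_mul (1 / c)
  refine (hd.congr_deriv ?_).congr_of_eventuallyEq ?_
  · unfold volDenom
    field_simp
  · exact Eventually.of_forall fun w => gammaSq_eq ha hc htT.le _

/-- The transport equation `(∂_t + (a - (c/2) e^{2v}) ∂_v) γ²(t,T,v) = -e^{2v}`, for the partial
derivatives of `hasDerivAt_gammaSq_time` and `hasDerivAt_gammaSq_vol`. -/
lemma gammaSq_transport (ha : 0 < a) (hc : 0 < c) (htT : t < T) (v : ℝ) :
    -(Real.exp (2 * v) * Real.exp (2 * a * (T - t)) / volDenom a c t v T)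
      + (a - c / 2 * Real.exp (2 * v)) *
        (Real.exp (2 * v) * (Real.exp (2 * a * (T - t)) - 1) / (a * volDenom a c t v T))
      = -Real.exp (2 * v) := by
  have hpos := zero_lt_one.trans (one_lt_volDenom ha hc htT v)
  rw [neg_add_eq_sub, sub_eq_iff_eq_add]
  have e : volDenom a c t v T = 1 + c / (2 * a) * Real.exp (2 * v)
    * (Real.exp (2 * a * (T - t)) - 1) := rfl
  generalize volDenom a c t v T = D at *
  generalize Real.exp (2 * a * (T - t)) = E at *
  generalize Real.exp (2 * v) = A at *
  field_simp
  rw [e]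
  field_simp
  ring

lemma barrier_pos (hH : 0 < H₁) (t v : ℝ) : 0 < barrier a c r T H₁ β t v :=
  mul_pos hH (Real.exp_pos _)

lemma barrier_terminal (v : ℝ) : barrier a c r T H₁ β T v = H₁ := by
  simp [barrier, gammaSq_self]

lemma continuousOn_barrier (ha : 0 < a) (hc : 0 < c) :
    ContinuousOn (fun p : ℝ × ℝ => barrier a c r T H₁ β p.1 p.2) {p | p.1 ≤ T} := by
  have h := continuousOn_gammaSq (T := T) ha hc
  unfold barrier
  fun_prop

lemma isOpen_openDomain (ha : 0 < a) (hc : 0 < c) : IsOpen (openDomain a c r T H₁ β) := by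
  rw [isOpen_iff_mem_nhds]
  rintro ⟨t, x, v⟩ ⟨h0, hT, hx⟩
  have hb : ContinuousAt (fun p : ℝ × ℝ => barrier a c r T H₁ β p.1 p.2) (t, v) :=
    (continuousOn_barrier ha hc).continuousAt
      (mem_of_superset (continuousAt_fst.eventually_lt_const hT) fun p (hp : p.1 < T) => hp.le)
  have hb' : ContinuousAt (fun p : ℝ × ℝ × ℝ => barrier a c r T H₁ β p.1 p.2.2) (t, x, v) :=
    ContinuousAt.comp_of_eq (g := fun p : ℝ × ℝ => barrier a c r T H₁ β p.1 p.2)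
      (f := fun p : ℝ × ℝ × ℝ => (p.1, p.2.2)) hb (by fun_prop) rfl
  have hx' : ContinuousAt (fun p : ℝ × ℝ × ℝ => p.2.1) (t, x, v) := by fun_prop
  filter_upwards [continuousAt_fst.eventually_const_lt h0, continuousAt_fst.eventually_lt_const hT,
    hb'.eventually_lt hx' hx] with p h1 h2 h3
  exact ⟨h1, h2, h3⟩

end Variance

/-! ### From the heat equation to the pricing equation -/

/-- `f` is of class `C¹` at `(t,x,v)`, twice differentiable in `x` there, and
`(∂_t + 𝓛₀) f = ρ` holds at this point. -/
structure SolvesAt (a c r : ℝ) (f : ℝ → ℝ → ℝ → ℝ) (ρ t x v : ℝ) : Prop where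
  contDiffAt : ContDiffAt ℝ 1 (fun p : ℝ × ℝ × ℝ => f p.1 p.2.1 p.2.2) (t, x, v)
  differentiableAt_deriv : DifferentiableAt ℝ (deriv (fun y => f t y v)) x
  pde : deriv (fun s => f s x v) t + opL0 a c r (f t) x v = ρ

namespace SolvesAt

variable {a c r ρ ρ' t x v : ℝ} {f g : ℝ → ℝ → ℝ → ℝ}

lemma eventually_differentiableAt (h : SolvesAt a c r f ρ t x v) :
    ∀ᶠ y in 𝓝 x, DifferentiableAt ℝ (fun y => f t y v) y := by
  have h1 := h.contDiffAt.eventually (by simp)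
  have h2 : ContinuousAt (fun y : ℝ => (t, y, v)) x := by fun_prop
  filter_upwards [h2.eventually h1] with y hy
  exact DifferentiableAt.comp (g := fun p : ℝ × ℝ × ℝ => f p.1 p.2.1 p.2.2)
    (f := fun y : ℝ => (t, y, v)) y (hy.differentiableAt one_ne_zero) (by fun_prop)

lemma differentiableAt_time (h : SolvesAt a c r f ρ t x v) :
    DifferentiableAt ℝ (fun s => f s x v) t :=
  DifferentiableAt.comp (g := fun p : ℝ × ℝ × ℝ => f p.1 p.2.1 p.2.2)
    (f := fun s : ℝ => (s, x, v)) t (h.contDiffAt.differentiableAt one_ne_zero) (by fun_prop)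

lemma differentiableAt_vol (h : SolvesAt a c r f ρ t x v) :
    DifferentiableAt ℝ (fun w => f t x w) v :=
  DifferentiableAt.comp (g := fun p : ℝ × ℝ × ℝ => f p.1 p.2.1 p.2.2)
    (f := fun w : ℝ => (t, x, w)) v (h.contDiffAt.differentiableAt one_ne_zero) (by fun_prop)

/-- The chain rule along a curve at fixed `x`. -/
lemma hasDerivAt_curve (h : SolvesAt a c r f ρ t x v) {V : ℝ → ℝ} {V' : ℝ} (hV : HasDerivAt V V' t)
    (hVt : V t = v) :
    HasDerivAt (fun s => f s x (V s))
      (deriv (fun s => f s x v) t + V' * deriv (fun w => f t x w) v) t := by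
  have hd := (h.contDiffAt.differentiableAt one_ne_zero).hasFDerivAt
  set A := fderiv ℝ (fun p : ℝ × ℝ × ℝ => f p.1 p.2.1 p.2.2) (t, x, v)
  have h1 : HasDerivAt (fun s => f s x v) (A (1, 0, 0)) t :=
    hd.comp_hasDerivAt_of_eq t ((hasDerivAt_id t).prodMk
      ((hasDerivAt_const t x).prodMk (hasDerivAt_const t v))) rfl
  have h2 : HasDerivAt (fun w => f t x w) (A (0, 0, 1)) v :=
    hd.comp_hasDerivAt_of_eq v ((hasDerivAt_const v t).prodMk
      ((hasDerivAt_const v x).prodMk (hasDerivAt_id v))) rfl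
  have h3 : HasDerivAt (fun s => f s x (V s)) (A (1, 0, V')) t :=
    hd.comp_hasDerivAt_of_eq t ((hasDerivAt_id t).prodMk
      ((hasDerivAt_const t x).prodMk hV)) (by simp [hVt])
  rw [h1.deriv, h2.deriv]
  refine h3.congr_deriv ?_
  have e : ((1, 0, V') : ℝ × ℝ × ℝ) = (1, 0, 0) + V' • ((0, 0, 1) : ℝ × ℝ × ℝ) := by simp
  rw [e, map_add, map_smul, smul_eq_mul]

lemma add_const_mul (hf : SolvesAt a c r f ρ t x v) (hg : SolvesAt a c r g ρ' t x v) (m : ℝ) :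
    SolvesAt a c r (fun t x v => f t x v + m * g t x v) (ρ + m * ρ') t x v := by
  have hev : deriv (fun y => f t y v + m * g t y v) =ᶠ[𝓝 x]
      fun y => deriv (fun y => f t y v) y + m * deriv (fun y => g t y v) y := by
    filter_upwards [hf.eventually_differentiableAt, hg.eventually_differentiableAt] with y h1 h2
    exact (h1.hasDerivAt.add (h2.hasDerivAt.const_mul m)).deriv
  have hdd := hf.differentiableAt_deriv.hasDerivAt.add
    (hg.differentiableAt_deriv.hasDerivAt.const_mul m)
  refine ⟨hf.contDiffAt.add (contDiffAt_const.mul hg.contDiffAt),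
    (hdd.differentiableAt).congr_of_eventuallyEq hev, ?_⟩
  have h1 := (hf.differentiableAt_time.hasDerivAt.add
    (hg.differentiableAt_time.hasDerivAt.const_mul m)).deriv
  have h2 := (hf.differentiableAt_vol.hasDerivAt.add
    (hg.differentiableAt_vol.hasDerivAt.const_mul m)).deriv
  have h3 := hev.eq_of_nhds
  have h4 := hev.deriv_eq.trans hdd.deriv
  have e1 := hf.pde
  have e2 := hg.pde
  simp only [opL0, iteratedDeriv_succ, iteratedDeriv_zero] at *
  rw [h4, h3]
  have h1' : deriv (fun s => f s x v + m * g s x v) t = _ := h1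
  have h2' : deriv (fun w => f t x w + m * g t x w) v = _ := h2
  rw [h1', h2']
  linear_combination e1 + m * e2

end SolvesAt

/-- The function `e^{-r(T-t)} G(γ²(t,T,v), log(x/H₁) + r(T-t) - γ²(t,T,v)/2)`: in these
variables the pricing equation `(∂_t + 𝓛₀) f = 0` becomes the heat equation. -/
def heatLift (a c r T H₁ : ℝ) (G : ℝ → ℝ → ℝ) (t x v : ℝ) : ℝ :=
  Real.exp (-r * (T - t)) *
    G (gammaSq a c t T v) (Real.log (x / H₁) + r * (T - t) - 1 / 2 * gammaSq a c t T v)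

section Lift

variable {a c r T H₁ t x v : ℝ} {G Gz Gzz : ℝ → ℝ → ℝ}

lemma hasDerivAt_log_div (hH : 0 < H₁) (hx : 0 < x) (m : ℝ) :
    HasDerivAt (fun y => Real.log (y / H₁) + m) (1 / x) x := by
  refine ((((hasDerivAt_id x).div_const H₁).log (by positivity)).add_const m).congr_deriv ?_
  simp only [id_eq]
  field_simp

lemma IsCaloric.hasDerivAt_heatLift (h : IsCaloric G Gz Gzz) (ha : 0 < a) (hc : 0 < c)
    (hH : 0 < H₁) (htT : t < T) (hx : 0 < x) :
    HasDerivAt (fun y => heatLift a c r T H₁ G t y v) (heatLift a c r T H₁ Gz t x v / x) x := by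
  have h1 := hasDerivAt_log_div hH hx (r * (T - t) - 1 / 2 * gammaSq a c t T v)
  simp only [← add_sub_assoc] at h1
  refine (((h.hasDerivAt_space _ _ (gammaSq_pos ha hc htT v)).comp x h1).const_mul
    (Real.exp (-r * (T - t)))).congr_deriv ?_
  unfold heatLift
  ring

lemma IsCaloric.hasDerivAt_deriv_heatLift (h : IsCaloric G Gz Gzz) (ha : 0 < a) (hc : 0 < c)
    (hH : 0 < H₁) (htT : t < T) (hx : 0 < x) :
    HasDerivAt (deriv fun y => heatLift a c r T H₁ G t y v)
      ((heatLift a c r T H₁ Gzz t x v - heatLift a c r T H₁ Gz t x v) / x ^ 2) x := by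
  have h1 := hasDerivAt_log_div hH hx (r * (T - t) - 1 / 2 * gammaSq a c t T v)
  simp only [← add_sub_assoc] at h1
  have h2 := (((h.hasDerivAt_space2 _ _ (gammaSq_pos ha hc htT v)).comp x h1).const_mul
    (Real.exp (-r * (T - t)))).div (hasDerivAt_id x) hx.ne'
  refine (h2.congr_deriv ?_).congr_of_eventuallyEq ?_
  · simp only [heatLift, id_eq, Function.comp_apply]
    field_simp
  · filter_upwards [eventually_gt_nhds hx] with y hy
    exact (h.hasDerivAt_heatLift ha hc hH htT hy).deriv

lemma contDiffAt_heatCoord (ha : 0 < a) (hc : 0 < c) (hH : 0 < H₁) (htT : t < T) (hx : 0 < x) :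
    ContDiffAt ℝ 1 (fun p : ℝ × ℝ × ℝ => (gammaSq a c p.1 T p.2.2,
      Real.log (p.2.1 / H₁) + r * (T - p.1) - 1 / 2 * gammaSq a c p.1 T p.2.2)) (t, x, v) := by
  have h1 : ContDiffAt ℝ 1 (fun p : ℝ × ℝ × ℝ => gammaSq a c p.1 T p.2.2) (t, x, v) :=
    ContDiffAt.comp (g := fun p : ℝ × ℝ => gammaSq a c p.1 T p.2)
      (f := fun p : ℝ × ℝ × ℝ => (p.1, p.2.2)) (t, x, v) (contDiffAt_gammaSq ha hc htT v)
      (by fun_prop)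
  have h2 : ContDiffAt ℝ 1 (fun p : ℝ × ℝ × ℝ => Real.log (p.2.1 / H₁)) (t, x, v) :=
    ContDiffAt.log (by fun_prop) (by positivity)
  fun_prop

lemma IsCaloric.contDiffAt_heatLift (h : IsCaloric G Gz Gzz) (ha : 0 < a) (hc : 0 < c)
    (hH : 0 < H₁) (htT : t < T) (hx : 0 < x) :
    ContDiffAt ℝ 1 (fun p : ℝ × ℝ × ℝ => heatLift a c r T H₁ G p.1 p.2.1 p.2.2) (t, x, v) :=
  ContDiffAt.mul (by fun_prop) (ContDiffAt.comp (g := fun p : ℝ × ℝ => G p.1 p.2) (t, x, v)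
    (h.contDiffAt _ _ (gammaSq_pos ha hc htT v)) (contDiffAt_heatCoord ha hc hH htT hx))

lemma continuousAt_heatLift (ha : 0 < a) (hc : 0 < c)
    (hH : 0 < H₁) (htT : t < T) (hx : 0 < x)
    (h : ∀ s z : ℝ, 0 < s → ContinuousAt (fun p : ℝ × ℝ => G p.1 p.2) (s, z)) :
    ContinuousAt (fun p : ℝ × ℝ × ℝ => heatLift a c r T H₁ G p.1 p.2.1 p.2.2) (t, x, v) :=
  ContinuousAt.mul (by fun_prop) (ContinuousAt.comp_of_eq (g := fun p : ℝ × ℝ => G p.1 p.2)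
    (h _ _ (gammaSq_pos ha hc htT v)) (contDiffAt_heatCoord ha hc hH htT hx).continuousAt rfl)

/-- Caloric functions lift to solutions of the pricing equation. -/
lemma IsCaloric.solvesAt_heatLift (h : IsCaloric G Gz Gzz) (ha : 0 < a) (hc : 0 < c)
    (hH : 0 < H₁) (htT : t < T) (hx : 0 < x) (v : ℝ) :
    SolvesAt a c r (heatLift a c r T H₁ G) 0 t x v := by
  have hs := gammaSq_pos ha hc htT v
  refine ⟨h.contDiffAt_heatLift ha hc hH htT hx,
    (h.hasDerivAt_deriv_heatLift ha hc hH htT hx).differentiableAt, ?_⟩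
  have hr : HasDerivAt (fun w => r * (T - w)) (-r) t := by
    simpa using ((hasDerivAt_id t).const_sub T).const_mul r
  have hr' : HasDerivAt (fun w => -r * (T - w)) r t := by
    simpa using ((hasDerivAt_id t).const_sub T).const_mul (-r)
  have g1 := hasDerivAt_gammaSq_time ha hc htT v
  have g2 := hasDerivAt_gammaSq_vol ha hc htT v
  have ht := (hr'.exp.mul (h.hasDerivAt_comp hs g1
    ((hr.const_add (Real.log (x / H₁))).sub (g1.const_mul (1 / 2))))).deriv
  have hv := ((h.hasDerivAt_comp hs g2 ((g2.const_mul (1 / 2)).const_sub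
    (Real.log (x / H₁) + r * (T - t)))).const_mul (Real.exp (-r * (T - t)))).deriv
  have ht' : deriv (fun s => heatLift a c r T H₁ G s x v) t = _ := ht
  have hv' : deriv (fun w => heatLift a c r T H₁ G t x w) v = _ := hv
  have hk := gammaSq_transport ha hc htT v
  simp only [opL0, iteratedDeriv_succ, iteratedDeriv_zero]
  rw [(h.hasDerivAt_deriv_heatLift ha hc hH htT hx).deriv,
    (h.hasDerivAt_heatLift ha hc hH htT hx).deriv, ht', hv']
  simp only [heatLift, Pi.sub_apply]
  set S := gammaSq a c t T v
  set Z := Real.log (x / H₁) + r * (T - t) - 1 / 2 * S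
  have e1 : ∀ A B : ℝ, x ^ 2 / 2 * A * (B / x ^ 2) = A / 2 * B := fun A B => by field_simp
  have e2 : ∀ B : ℝ, r * x * (B / x) = r * B := fun B => by field_simp
  rw [e1, e2]
  linear_combination (Real.exp (-r * (T - t)) * (1 / 2 * Gzz S Z - 1 / 2 * Gz S Z)) * hk

end Lift

/-! ### The closed form solves the terminal and boundary value problem -/

/-- The level `log((K ∨ H₁) / H₁)` of `log(S_T / H₁)` above which the down-and-out call pays. -/
def strikeLevel (K H₁ : ℝ) : ℝ := Real.log (max K H₁ / H₁)

/-- The terminal value `(H₁ e^z - K)⁺` of the call on `z > 0`, extended to `z < 0` by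
`g(-z) = -e^{2βz} g(z)`. The extension makes `heatEval g s (β s)` vanish for all `s`. -/
def callExt (K H₁ β z : ℝ) : ℝ :=
  H₁ * expStep 1 1 (strikeLevel K H₁) z + -K * expStep 0 1 (strikeLevel K H₁) z
    + -H₁ * expStep (-(1 + 2 * β)) (-1) (strikeLevel K H₁) z
    + K * expStep (-(2 * β)) (-1) (strikeLevel K H₁) z

/-- The solution of the heat equation with initial value `callExt`. -/
def callHeat (K H₁ β s z : ℝ) : ℝ :=
  H₁ * expBlock 1 1 (strikeLevel K H₁) s z + -K * expBlock 0 1 (strikeLevel K H₁) s z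
    + -H₁ * expBlock (-(1 + 2 * β)) (-1) (strikeLevel K H₁) s z
    + K * expBlock (-(2 * β)) (-1) (strikeLevel K H₁) s z

/-- The zero-order term: the lift to the pricing equation of the heat flow of `callExt`. -/
def zeroOrderTerm (a c r T K H₁ β : ℝ) : ℝ → ℝ → ℝ → ℝ :=
  heatLift a c r T H₁ (heatEval (callExt K H₁ β))

section Existence

variable {a c r T K H₁ β t x v : ℝ}

lemma heatEval_add {f g : ℝ → ℝ} (hf : ExpGrowth f) (hg : ExpGrowth g) (s z : ℝ) :
    heatEval (fun y => f y + g y) s z = heatEval f s z + heatEval g s z :=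
  integral_add (hf.integrable s z) (hg.integrable s z)

lemma heatEval_const_mul (g : ℝ → ℝ) (m s z : ℝ) :
    heatEval (fun y => m * g y) s z = m * heatEval g s z :=
  integral_const_mul _ _

lemma strikeLevel_nonneg (hH : 0 < H₁) : 0 ≤ strikeLevel K H₁ :=
  Real.log_nonneg ((one_le_div hH).2 (le_max_right _ _))

lemma mul_exp_strikeLevel (hH : 0 < H₁) : H₁ * Real.exp (strikeLevel K H₁) = max K H₁ := by
  rw [strikeLevel, Real.exp_log (div_pos (hH.trans_le (le_max_right _ _)) hH)]
  field_simp

lemma expGrowth_callExt (K H₁ β : ℝ) : ExpGrowth (callExt K H₁ β) :=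
  ((((expGrowth_expStep _ _ _).const_mul H₁).add ((expGrowth_expStep _ _ _).const_mul (-K))).add
    ((expGrowth_expStep _ _ _).const_mul (-H₁))).add ((expGrowth_expStep _ _ _).const_mul K)

lemma heatEval_callExt {s : ℝ} (hs : 0 < s) (z : ℝ) :
    heatEval (callExt K H₁ β) s z = callHeat K H₁ β s z := by
  have e := fun κ ε => expGrowth_expStep κ ε (strikeLevel K H₁)
  have h1 := (e 1 1).const_mul H₁
  have h2 := (e 0 1).const_mul (-K)
  have h3 := (e (-(1 + 2 * β)) (-1)).const_mul (-H₁)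
  have h4 := (e (-(2 * β)) (-1)).const_mul K
  unfold callExt callHeat
  rw [heatEval_add ((h1.add h2).add h3) h4, heatEval_add (h1.add h2) h3, heatEval_add h1 h2]
  simp_rw [heatEval_const_mul]
  rw [heatEval_expStep _ _ (Or.inl rfl) hs, heatEval_expStep _ _ (Or.inl rfl) hs,
    heatEval_expStep _ _ (Or.inr rfl) hs, heatEval_expStep _ _ (Or.inr rfl) hs]

lemma isCaloric_callHeat (K H₁ β : ℝ) : ∃ Gz Gzz, IsCaloric (callHeat K H₁ β) Gz Gzz := by
  obtain ⟨_, _, h1⟩ := isCaloric_expBlock 1 (one_pow 2) (strikeLevel K H₁)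
  obtain ⟨_, _, h2⟩ := isCaloric_expBlock 0 (one_pow 2) (strikeLevel K H₁)
  obtain ⟨_, _, h3⟩ := isCaloric_expBlock (-(1 + 2 * β)) (neg_one_sq) (strikeLevel K H₁)
  obtain ⟨_, _, h4⟩ := isCaloric_expBlock (-(2 * β)) (neg_one_sq) (strikeLevel K H₁)
  exact ⟨_, _, (((h1.const_mul H₁).add (h2.const_mul (-K))).add (h3.const_mul (-H₁))).add
    (h4.const_mul K)⟩

lemma callExt_of_pos (hH : 0 < H₁) {z : ℝ} (hz : 0 < z) :
    callExt K H₁ β z = max (H₁ * Real.exp z - K) 0 := by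
  have hL := strikeLevel_nonneg (K := K) hH
  have hm := mul_exp_strikeLevel (K := K) hH
  have h3 : ¬ strikeLevel K H₁ < -1 * z := by linarith
  simp only [callExt, expStep, h3, if_false, one_mul]
  split_ifs with h
  · have : H₁ * Real.exp (strikeLevel K H₁) < H₁ * Real.exp z := by gcongr
    rw [max_eq_left (by linarith [le_max_left K H₁])]
    simp
    ring
  · have h1 : H₁ * Real.exp z ≤ H₁ * Real.exp (strikeLevel K H₁) := by
      gcongr; exact not_lt.1 h
    have h2 : H₁ < H₁ * Real.exp z := lt_mul_of_one_lt_right hH (Real.one_lt_exp_iff.2 hz)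
    rw [max_eq_right]
    · simp
    · rcases max_cases K H₁ with ⟨h, _⟩ | ⟨h, _⟩ <;> rw [h] at hm <;> linarith

lemma callExt_zero (hH : 0 < H₁) : callExt K H₁ β 0 = 0 := by
  have hL := strikeLevel_nonneg (K := K) hH
  simp [callExt, expStep, hL.not_gt]

lemma callExt_neg (z : ℝ) :
    callExt K H₁ β (-z) = -Real.exp (2 * β * z) * callExt K H₁ β z := by
  have h1 : Real.exp (2 * β * z) * Real.exp z = Real.exp ((1 + 2 * β) * z) := by
    rw [← Real.exp_add]; ring_nf
  have h2 : Real.exp (2 * β * z) * Real.exp (-((1 + 2 * β) * z)) = Real.exp (-z) := by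
    rw [← Real.exp_add]; ring_nf
  have h3 : Real.exp (2 * β * z) * Real.exp (-(2 * β * z)) = 1 := by
    rw [← Real.exp_add]; simp
  simp only [callExt, expStep, one_mul, neg_mul, mul_neg, neg_neg, zero_mul, neg_zero,
    Real.exp_zero]
  split_ifs
  · linear_combination H₁ * h1 - H₁ * h2 + K * h3
  · linear_combination -H₁ * h2 + K * h3
  · linear_combination H₁ * h1
  · ring

lemma continuousAt_expStep {κ ε L z : ℝ} (h : L ≠ ε * z) : ContinuousAt (expStep κ ε L) z := by
  have hc : ContinuousAt (fun y => ε * y) z := by fun_prop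
  rcases lt_or_gt_of_ne h with h | h
  · refine ContinuousAt.congr (f := fun y => Real.exp (κ * y)) (by fun_prop) ?_
    filter_upwards [hc.eventually_const_lt h] with y hy
    simp [expStep, hy]
  · refine ContinuousAt.congr (f := fun _ => 0) continuousAt_const ?_
    filter_upwards [hc.eventually_lt_const h] with y hy
    simp [expStep, hy.not_gt]

lemma countable_not_continuousAt_callExt (K H₁ β : ℝ) :
    {z | ¬ ContinuousAt (callExt K H₁ β) z}.Countable := by
  refine (Set.toFinite {strikeLevel K H₁, -strikeLevel K H₁}).countable.mono fun z hz => ?_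
  by_contra hne
  simp only [mem_insert_iff, mem_singleton_iff, not_or] at hne
  have h1 : strikeLevel K H₁ ≠ 1 * z := fun h => hne.1 (by linarith)
  have h2 : strikeLevel K H₁ ≠ -1 * z := fun h => hne.2 (by linarith)
  exact hz ((((continuousAt_const.mul (continuousAt_expStep h1)).add
    (continuousAt_const.mul (continuousAt_expStep h1))).add
    (continuousAt_const.mul (continuousAt_expStep h2))).add
    (continuousAt_const.mul (continuousAt_expStep h2)))

/-- The extended terminal value is continuous on `z > 0`, and at `0` if the data are compatible
there. -/
lemma continuousAt_callExt (hH : 0 < H₁) {z : ℝ} (hz : 0 ≤ z) (h : H₁ ≤ K ∨ z ≠ 0) :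
    ContinuousAt (callExt K H₁ β) z := by
  rcases hz.eq_or_lt with rfl | hz
  · have hK : H₁ ≤ K := by simpa using h
    have e : callExt K H₁ β = fun z => max (H₁ * Real.exp z - K) 0
        - Real.exp (-(2 * β * z)) * max (H₁ * Real.exp (-z) - K) 0 := by
      have hle : ∀ z : ℝ, z ≤ 0 → max (H₁ * Real.exp z - K) 0 = 0 := fun z hz => by
        refine max_eq_right ?_
        have := mul_le_mul_of_nonneg_left (Real.exp_le_one_iff.2 hz) hH.le
        linarith
      funext z
      rcases lt_trichotomy z 0 with hz | rfl | hz
      · have := callExt_neg (K := K) (H₁ := H₁) (β := β) (-z)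
        rw [neg_neg, callExt_of_pos hH (neg_pos.2 hz)] at this
        rw [this, hle z hz.le]
        ring_nf
      · simp [callExt_zero hH]
      · rw [callExt_of_pos hH hz, hle (-z) (by linarith)]
        ring
    rw [e]
    fun_prop
  · refine ContinuousAt.congr (f := fun z => max (H₁ * Real.exp z - K) 0) (by fun_prop) ?_
    filter_upwards [eventually_gt_nhds hz] with y hy
    exact (callExt_of_pos hH hy).symm

/-- The boundary condition: the solution vanishes on the line `z = β s`. -/
lemma heatEval_callExt_boundary (hH : 0 < H₁) {s : ℝ} (hs : 0 ≤ s) :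
    heatEval (callExt K H₁ β) s (β * s) = 0 := by
  rcases hs.eq_or_lt with rfl | hs
  · rw [mul_zero, heatEval_zero, callExt_zero hH]
  · rw [heatEval_callExt hs]
    unfold callHeat expBlock
    ring_nf

/-- The logarithmic coordinate relative to the barrier. -/
lemma heatCoord_eq (hH : 0 < H₁) (hx : 0 < x) :
    Real.log (x / H₁) + r * (T - t) - 1 / 2 * gammaSq a c t T v
      = Real.log (x / barrier a c r T H₁ β t v) + β * gammaSq a c t T v := by
  rw [barrier, Real.log_div hx.ne' hH.ne', Real.log_div hx.ne' (by positivity),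
    Real.log_mul hH.ne' (Real.exp_pos _).ne', Real.log_exp]
  ring

lemma zeroOrderTerm_eq_heatLift (ha : 0 < a) (hc : 0 < c) (htT : t < T) :
    zeroOrderTerm a c r T K H₁ β t = heatLift a c r T H₁ (callHeat K H₁ β) t := by
  funext x v
  simp only [zeroOrderTerm, heatLift, heatEval_callExt (gammaSq_pos ha hc htT v)]

lemma zeroOrderTerm_eq_closedForm (ha : 0 < a) (hc : 0 < c) (hH : 0 < H₁) (htT : t < T)
    (hx : 0 < x) (v : ℝ) :
    zeroOrderTerm a c r T K H₁ β t x v = closedForm a c r T K H₁ β t x v := by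
  rw [zeroOrderTerm_eq_heatLift ha hc htT]
  have hS := gammaSq_pos ha hc htT v
  have hsq : 0 < √(gammaSq a c t T v) := Real.sqrt_pos.2 hS
  have hb : 0 < barrier a c r T H₁ β t v := barrier_pos hH t v
  have hm : 0 < max K H₁ := hH.trans_le (le_max_right _ _)
  have hZ := heatCoord_eq (a := a) (c := c) (r := r) (T := T) (β := β) (t := t) (v := v) hH hx
  have hZx : Real.log (x / max K H₁) = Real.log (x / H₁) - strikeLevel K H₁ := by
    rw [strikeLevel, Real.log_div hx.ne' hm.ne', Real.log_div hx.ne' hH.ne',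
      Real.log_div hm.ne' hH.ne']
    ring
  have hbx : Real.log (barrier a c r T H₁ β t v / x)
      = -Real.log (x / barrier a c r T H₁ β t v) := by
    rw [← Real.log_inv, inv_div]
  have hpow : ∀ q, (barrier a c r T H₁ β t v / x) ^ q
      = Real.exp (-Real.log (x / barrier a c r T H₁ β t v) * q) := fun q => by
    rw [Real.rpow_def_of_pos (by positivity), hbx]
  have hxe : x = H₁ * Real.exp (Real.log (x / H₁)) := by
    rw [Real.exp_log (by positivity)]; field_simp
  have hss : √(gammaSq a c t T v) * √(gammaSq a c t T v) = gammaSq a c t T v :=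
    Real.mul_self_sqrt hS.le
  simp only [closedForm, d1, d2, d3, d4, gamma, hpow, hbx, hZx]
  simp only [heatLift, callHeat, expBlock, hZ]
  have hw : Real.log (x / H₁) = Real.log (x / barrier a c r T H₁ β t v)
      + β * gammaSq a c t T v - r * (T - t) + 1 / 2 * gammaSq a c t T v := by linarith
  set y := Real.log (x / barrier a c r T H₁ β t v)
  set S := gammaSq a c t T v
  set L := strikeLevel K H₁
  rw [hw] at hxe ⊢
  generalize √S = q at *
  have e1 : 1 / q * (y + β * S - r * (T - t) + 1 / 2 * S - L + r * (T - t) + 1 / 2 * S)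
      = (1 * (y + β * S + 1 * S) - L) / q := by ring
  have e2 : (1 * (y + β * S + 1 * S) - L) / q - q = (1 * (y + β * S + 0 * S) - L) / q := by
    field_simp; linear_combination -hss
  have e3 : (1 * (y + β * S + 1 * S) - L) / q + 2 / q * -y
      = (-1 * (y + β * S + -(1 + 2 * β) * S) - L) / q := by ring
  have e4 : (1 * (y + β * S + 0 * S) - L) / q + 2 / q * -y
      = (-1 * (y + β * S + -(2 * β) * S) - L) / q := by ring
  rw [e1, e2, e3, e4]
  generalize normalCDF ((1 * (y + β * S + 1 * S) - L) / q) = n1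
  generalize normalCDF ((1 * (y + β * S + 0 * S) - L) / q) = n2
  generalize normalCDF ((-1 * (y + β * S + -(1 + 2 * β) * S) - L) / q) = n3
  generalize normalCDF ((-1 * (y + β * S + -(2 * β) * S) - L) / q) = n4
  have f1 : Real.exp (-r * (T - t)) * (H₁ * Real.exp (1 * (y + β * S) + 1 ^ 2 / 2 * S)) = x := by
    rw [hxe, mul_left_comm, ← Real.exp_add]
    ring_nf
  have f3 : Real.exp (-r * (T - t)) *
      (H₁ * Real.exp (-(1 + 2 * β) * (y + β * S) + (-(1 + 2 * β)) ^ 2 / 2 * S))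
      = Real.exp (-y * (2 + 2 * β)) * x := by
    rw [hxe, mul_left_comm, mul_left_comm _ H₁, ← Real.exp_add, ← Real.exp_add]
    ring_nf
  have f2 : Real.exp (0 * (y + β * S) + 0 ^ 2 / 2 * S) = 1 := by simp
  have f4 : Real.exp (-(2 * β) * (y + β * S) + (-(2 * β)) ^ 2 / 2 * S)
      = Real.exp (-y * (2 * β)) := by
    ring_nf
  rw [f2, f4]
  linear_combination n1 * f1 - n3 * f3

lemma continuousWithinAt_comp₂ {X : Type*} [TopologicalSpace X] {G : ℝ → ℝ → ℝ} {f g : X → ℝ}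
    {D : Set X} {p : X} (hG : ContinuousAt (fun q : ℝ × ℝ => G q.1 q.2) (f p, g p))
    (hf : ContinuousWithinAt f D p) (hg : ContinuousWithinAt g D p) :
    ContinuousWithinAt (fun q => G (f q) (g q)) D p :=
  Filter.Tendsto.comp (g := fun q : ℝ × ℝ => G q.1 q.2) hG (hf.prodMk hg)

/-- The lift is continuous up to the boundary wherever the extended terminal value is continuous,
that is, except at the corner where incompatible data meet. -/
lemma continuousOn_zeroOrderTerm (ha : 0 < a) (hc : 0 < c) (hH : 0 < H₁) :
    ContinuousOn (fun p : ℝ × ℝ × ℝ => zeroOrderTerm a c r T K H₁ β p.1 p.2.1 p.2.2)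
      {p ∈ closedDomain a c r T H₁ β |
        H₁ ≤ K ∨ p.1 ≠ T ∨ p.2.1 ≠ barrier a c r T H₁ β T p.2.2} := by
  rintro ⟨t, x, v⟩ ⟨⟨h0, hT, hx⟩, hcor⟩
  simp only at h0 hT hx hcor
  have hxpos : 0 < x := (barrier_pos hH t v).trans_le hx
  have hmem : ∀ p ∈ {p ∈ closedDomain a c r T H₁ β |
      H₁ ≤ K ∨ p.1 ≠ T ∨ p.2.1 ≠ barrier a c r T H₁ β T p.2.2}, p.1 ≤ T := fun p hp => hp.1.2.1
  generalize {p ∈ closedDomain a c r T H₁ β |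
      H₁ ≤ K ∨ p.1 ≠ T ∨ p.2.1 ≠ barrier a c r T H₁ β T p.2.2} = D at *
  have hg : ContinuousWithinAt (fun p : ℝ × ℝ × ℝ => gammaSq a c p.1 T p.2.2) D (t, x, v) :=
    ContinuousWithinAt.comp (t := {p : ℝ × ℝ | p.1 ≤ T})
      (g := fun p : ℝ × ℝ => gammaSq a c p.1 T p.2)
      (f := fun p : ℝ × ℝ × ℝ => (p.1, p.2.2)) (continuousOn_gammaSq ha hc (t, v) hT)
      (by fun_prop) hmem
  have hl : ContinuousAt (fun p : ℝ × ℝ × ℝ => Real.log (p.2.1 / H₁)) (t, x, v) :=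
    ContinuousAt.log (by fun_prop) (by positivity)
  have hz : ContinuousWithinAt (fun p : ℝ × ℝ × ℝ =>
      Real.log (p.2.1 / H₁) + r * (T - p.1) - 1 / 2 * gammaSq a c p.1 T p.2.2) D (t, x, v) :=
    ((hl.continuousWithinAt (s := D)).add (by fun_prop)).sub (continuousWithinAt_const.mul hg)
  have hE : ContinuousAt (fun p : ℝ × ℝ => heatEval (callExt K H₁ β) p.1 p.2)
      (gammaSq a c t T v,
        Real.log (x / H₁) + r * (T - t) - 1 / 2 * gammaSq a c t T v) := by
    refine (expGrowth_callExt K H₁ β).continuousAt_heatEval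
      (countable_not_continuousAt_callExt K H₁ β) ?_
    rcases hT.lt_or_eq with hT | rfl
    · exact Or.inl (gammaSq_pos ha hc hT v)
    · right
      rw [barrier_terminal] at hx hcor
      simp only [gammaSq_self, sub_self, mul_zero, add_zero, sub_zero]
      have h1 : 0 ≤ Real.log (x / H₁) := Real.log_nonneg ((one_le_div hH).2 hx)
      refine continuousAt_callExt hH h1 (hcor.imp_right fun h => ?_)
      have hne : x ≠ H₁ := by simpa using h
      exact (Real.log_pos ((one_lt_div hH).2 (lt_of_le_of_ne hx hne.symm))).ne'
  have hexp : ContinuousWithinAt (fun p : ℝ × ℝ × ℝ => Real.exp (-r * (T - p.1))) D (t, x, v) := by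
    fun_prop
  exact hexp.mul (continuousWithinAt_comp₂ (G := heatEval (callExt K H₁ β)) hE hg hz)

lemma exists_gammaSq_le (ha : 0 < a) (hc : 0 < c) (M : ℝ) :
    ∃ S : ℝ, 0 ≤ S ∧ ∀ t v : ℝ, 0 ≤ t → t ≤ T → |v| ≤ M → gammaSq a c t T v ≤ S := by
  obtain ⟨S, hS⟩ :=
    (isCompact_Icc.prod (isCompact_Icc (a := -M) (b := M))).exists_bound_of_continuousOn (
    (continuousOn_gammaSq (T := T) ha hc).mono
      (fun p hp => (hp.1.2 : p.1 ≤ T) : Icc 0 T ×ˢ Icc (-M) M ⊆ {p : ℝ × ℝ | p.1 ≤ T}))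
  refine ⟨|S|, abs_nonneg _, fun t v h0 hT hv => ?_⟩
  exact (le_abs_self _).trans ((hS (t, v) ⟨⟨h0, hT⟩, abs_le.1 hv⟩).trans (le_abs_self S))

lemma growth_zeroOrderTerm (ha : 0 < a) (hc : 0 < c) (hH : 0 < H₁) (M : ℝ) :
    ∃ (C : ℝ) (k : ℕ), ∀ t x v : ℝ, (t, x, v) ∈ closedDomain a c r T H₁ β → |v| ≤ M →
      |zeroOrderTerm a c r T K H₁ β t x v| ≤ C * (1 + x ^ k) := by
  obtain ⟨S, hS0, hS⟩ := exists_gammaSq_le (T := T) ha hc M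
  obtain ⟨C, k, hC⟩ := (expGrowth_callExt K H₁ β).exists_heatEval_le S
  have hC0 : 0 ≤ C := by simpa using (abs_nonneg _).trans (hC 0 0 hS0)
  set b₀ := H₁ * Real.exp (-(|r| * T + |(1 + 2 * β) / 2| * S)) with hb₀
  have hb₀pos : 0 < b₀ := by positivity
  refine ⟨Real.exp (|r| * T) * (C * ((1 / b₀) ^ k * Real.exp (k * (|β| * S)))), k, ?_⟩
  rintro t x v ⟨h0, hT, hx⟩ hv
  simp only at h0 hT hx
  have hb := barrier_pos (a := a) (c := c) (r := r) (T := T) (β := β) hH t v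
  have hxpos : 0 < x := hb.trans_le hx
  have hSt := hS t v h0 hT hv
  have hSt0 : 0 ≤ gammaSq a c t T v := gammaSq_nonneg hT
  have hrT : |r * (T - t)| ≤ |r| * T := by
    rw [abs_mul, abs_of_nonneg (sub_nonneg.2 hT)]
    gcongr
    linarith
  have hbb : b₀ ≤ barrier a c r T H₁ β t v := by
    rw [hb₀, barrier]
    gcongr
    have h1 : |(1 + 2 * β) / 2 * gammaSq a c t T v| ≤ |(1 + 2 * β) / 2| * S := by
      rw [abs_mul, abs_of_nonneg hSt0]
      gcongr
    linarith [abs_le.1 h1, abs_le.1 hrT]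
  have hy : 0 ≤ Real.log (x / barrier a c r T H₁ β t v) :=
    Real.log_nonneg ((one_le_div hb).2 hx)
  unfold zeroOrderTerm heatLift
  rw [heatCoord_eq (β := β) hH hxpos, abs_mul, abs_of_pos (Real.exp_pos _), mul_assoc]
  refine mul_le_mul (Real.exp_le_exp.2 (by linarith [abs_le.1 hrT])) ?_ (abs_nonneg _)
    (Real.exp_pos _).le
  refine (hC _ _ hSt).trans ?_
  rw [mul_assoc]
  gcongr
  calc Real.exp (k * |Real.log (x / barrier a c r T H₁ β t v) + β * gammaSq a c t T v|)
      ≤ Real.exp (k * (Real.log (x / barrier a c r T H₁ β t v) + |β| * S)) := by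
        gcongr
        refine (abs_add_le _ _).trans ?_
        rw [abs_of_nonneg hy, abs_mul, abs_of_nonneg hSt0]
        gcongr
    _ = (x / barrier a c r T H₁ β t v) ^ k * Real.exp (k * (|β| * S)) := by
        rw [mul_add, Real.exp_add, Real.exp_nat_mul, Real.exp_log (by positivity)]
    _ ≤ (x / b₀) ^ k * Real.exp (k * (|β| * S)) := by gcongr
    _ = (1 / b₀) ^ k * Real.exp (k * (|β| * S)) * x ^ k := by
        rw [div_pow, div_pow, one_pow]; ring
    _ ≤ _ := by
        gcongr
        linarith

theorem isZeroOrderTerm_zeroOrderTerm (ha : 0 < a) (hc : 0 < c) (hH : 0 < H₁) :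
    IsZeroOrderTerm a c r T K H₁ β (zeroOrderTerm a c r T K H₁ β) := by
  obtain ⟨Gz, Gzz, hG⟩ := isCaloric_callHeat K H₁ β
  have heq : ∀ t < T, zeroOrderTerm a c r T K H₁ β t
      = heatLift a c r T H₁ (callHeat K H₁ β) t := fun t ht => zeroOrderTerm_eq_heatLift ha hc ht
  have hxpos : ∀ t x v : ℝ, (t, x, v) ∈ openDomain a c r T H₁ β → 0 < x := fun t x v h =>
    (barrier_pos hH t v).trans h.2.2
  refine ⟨?_, ?_, ?_, continuousOn_zeroOrderTerm ha hc hH, growth_zeroOrderTerm ha hc hH,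
    ?_, ?_, ?_⟩
  · rintro ⟨t, x, v⟩ h
    refine (ContDiffAt.congr_of_eventuallyEq
      (hG.contDiffAt_heatLift (r := r) ha hc hH h.2.1 (hxpos t x v h)) ?_).contDiffWithinAt
    filter_upwards [continuousAt_fst.eventually_lt_const h.2.1] with p hp
    rw [heq p.1 hp]
  · intro t x v h
    rw [heq t h.2.1]
    exact (hG.solvesAt_heatLift ha hc hH h.2.1 (hxpos t x v h) v).differentiableAt_deriv
  · rintro ⟨t, x, v⟩ h
    have hx := hxpos t x v h
    have h1 := continuousAt_heatLift (r := r) (v := v) ha hc hH h.2.1 hx hG.continuousAt_space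
    have h2 := continuousAt_heatLift (r := r) (v := v) ha hc hH h.2.1 hx hG.continuousAt_space2
    have h3 : ContinuousAt (fun p : ℝ × ℝ × ℝ => p.2.1) (t, x, v) := by fun_prop
    refine ContinuousAt.continuousWithinAt (ContinuousAt.congr
      ((h2.sub h1).div (h3.pow 2) (pow_pos hx 2).ne') ?_)
    filter_upwards [continuousAt_fst.eventually_lt_const h.2.1,
      h3.eventually_const_lt hx] with p hp1 hp2
    rw [iteratedDeriv_succ, iteratedDeriv_one, heq p.1 hp1]
    exact (hG.hasDerivAt_deriv_heatLift ha hc hH hp1 hp2).deriv.symm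
  · intro t x v h
    have h1 : deriv (fun s => zeroOrderTerm a c r T K H₁ β s x v) t
        = deriv (fun s => heatLift a c r T H₁ (callHeat K H₁ β) s x v) t := by
      refine Filter.EventuallyEq.deriv_eq ?_
      filter_upwards [eventually_lt_nhds h.2.1] with s hs
      rw [heq s hs]
    rw [h1, heq t h.2.1]
    exact (hG.solvesAt_heatLift ha hc hH h.2.1 (hxpos t x v h) v).pde
  · intro x v hx
    rw [barrier_terminal] at hx
    have hx0 : 0 < x := hH.trans hx
    have hz : 0 < Real.log (x / H₁) := Real.log_pos ((one_lt_div hH).2 hx)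
    simp only [zeroOrderTerm, heatLift, gammaSq_self, sub_self, mul_zero, add_zero, sub_zero,
      heatEval_zero, Real.exp_zero, one_mul]
    rw [callExt_of_pos hH hz, Real.exp_log (by positivity)]
    congr 2
    field_simp
  · intro t v h0 hT
    have hb := barrier_pos (a := a) (c := c) (r := r) (T := T) (β := β) hH t v
    unfold zeroOrderTerm heatLift
    rw [heatCoord_eq (β := β) hH hb, div_self hb.ne', Real.log_one, zero_add,
      heatEval_callExt_boundary hH (gammaSq_nonneg hT), mul_zero]

end Existence

/-! ### Uniqueness by the maximum principle -/

section Uniqueness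

variable {a c r T K H₁ β : ℝ}

lemma deriv_deriv_nonpos_of_isLocalMax {g : ℝ → ℝ} {x : ℝ} (h : IsLocalMax g x)
    (hc : ContinuousAt g x) : deriv (deriv g) x ≤ 0 := by
  by_contra! hpos
  have hmin := isLocalMin_of_deriv_deriv_pos hpos h.deriv_eq_zero hc
  have hconst : g =ᶠ[𝓝 x] fun _ => g x := by
    filter_upwards [h, hmin] with y h1 h2
    exact le_antisymm h1 h2
  have h2 : deriv g =ᶠ[𝓝 x] fun _ => 0 := by
    filter_upwards [hconst.eventuallyEq_nhds] with y hy
    rw [hy.deriv_eq, deriv_const]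
  rw [h2.deriv_eq, deriv_const] at hpos
  exact lt_irrefl _ hpos

lemma HasDerivAt.nonpos_of_eventually_le {g : ℝ → ℝ} {g' t : ℝ} (h : HasDerivAt g g' t)
    (hle : ∀ᶠ s in 𝓝[>] t, g s ≤ g t) : g' ≤ 0 := by
  have h1 := (hasDerivAt_iff_tendsto_slope.1 h).mono_left (nhdsGT_le_nhdsNE t)
  refine le_of_tendsto h1 ?_
  filter_upwards [hle, self_mem_nhdsWithin] with s hs hst
  rw [slope_def_field]
  exact div_nonpos_of_nonpos_of_nonneg (sub_nonpos.2 hs) (sub_nonneg.2 (le_of_lt hst))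

/-- A strict subsolution has no interior maximum along a characteristic `v = V t` of the transport
part of the equation; the discount factor removes the term `-r f`. -/
lemma SolvesAt.not_isMax {Φ : ℝ → ℝ → ℝ → ℝ} {ρ t x : ℝ} {V : ℝ → ℝ}
    (h : SolvesAt a c r Φ ρ t x (V t)) (hρ : 0 < ρ)
    (hV : HasDerivAt V (a - c / 2 * Real.exp (2 * V t)) t)
    (htime : ∀ᶠ s in 𝓝[>] t,
      Real.exp (r * (T - s)) * Φ s x (V s) ≤ Real.exp (r * (T - t)) * Φ t x (V t))
    (hspace : IsLocalMax (fun y => Φ t y (V t)) x) : False := by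
  have hr : HasDerivAt (fun w => r * (T - w)) (-r) t := by
    simpa using ((hasDerivAt_id t).const_sub T).const_mul r
  have h1 := HasDerivAt.nonpos_of_eventually_le (hr.exp.mul (h.hasDerivAt_curve hV rfl)) htime
  have h2 := hspace.deriv_eq_zero
  have h3 := deriv_deriv_nonpos_of_isLocalMax hspace
    h.eventually_differentiableAt.self_of_nhds.continuousAt
  have h4 := h.pde
  simp only [opL0, iteratedDeriv_succ, iteratedDeriv_zero, h2] at h4
  have h5 : deriv (fun s => Φ s x (V t)) t
      + (a - c / 2 * Real.exp (2 * V t)) * deriv (fun w => Φ t x w) (V t) - r * Φ t x (V t)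
        ≤ 0 := by
    have he := Real.exp_pos (r * (T - t))
    by_contra! hcon
    have := mul_pos he hcon
    linarith
  have h6 : x ^ 2 / 2 * Real.exp (2 * V t) * deriv (deriv fun y => Φ t y (V t)) x ≤ 0 :=
    mul_nonpos_of_nonneg_of_nonpos (by positivity) h3
  linarith

lemma IsZeroOrderTerm.solvesAt {f : ℝ → ℝ → ℝ → ℝ} (hf : IsZeroOrderTerm a c r T K H₁ β f)
    (ha : 0 < a) (hc : 0 < c) {t x v : ℝ} (h : (t, x, v) ∈ openDomain a c r T H₁ β) :
    SolvesAt a c r f 0 t x v :=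
  ⟨hf.contDiffOn.contDiffAt ((isOpen_openDomain ha hc).mem_nhds h),
    hf.differentiableAt_deriv t x v h, hf.pde t x v h⟩

lemma solvesAt_discountedTime (t x v : ℝ) :
    SolvesAt a c r (fun t _ _ => Real.exp (-r * (T - t)) * (T - t))
      (-Real.exp (-r * (T - t))) t x v := by
  have hr : HasDerivAt (fun w => -r * (T - w)) r t := by
    simpa using ((hasDerivAt_id t).const_sub T).const_mul (-r)
  have h1 := hr.exp.mul ((hasDerivAt_id t).const_sub T)
  refine ⟨by fun_prop, ?_, ?_⟩
  · simp only [deriv_const']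
    exact differentiableAt_const _
  · have h1' : deriv (fun s => Real.exp (-r * (T - s)) * (T - s)) t = _ := h1.deriv
    simp only [opL0, iteratedDeriv_succ, iteratedDeriv_zero, deriv_const', h1', id_eq]
    ring

lemma heatBump_nonneg (δ s z : ℝ) : 0 ≤ heatBump δ s z := (Real.exp_pos _).le

lemma continuousAt_heatBump {δ s : ℝ} (hδ : 0 < δ) (hs : 0 ≤ s) (z : ℝ) :
    ContinuousAt (fun p : ℝ × ℝ => heatBump δ p.1 p.2) (s, z) := by
  have h1 : s + δ ≠ 0 := by positivity
  have h2 : (s + δ) / δ ≠ 0 := by positivity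
  unfold heatBump
  fun_prop (disch := assumption)

lemma heatBump_origin {δ : ℝ} (hδ : 0 < δ) : heatBump δ 0 0 = 1 := by
  simp [heatBump, hδ.ne']

lemma heatBump_le {δ s : ℝ} (hδ : 0 < δ) (hs : 0 < s) (z : ℝ) : heatBump δ s z ≤ √(δ / s) := by
  rw [heatBump, ← Real.exp_log (Real.sqrt_pos.2 (div_pos hδ hs)), Real.exp_le_exp,
    Real.log_sqrt (div_pos hδ hs).le, ← inv_div s δ, Real.log_inv]
  have h1 : Real.log (s / δ) ≤ Real.log ((s + δ) / δ) :=
    Real.log_le_log (by positivity) (by gcongr; linarith)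
  have h2 : 0 ≤ z ^ 2 / (s + δ) := by positivity
  linarith

/-- The lift of a function that is continuous on `s ≥ 0` is continuous along a continuous path
`v = V t`, up to maturity. -/
lemma continuousWithinAt_heatLift_path {G : ℝ → ℝ → ℝ}
    (hG : ∀ s z : ℝ, 0 ≤ s → ContinuousAt (fun p : ℝ × ℝ => G p.1 p.2) (s, z))
    (ha : 0 < a) (hc : 0 < c) (hH : 0 < H₁) {V : ℝ → ℝ} {t₀ t x : ℝ}
    (hV : ContinuousOn V (Icc t₀ T)) (ht : t ∈ Icc t₀ T) (hx : 0 < x) :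
    ContinuousWithinAt (fun p : ℝ × ℝ => heatLift a c r T H₁ G p.1 p.2 (V p.1))
      (Icc t₀ T ×ˢ univ) (t, x) := by
  have hV' : ContinuousWithinAt (fun p : ℝ × ℝ => V p.1) (Icc t₀ T ×ˢ univ) (t, x) :=
    ContinuousWithinAt.comp (g := V) (f := Prod.fst) (hV t ht) (by fun_prop) fun p hp => hp.1
  have hg : ContinuousWithinAt (fun p : ℝ × ℝ => gammaSq a c p.1 T (V p.1))
      (Icc t₀ T ×ˢ univ) (t, x) :=
    ContinuousWithinAt.comp (t := {p : ℝ × ℝ | p.1 ≤ T})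
      (g := fun p : ℝ × ℝ => gammaSq a c p.1 T p.2) (f := fun p : ℝ × ℝ => (p.1, V p.1))
      (continuousOn_gammaSq ha hc (t, V t) ht.2) (continuousWithinAt_fst.prodMk hV')
      fun p hp => hp.1.2
  have hl : ContinuousAt (fun p : ℝ × ℝ => Real.log (p.2 / H₁)) (t, x) :=
    ContinuousAt.log (by fun_prop) (by positivity)
  have hz : ContinuousWithinAt (fun p : ℝ × ℝ =>
      Real.log (p.2 / H₁) + r * (T - p.1) - 1 / 2 * gammaSq a c p.1 T (V p.1))
      (Icc t₀ T ×ˢ univ) (t, x) :=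
    (hl.continuousWithinAt.add (by fun_prop)).sub (continuousWithinAt_const.mul hg)
  have hexp : ContinuousWithinAt (fun p : ℝ × ℝ => Real.exp (-r * (T - p.1)))
      (Icc t₀ T ×ˢ univ) (t, x) := by fun_prop
  exact hexp.mul (continuousWithinAt_comp₂ (hG _ _ (gammaSq_nonneg ht.2)) hg hz)

/-- The lift of `e^{κ z + κ² s / 2}` grows like `x^κ`. -/
lemma le_heatLift_exp (hH : 0 < H₁) {t x : ℝ} (h0 : 0 ≤ t) (hT : t ≤ T) (hx : 0 < x) (v : ℝ)
    (k : ℕ) :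
    Real.exp (-((k + 2) * |r| * T)) * (1 / H₁) ^ (k + 1) * x ^ (k + 1) ≤
      heatLift a c r T H₁
        (fun s z => Real.exp ((k + 1 : ℕ) * z + ((k + 1 : ℕ) : ℝ) ^ 2 / 2 * s)) t x v := by
  have hS : 0 ≤ gammaSq a c t T v := gammaSq_nonneg hT
  have hrT : |r * (T - t)| ≤ |r| * T := by
    rw [abs_mul, abs_of_nonneg (sub_nonneg.2 hT)]
    gcongr
    linarith
  have h1 : (1 / H₁) ^ (k + 1) * x ^ (k + 1) = Real.exp ((k + 1 : ℕ) * Real.log (x / H₁)) := by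
    rw [Real.exp_nat_mul, Real.exp_log (by positivity), ← mul_pow]
    ring
  rw [mul_assoc, h1, heatLift, ← Real.exp_add, ← Real.exp_add, Real.exp_le_exp]
  push_cast
  have hk : (0 : ℝ) ≤ k := Nat.cast_nonneg k
  have h2 := abs_le.1 hrT
  have h3 : 0 ≤ (k : ℝ) * (r * (T - t) + |r| * T) := mul_nonneg hk (by linarith)
  have h4 : 0 ≤ (k : ℝ) * (k + 1) * gammaSq a c t T v := by positivity
  have h5 : 0 ≤ |r| * T := (abs_nonneg _).trans hrT
  nlinarith

/-- A solution is dominated, up to small multiples of positive supersolutions, by any other one: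
`e^{-r(T-t)} (T - t)` makes the inequality strict, a power of `x` controls the growth, and the heat
kernel issued from `(-ε, 0)` controls the difference near the corner `t = T`, `x = ĥ(T,v)`, where
solutions need not be continuous. The factor `C'` does not depend on `ε`. -/
lemma IsZeroOrderTerm.sub_le {f g : ℝ → ℝ → ℝ → ℝ} (hf : IsZeroOrderTerm a c r T K H₁ β f)
    (hg : IsZeroOrderTerm a c r T K H₁ β g) (ha : 0 < a) (hc : 0 < c) (hH : 0 < H₁)
    {t₀ x₀ v₀ : ℝ} (h₀ : (t₀, x₀, v₀) ∈ openDomain a c r T H₁ β) :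
    ∃ (C' : ℝ) (k : ℕ), ∀ ε : ℝ, 0 < ε → f t₀ x₀ v₀ - g t₀ x₀ v₀ ≤
      ε * (Real.exp (-r * (T - t₀)) * (T - t₀))
      + ε * heatLift a c r T H₁
        (fun s z => Real.exp ((k + 1 : ℕ) * z + ((k + 1 : ℕ) : ℝ) ^ 2 / 2 * s)) t₀ x₀ v₀
      + C' * heatLift a c r T H₁ (heatBump ε) t₀ x₀ v₀ := by
  obtain ⟨h0t, htT, hxb⟩ := h₀
  simp only at h0t htT hxb
  set V := logVol a c t₀ v₀ with hVdef
  have hVt₀ : V t₀ = v₀ := logVol_self a c t₀ v₀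
  have hVd : ∀ s, t₀ ≤ s → HasDerivAt V (a - c / 2 * Real.exp (2 * V s)) s := fun s hs =>
    hasDerivAt_logVol ha hc hs v₀
  have hVc : ContinuousOn V (Icc t₀ T) := (continuousOn_logVol ha hc t₀ v₀).mono Icc_subset_Ici_self
  obtain ⟨M, hM⟩ := isCompact_Icc.exists_bound_of_continuousOn hVc
  obtain ⟨C₁, k₁, hC₁⟩ := hf.growth M
  obtain ⟨C₂, k₂, hC₂⟩ := hg.growth M
  set k := max k₁ k₂
  set C := 2 * (|C₁| + |C₂|)
  have hC0 : 0 ≤ C := by positivity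
  set b : ℝ → ℝ := fun t => barrier a c r T H₁ β t (V t) with hb
  have hbpos : ∀ t, 0 < b t := fun t => barrier_pos hH t _
  have hbT : b T = H₁ := barrier_terminal _
  have hbc : ContinuousOn b (Icc t₀ T) :=
    ContinuousOn.comp (t := {p : ℝ × ℝ | p.1 ≤ T})
      (g := fun p : ℝ × ℝ => barrier a c r T H₁ β p.1 p.2) (f := fun t : ℝ => (t, V t))
      (continuousOn_barrier ha hc) (continuousOn_id.prodMk hVc) fun t ht => ht.2
  have hmemc : ∀ t x, t ∈ Icc t₀ T → b t ≤ x → (t, x, V t) ∈ closedDomain a c r T H₁ β :=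
    fun t x ht hx => ⟨h0t.le.trans ht.1, ht.2, hx⟩
  have hgrow : ∀ t x, t ∈ Icc t₀ T → b t ≤ x →
      |f t x (V t) - g t x (V t)| ≤ C * (1 + x ^ k) := by
    intro t x ht hx
    have hx0 : 0 < x := (hbpos t).trans_le hx
    have hpow : ∀ j ≤ k, 1 + x ^ j ≤ 2 * (1 + x ^ k) := fun j hj => by
      rcases le_total x 1 with h1 | h1
      · have := pow_le_one₀ (n := j) hx0.le h1
        have := pow_pos hx0 k
        linarith
      · have := pow_le_pow_right₀ h1 hj
        have := pow_pos hx0 k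
        linarith
    have e1 := hC₁ t x (V t) (hmemc t x ht hx) (hM t ht)
    have e2 := hC₂ t x (V t) (hmemc t x ht hx) (hM t ht)
    calc |f t x (V t) - g t x (V t)| ≤ |f t x (V t)| + |g t x (V t)| := abs_sub _ _
      _ ≤ |C₁| * (1 + x ^ k₁) + |C₂| * (1 + x ^ k₂) := by
        refine add_le_add (e1.trans ?_) (e2.trans ?_) <;> gcongr <;> exact le_abs_self _
      _ ≤ |C₁| * (2 * (1 + x ^ k)) + |C₂| * (2 * (1 + x ^ k)) := by
        gcongr
        · exact hpow _ (le_max_left _ _)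
        · exact hpow _ (le_max_right _ _)
      _ = C * (1 + x ^ k) := by ring
  -- a bound for the difference near the corner, where `x ≤ H₁ + 1`
  set B := C * (1 + (H₁ + 1) ^ k) with hB
  have hB0 : 0 ≤ B := by positivity
  refine ⟨2 * B + 1, k, fun ε hε => ?_⟩
  set G : ℝ → ℝ → ℝ := fun s z => Real.exp ((k + 1 : ℕ) * z + ((k + 1 : ℕ) : ℝ) ^ 2 / 2 * s)
  obtain ⟨Gz, Gzz, hGc⟩ : ∃ Gz Gzz, IsCaloric G Gz Gzz := IsCaloric.exp _
  obtain ⟨Bz, Bzz, hBc⟩ := isCaloric_heatBump hε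
  have hGcont : ∀ s z : ℝ, 0 ≤ s → ContinuousAt (fun p : ℝ × ℝ => G p.1 p.2) (s, z) :=
    fun s z _ => by fun_prop
  have hGn : ∀ t x, 0 ≤ heatLift a c r T H₁ G t x (V t) := fun t x => by
    unfold heatLift; positivity
  have hBn : ∀ t x, 0 ≤ heatLift a c r T H₁ (heatBump ε) t x (V t) := fun t x =>
    mul_nonneg (Real.exp_pos _).le (heatBump_nonneg _ _ _)
  set Φ : ℝ → ℝ → ℝ → ℝ := fun t x v => f t x v + (-1) * g t x v
    + (-ε) * (Real.exp (-r * (T - t)) * (T - t)) + (-ε) * heatLift a c r T H₁ G t x v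
    + (-(2 * B + 1)) * heatLift a c r T H₁ (heatBump ε) t x v with hΦ
  by_contra! hcon
  have hpos₀ : 0 < Φ t₀ x₀ (V t₀) := by
    rw [hVt₀]
    simp only [hΦ]
    linarith
  -- `Φ` is at most `f - g`
  have hΦle : ∀ t x, t ≤ T → Φ t x (V t) ≤ f t x (V t) - g t x (V t) := fun t x ht => by
    have h1 := mul_nonneg hε.le (hGn t x)
    have h2 := mul_nonneg (by linarith : 0 ≤ 2 * B + 1) (hBn t x)
    have h3 := mul_nonneg hε.le (mul_nonneg (Real.exp_pos (-r * (T - t))).le (sub_nonneg.2 ht))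
    simp only [hΦ]
    linarith
  -- beyond some `R`, the power of `x` takes over
  set m := Real.exp (-((k + 2) * |r| * T)) * (1 / H₁) ^ (k + 1)
  have hm : 0 < m := by positivity
  set R := max (x₀ + 1) (max 1 (2 * C / (ε * m)))
  have hR1 : 1 ≤ R := (le_max_left _ _).trans (le_max_right _ _)
  have hRx : x₀ < R := (lt_add_one x₀).trans_le (le_max_left _ _)
  have hR2 : 2 * C ≤ ε * m * R := by
    rw [mul_comm (ε * m), ← div_le_iff₀ (by positivity)]
    exact (le_max_right _ _).trans (le_max_right _ _)
  have hΦR : ∀ t, t ∈ Icc t₀ T → b t ≤ R → Φ t R (V t) ≤ 0 := by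
    intro t ht hbR
    have h1 := (le_abs_self _).trans (hgrow t R ht hbR)
    have h2 := le_heatLift_exp (a := a) (c := c) (r := r) hH (h0t.le.trans ht.1) ht.2
      (by linarith : 0 < R) (V t) k
    have h3 := mul_nonneg (by linarith : 0 ≤ 2 * B + 1) (hBn t R)
    have h4 := mul_nonneg hε.le (mul_nonneg (Real.exp_pos (-r * (T - t))).le (sub_nonneg.2 ht.2))
    have h5 : C * (1 + R ^ k) ≤ ε * (m * R ^ (k + 1)) := by
      have h6 : 1 ≤ R ^ k := one_le_pow₀ hR1
      calc C * (1 + R ^ k) ≤ C * (2 * R ^ k) := by gcongr; linarith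
        _ = 2 * C * R ^ k := by ring
        _ ≤ ε * m * R * R ^ k := by gcongr
        _ = ε * (m * R ^ (k + 1)) := by ring
    have h7 : ε * (m * R ^ (k + 1)) ≤ ε * heatLift a c r T H₁ G t R (V t) := by gcongr
    simp only [hΦ]
    linarith
  have hΦb : ∀ t, t ∈ Icc t₀ T → Φ t (b t) (V t) ≤ 0 := fun t ht => by
    refine (hΦle t _ ht.2).trans ?_
    rw [hf.boundary t _ (h0t.le.trans ht.1) ht.2,
      hg.boundary t _ (h0t.le.trans ht.1) ht.2, sub_zero]
  have hΦT : ∀ x, H₁ < x → Φ T x (V T) ≤ 0 := fun x hx => by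
    refine (hΦle T _ le_rfl).trans ?_
    rw [hf.terminal x _ (by rwa [barrier_terminal]), hg.terminal x _ (by rwa [barrier_terminal]),
      sub_self]
  -- near the corner, the heat kernel takes over
  have hcorner : ∃ U : Set (ℝ × ℝ), IsOpen U ∧ (T, H₁) ∈ U ∧
      ∀ t x, (t, x) ∈ U → t ∈ Icc t₀ T → b t ≤ x → Φ t x (V t) ≤ 0 := by
    have h1 := continuousWithinAt_heatLift_path (r := r) (G := heatBump ε)
      (fun s z hs => continuousAt_heatBump hε hs z) ha hc hH hVc (right_mem_Icc.2 htT.le) hH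
    have h2 : heatLift a c r T H₁ (heatBump ε) T H₁ (V T) = 1 := by
      simp [heatLift, gammaSq_self, hH.ne', heatBump_origin hε]
    have h3 : ∀ᶠ p in 𝓝[Icc t₀ T ×ˢ univ] (T, H₁),
        1 / 2 < heatLift a c r T H₁ (heatBump ε) p.1 p.2 (V p.1) :=
      h1.eventually_const_lt (by simp only [h2]; norm_num)
    have h4 : ∀ᶠ p : ℝ × ℝ in 𝓝[Icc t₀ T ×ˢ univ] (T, H₁), p.2 < H₁ + 1 :=
      mem_nhdsWithin_of_mem_nhds (continuousAt_snd.eventually_lt_const (lt_add_one H₁))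
    obtain ⟨U, hU, hUm, hUs⟩ := mem_nhdsWithin.1 (h3.and h4)
    refine ⟨U, hU, hUm, fun t x htx ht hx => ?_⟩
    obtain ⟨h5, h6⟩ := hUs ⟨htx, ht, mem_univ _⟩
    simp only at h5 h6
    have hx0 : 0 < x := (hbpos t).trans_le hx
    have h7 := (le_abs_self _).trans (hgrow t x ht hx)
    have h8 : C * (1 + x ^ k) ≤ B := by
      rw [hB]; gcongr
    have h9 := mul_nonneg hε.le (hGn t x)
    have h10 := mul_nonneg hε.le (mul_nonneg (Real.exp_pos (-r * (T - t))).le (sub_nonneg.2 ht.2))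
    have h11 := mul_le_mul_of_nonneg_left h5.le (by linarith : 0 ≤ 2 * B + 1)
    simp only [hΦ]
    linarith
  obtain ⟨U, hU, hUm, hUΦ⟩ := hcorner
  -- the compact region in which the maximum is attained
  set D : Set (ℝ × ℝ) := {p ∈ Icc t₀ T ×ˢ Icc 0 R | b p.1 ≤ p.2}
  have hbc' : ContinuousOn (fun p : ℝ × ℝ => b p.1) (Icc t₀ T ×ˢ Icc 0 R) :=
    hbc.comp continuousOn_fst fun p hp => hp.1
  have hDc : IsCompact D := by
    refine (isCompact_Icc.prod isCompact_Icc).of_isClosed_subset ?_ fun p hp => hp.1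
    exact (isClosed_Icc.prod isClosed_Icc).isClosed_le hbc' continuousOn_snd
  have hDU : IsCompact (D \ U) := hDc.diff hU
  have hmem₀ : (t₀, x₀) ∈ D \ U := by
    have hb0 : b t₀ < x₀ := by simpa [hb, hVt₀] using hxb
    refine ⟨⟨⟨⟨le_rfl, htT.le⟩, ((hbpos t₀).trans hb0).le, hRx.le⟩, hb0.le⟩, fun hU' => ?_⟩
    exact absurd (hUΦ t₀ x₀ hU' ⟨le_rfl, htT.le⟩ hb0.le) hpos₀.not_ge
  have hcont : ContinuousOn (fun p : ℝ × ℝ => Real.exp (r * (T - p.1)) * Φ p.1 p.2 (V p.1))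
      (D \ U) := by
    have hV' : ContinuousOn (fun p : ℝ × ℝ => V p.1) (D \ U) :=
      hVc.comp continuousOn_fst fun p hp => hp.1.1.1
    have hpath : ContinuousOn (fun p : ℝ × ℝ => (p.1, p.2, V p.1)) (D \ U) :=
      continuousOn_fst.prodMk (continuousOn_snd.prodMk hV')
    have hmaps : MapsTo (fun p : ℝ × ℝ => (p.1, p.2, V p.1)) (D \ U)
        {p ∈ closedDomain a c r T H₁ β |
          H₁ ≤ K ∨ p.1 ≠ T ∨ p.2.1 ≠ barrier a c r T H₁ β T p.2.2} := by
      rintro ⟨t, x⟩ ⟨⟨⟨ht, -⟩, hx⟩, hnU⟩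
      refine ⟨hmemc t x ht hx, Or.inr ?_⟩
      by_contra! hcor
      simp only [barrier_terminal] at hcor
      obtain ⟨rfl, rfl⟩ := hcor
      exact hnU hUm
    have hfc := hf.continuousOn.comp hpath hmaps
    have hgc := hg.continuousOn.comp hpath hmaps
    have hL : ∀ {E : ℝ → ℝ → ℝ},
        (∀ s z : ℝ, 0 ≤ s → ContinuousAt (fun p : ℝ × ℝ => E p.1 p.2) (s, z)) →
        ContinuousOn (fun p : ℝ × ℝ => heatLift a c r T H₁ E p.1 p.2 (V p.1)) (D \ U) :=
      fun hE p hp => (continuousWithinAt_heatLift_path hE ha hc hH hVc hp.1.1.1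
        ((hbpos p.1).trans_le hp.1.2)).mono fun q hq => ⟨hq.1.1.1, mem_univ _⟩
    have hLG := hL hGcont
    have hLB := hL (E := heatBump ε) fun s z hs => continuousAt_heatBump hε hs z
    have ht : ContinuousOn (fun p : ℝ × ℝ => Real.exp (-r * (T - p.1)) * (T - p.1)) (D \ U) := by
      fun_prop
    exact ContinuousOn.mul (by fun_prop) ((((hfc.add (continuousOn_const.mul hgc)).add
      (continuousOn_const.mul ht)).add (continuousOn_const.mul hLG)).add
      (continuousOn_const.mul hLB))
  obtain ⟨⟨t₁, x₁⟩, ⟨hmD, hmU⟩, hmax⟩ := hDU.exists_isMaxOn ⟨_, hmem₀⟩ hcont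
  obtain ⟨⟨ht₁, -, hx₁R⟩, hx₁b⟩ := hmD
  simp only at ht₁ hx₁R hx₁b
  have hpos₁ : 0 < Φ t₁ x₁ (V t₁) := by
    have h1 : Real.exp (r * (T - t₀)) * Φ t₀ x₀ (V t₀)
      ≤ Real.exp (r * (T - t₁)) * Φ t₁ x₁ (V t₁) := hmax hmem₀
    exact pos_of_mul_pos_right ((mul_pos (Real.exp_pos _) hpos₀).trans_le h1) (Real.exp_pos _).le
  have hx₁b' : b t₁ < x₁ := lt_of_le_of_ne hx₁b fun h => by
    have := hΦb t₁ ht₁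
    rw [h] at this
    exact this.not_gt hpos₁
  have hx₁R' : x₁ < R := lt_of_le_of_ne hx₁R fun h => by
    have := hΦR t₁ ht₁ (h ▸ hx₁b)
    rw [← h] at this
    exact this.not_gt hpos₁
  have ht₁T : t₁ < T := lt_of_le_of_ne ht₁.2 fun h => by
    rw [h] at hpos₁ hx₁b'
    exact (hΦT x₁ (hbT ▸ hx₁b')).not_gt hpos₁
  have hle : ∀ t x, t ∈ Icc t₀ T → b t ≤ x → x ≤ R →
      Real.exp (r * (T - t)) * Φ t x (V t) ≤ Real.exp (r * (T - t₁)) * Φ t₁ x₁ (V t₁) := by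
    intro t x ht hbx hxR
    by_cases hUt : (t, x) ∈ U
    · exact (mul_nonpos_of_nonneg_of_nonpos (Real.exp_pos _).le (hUΦ t x hUt ht hbx)).trans
        (mul_pos (Real.exp_pos _) hpos₁).le
    · exact hmax (⟨⟨⟨ht, ((hbpos t).trans_le hbx).le, hxR⟩, hbx⟩, hUt⟩ : (t, x) ∈ D \ U)
  have hopen : (t₁, x₁, V t₁) ∈ openDomain a c r T H₁ β :=
    ⟨h0t.trans_le ht₁.1, ht₁T, hx₁b'⟩
  have hx₁0 : 0 < x₁ := (hbpos t₁).trans hx₁b'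
  have hsol := ((((hf.solvesAt ha hc hopen).add_const_mul
    (hg.solvesAt ha hc hopen) (-1)).add_const_mul
    (solvesAt_discountedTime (T := T) t₁ x₁ (V t₁)) (-ε)).add_const_mul
    (hGc.solvesAt_heatLift ha hc hH ht₁T hx₁0 (V t₁)) (-ε)).add_const_mul
    (hBc.solvesAt_heatLift ha hc hH ht₁T hx₁0 (V t₁)) (-(2 * B + 1))
  refine SolvesAt.not_isMax (T := T) hsol ?_ (hVd t₁ ht₁.1) ?_ ?_
  · have := mul_pos hε (Real.exp_pos (-r * (T - t₁)))
    linarith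
  · have hbt : ∀ᶠ s in 𝓝[>] t₁, b s < x₁ := by
      have h1 : ContinuousWithinAt b (Ioo t₁ T) t₁ :=
        (hbc t₁ ht₁).mono fun s hs => ⟨ht₁.1.trans hs.1.le, hs.2.le⟩
      rw [← nhdsWithin_Ioo_eq_nhdsGT ht₁T]
      exact h1.eventually_lt_const hx₁b'
    filter_upwards [hbt, Ioo_mem_nhdsGT ht₁T] with s hs hsT
    exact hle s x₁ ⟨ht₁.1.trans hsT.1.le, hsT.2.le⟩ hs.le hx₁R
  · filter_upwards [Ioo_mem_nhds hx₁b' hx₁R'] with y hy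
    exact le_of_mul_le_mul_left (hle t₁ y ht₁ hy.1.le hy.2.le) (Real.exp_pos _)

lemma IsZeroOrderTerm.le {f g : ℝ → ℝ → ℝ → ℝ} (hf : IsZeroOrderTerm a c r T K H₁ β f)
    (hg : IsZeroOrderTerm a c r T K H₁ β g) (ha : 0 < a) (hc : 0 < c) (hH : 0 < H₁)
    {t x v : ℝ} (h : (t, x, v) ∈ openDomain a c r T H₁ β) : f t x v ≤ g t x v := by
  obtain ⟨C', k, hle⟩ := hf.sub_le hg ha hc hH h
  have hS := gammaSq_pos ha hc h.2.1 v
  set A := Real.exp (-r * (T - t)) * (T - t)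
  set A' := heatLift a c r T H₁
    (fun s z => Real.exp ((k + 1 : ℕ) * z + ((k + 1 : ℕ) : ℝ) ^ 2 / 2 * s)) t x v
  have hbound : ∀ ε : ℝ, 0 < ε → f t x v - g t x v ≤
      ε * A + ε * A' + |C'| * (Real.exp (-r * (T - t)) * √(ε / gammaSq a c t T v)) := by
    intro ε hε
    refine (hle ε hε).trans (add_le_add le_rfl ?_)
    have h0 : 0 ≤ heatLift a c r T H₁ (heatBump ε) t x v :=
      mul_nonneg (Real.exp_pos _).le (heatBump_nonneg _ _ _)
    refine (mul_le_mul_of_nonneg_right (le_abs_self C') h0).trans ?_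
    unfold heatLift
    gcongr
    exact heatBump_le hε hS _
  have hlim : Tendsto (fun ε : ℝ => ε * A + ε * A'
      + |C'| * (Real.exp (-r * (T - t)) * √(ε / gammaSq a c t T v))) (𝓝[>] 0) (𝓝 0) := by
    have hc : Continuous (fun ε : ℝ => ε * A + ε * A'
      + |C'| * (Real.exp (-r * (T - t)) * √(ε / gammaSq a c t T v))) := by fun_prop
    have := hc.tendsto 0
    simp only [zero_mul, zero_div, Real.sqrt_zero, mul_zero, add_zero] at this
    exact this.mono_left nhdsWithin_le_nhds
  have := ge_of_tendsto hlim (eventually_nhdsWithin_of_forall fun ε hε => hbound ε hε)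
  linarith

/-- Solutions agree for `0 ≤ t ≤ T`, `x > ĥ(t,v)`: in the interior by comparison, at `t = 0` by
continuity and at `t = T` by the terminal condition. -/
theorem IsZeroOrderTerm.unique {f g : ℝ → ℝ → ℝ → ℝ} (hf : IsZeroOrderTerm a c r T K H₁ β f)
    (hg : IsZeroOrderTerm a c r T K H₁ β g) (ha : 0 < a) (hc : 0 < c) (hT : 0 < T) (hH : 0 < H₁)
    {t x v : ℝ} (h0 : 0 ≤ t) (htT : t ≤ T) (hx : barrier a c r T H₁ β t v < x) :
    f t x v = g t x v := by
  have hin : ∀ t, 0 < t → t < T → barrier a c r T H₁ β t v < x → f t x v = g t x v :=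
    fun t h1 h2 h3 => le_antisymm (hf.le hg ha hc hH ⟨h1, h2, h3⟩) (hg.le hf ha hc hH ⟨h1, h2, h3⟩)
  rcases htT.lt_or_eq with htT | rfl
  · rcases h0.lt_or_eq with h0 | rfl
    · exact hin t h0 htT hx
    · have hb : ∀ᶠ s in 𝓝[>] (0 : ℝ), barrier a c r T H₁ β s v < x := by
        have h1 : ContinuousWithinAt (fun s => barrier a c r T H₁ β s v) {s | s ≤ T} 0 :=
          ContinuousWithinAt.comp (t := {p : ℝ × ℝ | p.1 ≤ T})
            (g := fun p : ℝ × ℝ => barrier a c r T H₁ β p.1 p.2) (f := fun s : ℝ => (s, v))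
            (continuousOn_barrier ha hc (0, v) hT.le) (by fun_prop) fun s hs => hs
        have h2 : ContinuousAt (fun s => barrier a c r T H₁ β s v) 0 :=
          h1.continuousAt (Iic_mem_nhds hT)
        exact (h2.eventually_lt_const hx).filter_mono nhdsWithin_le_nhds
      have hmem : ∀ᶠ s in 𝓝[>] (0 : ℝ), s ∈ Ioo 0 T ∧ barrier a c r T H₁ β s v < x :=
        Filter.Eventually.and (Ioo_mem_nhdsGT hT) hb
      have hlim : ∀ {e : ℝ → ℝ → ℝ → ℝ}, IsZeroOrderTerm a c r T K H₁ β e →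
          Tendsto (fun s => e s x v) (𝓝[>] 0) (𝓝 (e 0 x v)) := by
        intro e he
        have h1 := he.continuousOn (0, x, v) ⟨⟨le_rfl, hT.le, hx.le⟩, Or.inr (Or.inl hT.ne)⟩
        refine Tendsto.comp (g := fun p : ℝ × ℝ × ℝ => e p.1 p.2.1 p.2.2)
          (f := fun s : ℝ => (s, x, v)) h1 (tendsto_nhdsWithin_iff.2 ⟨?_, ?_⟩)
        · exact (Continuous.tendsto' (by fun_prop) _ _ rfl).mono_left nhdsWithin_le_nhds
        · filter_upwards [hmem] with s hs
          exact ⟨⟨hs.1.1.le, hs.1.2.le, hs.2.le⟩, Or.inr (Or.inl hs.1.2.ne)⟩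
      refine tendsto_nhds_unique_of_eventuallyEq (hlim hf) (hlim hg) ?_
      filter_upwards [hmem] with s hs
      exact hin s hs.1.1 hs.1.2 hs.2
  · rw [hf.terminal x v hx, hg.terminal x v hx]

/-- At maturity the closed form tends to the terminal value. -/
lemma tendsto_closedForm (ha : 0 < a) (hc : 0 < c) (hT : 0 < T) (hH : 0 < H₁) {x v : ℝ}
    (hx : barrier a c r T H₁ β T v < x) :
    Tendsto (fun t => closedForm a c r T K H₁ β t x v) (𝓝[<] T) (𝓝 (max (x - K) 0)) := by
  have he := isZeroOrderTerm_zeroOrderTerm (r := r) (T := T) (K := K) (β := β) ha hc hH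
  have hx0 : 0 < x := (barrier_pos hH T v).trans hx
  have hb : ∀ᶠ s in 𝓝[<] T, barrier a c r T H₁ β s v < x := by
    have h1 : ContinuousWithinAt (fun s => barrier a c r T H₁ β s v) {s | s ≤ T} T :=
      ContinuousWithinAt.comp (t := {p : ℝ × ℝ | p.1 ≤ T})
        (g := fun p : ℝ × ℝ => barrier a c r T H₁ β p.1 p.2) (f := fun s : ℝ => (s, v))
        (continuousOn_barrier ha hc (T, v) (le_refl T)) (by fun_prop) fun s hs => hs
    exact (h1.mono fun s (hs : s < T) => hs.le).eventually_lt_const hx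
  have h1 := he.continuousOn (T, x, v) ⟨⟨hT.le, le_rfl, hx.le⟩, Or.inr (Or.inr hx.ne')⟩
  have h2 : Tendsto (fun s => zeroOrderTerm a c r T K H₁ β s x v) (𝓝[<] T)
      (𝓝 (zeroOrderTerm a c r T K H₁ β T x v)) := by
    refine Tendsto.comp (g := fun p : ℝ × ℝ × ℝ => zeroOrderTerm a c r T K H₁ β p.1 p.2.1 p.2.2)
      (f := fun s : ℝ => (s, x, v)) h1 (tendsto_nhdsWithin_iff.2 ⟨?_, ?_⟩)
    · exact (Continuous.tendsto' (by fun_prop) _ _ rfl).mono_left nhdsWithin_le_nhds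
    · filter_upwards [hb, Ioo_mem_nhdsLT hT] with s hs hsT
      exact ⟨⟨hsT.1.le, hsT.2.le, hs.le⟩, Or.inr (Or.inl hsT.2.ne)⟩
  rw [he.terminal x v hx] at h2
  refine h2.congr' ?_
  filter_upwards [self_mem_nhdsWithin] with s hs
  exact zeroOrderTerm_eq_closedForm ha hc hH hs hx0 v

lemma IsZeroOrderTerm.isGivenByClosedForm {f : ℝ → ℝ → ℝ → ℝ}
    (hf : IsZeroOrderTerm a c r T K H₁ β f) (ha : 0 < a) (hc : 0 < c) (hT : 0 < T) (hH : 0 < H₁) :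
    IsGivenByClosedForm a c r T K H₁ β f := by
  refine ⟨fun t x v h0 htT hx => ?_, fun x v hx => ?_⟩
  · rw [hf.unique (isZeroOrderTerm_zeroOrderTerm ha hc hH) ha hc hT hH h0 htT.le hx]
    exact zeroOrderTerm_eq_closedForm ha hc hH htT ((barrier_pos hH t v).trans hx) v
  · rw [hf.terminal x v hx]
    exact tendsto_closedForm ha hc hT hH hx

end Uniqueness

/-! ### The Wiener integral of a deterministic integrand -/

section Wiener

variable {σ σ' : ℝ → ℝ} {t u T : ℝ}

/-- `σ` is continuously differentiable on `[t, T]` with derivative `σ'`. -/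
structure IsC1On (σ σ' : ℝ → ℝ) (t T : ℝ) : Prop where
  hasDerivAt : ∀ l ∈ Icc t T, HasDerivAt σ (σ' l) l
  continuousOn_deriv : ContinuousOn σ' (Icc t T)

lemma IsC1On.mono {s : ℝ} (h : IsC1On σ σ' t T) (hs : t ≤ s) (hu : u ≤ T) : IsC1On σ σ' s u :=
  ⟨fun l hl => h.hasDerivAt l ⟨hs.trans hl.1, hl.2.trans hu⟩,
    h.continuousOn_deriv.mono (Icc_subset_Icc hs hu)⟩

lemma IsC1On.continuousOn (h : IsC1On σ σ' t T) : ContinuousOn σ (Icc t T) := fun l hl =>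
  (h.hasDerivAt l hl).continuousAt.continuousWithinAt

lemma IsC1On.sq (h : IsC1On σ σ' t T) :
    IsC1On (fun l => σ l ^ 2) (fun l => 2 * σ l * σ' l) t T :=
  ⟨fun l hl => ((h.hasDerivAt l hl).pow 2).congr_deriv (by simp),
    (continuousOn_const.mul h.continuousOn).mul h.continuousOn_deriv⟩

lemma IsC1On.tendsto_riemannSum (h : IsC1On σ σ' t T) (htT : t ≤ T) {w : ℝ≥0 → ℝ}
    (hw : Continuous w) :
    Tendsto (riemannSum σ w t T) atTop (𝓝 (wienerIntegral σ w t T)) :=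
  tendsto_nhds_limUnder ⟨_, SmallVolOfVol.tendsto_riemannSum htT hw h.hasDerivAt
    h.continuousOn_deriv⟩

lemma IsC1On.wienerIntegral_eq (h : IsC1On σ σ' t T) (htT : t ≤ T) {w : ℝ≥0 → ℝ}
    (hw : Continuous w) :
    wienerIntegral σ w t T = σ T * w T.toNNReal - σ t * w t.toNNReal
      - ∫ l in t..T, w l.toNNReal * σ' l :=
  (SmallVolOfVol.tendsto_riemannSum htT hw h.hasDerivAt h.continuousOn_deriv).limUnder_eq

lemma wienerIntegral_self (σ : ℝ → ℝ) (w : ℝ≥0 → ℝ) (t : ℝ) : wienerIntegral σ w t t = 0 := by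
  have h : riemannSum σ w t t = fun _ => 0 := by
    funext n
    simp [riemannSum]
  rw [wienerIntegral, h]
  exact tendsto_const_nhds.limUnder_eq

lemma IsC1On.intervalIntegrable (h : IsC1On σ σ' t T) (htT : t ≤ T) {w : ℝ≥0 → ℝ}
    (hw : Continuous w) : IntervalIntegrable (fun l => w l.toNNReal * σ' l) volume t T := by
  refine ContinuousOn.intervalIntegrable ?_
  rw [uIcc_of_le htT]
  exact (hw.comp continuous_real_toNNReal).continuousOn.mul h.continuousOn_deriv

lemma IsC1On.wienerIntegral_add (h : IsC1On σ σ' t T) (htu : t ≤ u) (huT : u ≤ T)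
    {w : ℝ≥0 → ℝ} (hw : Continuous w) :
    wienerIntegral σ w t u + wienerIntegral σ w u T = wienerIntegral σ w t T := by
  rw [h.wienerIntegral_eq (htu.trans huT) hw, (h.mono le_rfl huT).wienerIntegral_eq htu hw,
    (h.mono htu le_rfl).wienerIntegral_eq huT hw,
    ← intervalIntegral.integral_add_adjacent_intervals
      ((h.mono le_rfl huT).intervalIntegrable htu hw)
      ((h.mono htu le_rfl).intervalIntegrable huT hw)]
  ring

lemma IsC1On.continuousOn_wienerIntegral (h : IsC1On σ σ' t T) {w : ℝ≥0 → ℝ}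
    (hw : Continuous w) : ContinuousOn (fun u => wienerIntegral σ w t u) (Icc t T) := by
  rcases lt_or_ge T t with hlt | htT
  · simp [Icc_eq_empty hlt.not_ge]
  have hI := intervalIntegral.continuousOn_primitive_interval'
    (h.intervalIntegrable htT hw) left_mem_uIcc
  rw [uIcc_of_le htT] at hI
  have hw' : Continuous fun u : ℝ => w u.toNNReal := hw.comp continuous_real_toNNReal
  have hc : ContinuousOn (fun u => σ u * w u.toNNReal - σ t * w t.toNNReal
      - ∫ l in t..u, w l.toNNReal * σ' l) (Icc t T) :=
    ((h.continuousOn.mul hw'.continuousOn).sub continuousOn_const).sub hI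
  refine hc.congr fun u hu => ?_
  exact (h.mono le_rfl hu.2).wienerIntegral_eq hu.1 hw

lemma measurable_wienerIntegral {E : Type*} [MeasurableSpace E] {w : ℝ≥0 → E → ℝ}
    (hw : ∀ q, Measurable (w q)) (σ : ℝ → ℝ) (t u : ℝ) :
    Measurable fun e => wienerIntegral σ (fun q => w q e) t u := by
  refine (StronglyMeasurable.limUnder fun n => ?_).measurable
  refine Measurable.stronglyMeasurable ?_
  unfold riemannSum
  exact Finset.measurable_fun_sum _ fun i _ => measurable_const.mul ((hw _).sub (hw _))

lemma wienerIntegral_congr {w w' : ℝ≥0 → ℝ} (htu : t ≤ u)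
    (h : ∀ p q, p ∈ Icc t u → q ∈ Icc t u →
      w p.toNNReal - w q.toNNReal = w' p.toNNReal - w' q.toNNReal) :
    wienerIntegral σ w t u = wienerIntegral σ w' t u := by
  have hr : riemannSum σ w t u = riemannSum σ w' t u := by
    funext n
    refine Finset.sum_congr rfl fun i hi => ?_
    have hi' : i < n := Finset.mem_range.1 hi
    have hn : (0 : ℝ) < n := by exact_mod_cast (Nat.zero_le i).trans_lt hi'
    have hmem : ∀ j : ℕ, j ≤ n → t + j * ((u - t) / n) ∈ Icc t u := fun j hj => by
      have hj' : (j : ℝ) ≤ n := by exact_mod_cast hj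
      have h0 : 0 ≤ (u - t) / n := div_nonneg (by linarith) hn.le
      have h1 : (j : ℝ) * ((u - t) / n) ≤ n * ((u - t) / n) := by gcongr
      have h2 : n * ((u - t) / n) = u - t := by field_simp
      have h3 : 0 ≤ (j : ℝ) * ((u - t) / n) := by positivity
      constructor <;> linarith
    rw [h _ _ (hmem (i + 1) hi') (hmem i hi'.le)]
  rw [wienerIntegral, wienerIntegral, hr]

section Law

variable {Ω : Type*} [MeasurableSpace Ω] {P : Measure Ω} {W : ℝ≥0 → Ω → ℝ}

lemma aemeasurable_riemannSum (hW : IsBrownianReal W P) (σ : ℝ → ℝ) (t u : ℝ) (n : ℕ) :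
    AEMeasurable (fun ω => riemannSum σ (fun q => W q ω) t u n) P := by
  unfold riemannSum
  exact Finset.aemeasurable_fun_sum _ fun i _ =>
    ((hW.aemeasurable _).sub (hW.aemeasurable _)).const_mul _

lemma IsC1On.aemeasurable_wienerIntegral (h : IsC1On σ σ' t T) (htT : t ≤ T)
    (hW : IsBrownianReal W P) :
    AEMeasurable (fun ω => wienerIntegral σ (fun q => W q ω) t T) P := by
  refine aemeasurable_of_tendsto_metrizable_ae atTop
    (fun n => aemeasurable_riemannSum hW σ t T n) ?_
  filter_upwards [hW.cont] with ω hω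
  exact h.tendsto_riemannSum htT hω

/-- A Riemann sum is a sum of independent centered Gaussian variables; its variance is the Riemann
sum of `σ²`. -/
lemma charFun_riemannSum (hW : IsBrownianReal W P) (σ : ℝ → ℝ) (htu : t ≤ u) (n : ℕ) (θ : ℝ) :
    charFun (P.map fun ω => riemannSum σ (fun q => W q ω) t u n) θ
      = Complex.exp
          (-(riemannSum (fun l => σ l ^ 2) (fun q => (q : ℝ)) t u n : ℝ) * θ ^ 2 / 2) := by
  set p : ℕ → ℝ := fun i => t + i * ((u - t) / n)
  have hp : Monotone p := fun i j hij => by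
    have h0 : 0 ≤ (u - t) / n := div_nonneg (by linarith) (Nat.cast_nonneg n)
    simp only [p]
    gcongr
  have hpn : Monotone fun i => (p i).toNNReal := fun i j hij => Real.toNNReal_mono (hp hij)
  have hind : iIndepFun (fun i ω =>
      σ (p i) * (W (p (i + 1)).toNNReal ω - W (p i).toNNReal ω)) P :=
    (hW.hasIndepIncrements.nat hpn).comp (fun i y => σ (p i) * y)
      fun i => measurable_const_mul _
  have hind' : iIndepFun ((Finset.range n).restrict fun i ω =>
      σ (p i) * (W (p (i + 1)).toNNReal ω - W (p i).toNNReal ω)) P :=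
    hind.precomp (g := fun i : Finset.range n => (i : ℕ)) Subtype.val_injective
  have hmeas : ∀ i ∈ Finset.range n, AEMeasurable (fun ω =>
      σ (p i) * (W (p (i + 1)).toNNReal ω - W (p i).toNNReal ω)) P := fun i _ =>
    ((hW.aemeasurable _).sub (hW.aemeasurable _)).const_mul _
  have key := congrFun (hind'.charFun_map_fun_finsetSum_eq_prod hmeas) θ
  have hterm : ∀ i, charFun (P.map fun ω =>
      σ (p i) * (W (p (i + 1)).toNNReal ω - W (p i).toNNReal ω)) θ
      = Complex.exp (((-(σ (p i) ^ 2 * (((p (i + 1)).toNNReal : ℝ) - ((p i).toNNReal : ℝ)))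
          * θ ^ 2 / 2 : ℝ) : ℂ)) := by
    intro i
    obtain ⟨N, hN, hl⟩ : ∃ N : ℝ≥0,
        (N : ℝ) = ((p (i + 1)).toNNReal : ℝ) - ((p i).toNNReal : ℝ) ∧
        HasLaw (W (p (i + 1)).toNNReal - W (p i).toNNReal) (gaussianReal 0 N) P := by
      refine ⟨_, ?_, hW.hasLaw_sub (p (i + 1)).toNNReal (p i).toNNReal⟩
      rw [coe_nndist, Real.dist_eq]
      exact abs_of_nonneg (sub_nonneg.2 (by exact_mod_cast hpn i.le_succ))
    have hl' : P.map (fun ω => σ (p i) * (W (p (i + 1)).toNNReal ω - W (p i).toNNReal ω)) = _ :=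
      (gaussianReal_const_mul hl (σ (p i))).map_eq
    rw [hl', charFun_gaussianReal, ← hN]
    congr 1
    push_cast
    ring
  rw [Finset.prod_apply] at key
  simp_rw [hterm] at key
  rw [← Complex.exp_sum, ← Complex.ofReal_sum, ← Finset.sum_div, ← Finset.sum_mul,
    Finset.sum_neg_distrib] at key
  refine key.trans ?_
  have e : riemannSum (fun l => σ l ^ 2) (fun q => (q : ℝ)) t u n = ∑ i ∈ Finset.range n,
      σ (p i) ^ 2 * (((p (i + 1)).toNNReal : ℝ) - ((p i).toNNReal : ℝ)) := rfl
  rw [e]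
  push_cast
  rfl

lemma IsC1On.tendsto_riemannSum_coe (h : IsC1On σ σ' t T) (h0 : 0 ≤ t) (htT : t ≤ T) :
    Tendsto (riemannSum σ (fun q => (q : ℝ)) t T) atTop (𝓝 (∫ l in t..T, σ l)) := by
  have h1 := SmallVolOfVol.tendsto_riemannSum htT NNReal.continuous_coe h.hasDerivAt
    h.continuousOn_deriv
  have hI : IntervalIntegrable σ volume t T := by
    refine ContinuousOn.intervalIntegrable ?_
    rw [uIcc_of_le htT]
    exact h.continuousOn
  have hI' := h.intervalIntegrable htT NNReal.continuous_coe
  have hsum : ∫ l in t..T, (σ l + (l.toNNReal : ℝ) * σ' l) = σ T * T - σ t * t := by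
    refine intervalIntegral.integral_eq_sub_of_hasDerivAt (f := fun l => σ l * l) (fun l hl => ?_)
      (hI.add hI')
    rw [uIcc_of_le htT] at hl
    refine ((h.hasDerivAt l hl).mul (hasDerivAt_id l)).congr_deriv ?_
    rw [Real.coe_toNNReal l (h0.trans hl.1), id_eq]
    ring
  rw [intervalIntegral.integral_add hI hI'] at hsum
  rw [Real.coe_toNNReal T (h0.trans htT), Real.coe_toNNReal t h0] at h1
  convert h1 using 2
  linarith

/-- The Wiener integral is a centered Gaussian variable with variance `∫ σ²`. -/
lemma IsC1On.hasLaw_wienerIntegral (h : IsC1On σ σ' t T) (h0 : 0 ≤ t) (htT : t ≤ T)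
    (hW : IsBrownianReal W P) :
    HasLaw (fun ω => wienerIntegral σ (fun q => W q ω) t T)
      (gaussianReal 0 (∫ l in t..T, σ l ^ 2).toNNReal) P := by
  have : IsProbabilityMeasure P := hW.isGaussianProcess.isProbabilityMeasure
  have hm := h.aemeasurable_wienerIntegral htT hW
  refine ⟨hm, ?_⟩
  have : IsProbabilityMeasure (P.map fun ω => wienerIntegral σ (fun q => W q ω) t T) :=
    Measure.isProbabilityMeasure_map hm
  refine Measure.ext_of_charFun (funext fun θ => ?_)
  have h1 : Tendsto (fun n => charFun (P.map fun ω => riemannSum σ (fun q => W q ω) t T n) θ) atTop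
      (𝓝 (charFun (P.map fun ω => wienerIntegral σ (fun q => W q ω) t T) θ)) := by
    simp_rw [charFun_apply_real]
    rw [integral_map hm (by fun_prop)]
    have e : ∀ n, ∫ x, Complex.exp (θ * x * Complex.I)
        ∂(P.map fun ω => riemannSum σ (fun q => W q ω) t T n)
        = ∫ ω, Complex.exp (θ * (riemannSum σ (fun q => W q ω) t T n : ℝ) * Complex.I) ∂P :=
      fun n => integral_map (aemeasurable_riemannSum hW σ t T n) (by fun_prop)
    simp_rw [e]
    have hcont : Continuous fun x : ℝ => Complex.exp (θ * (x : ℂ) * Complex.I) := by fun_prop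
    refine tendsto_integral_of_dominated_convergence (fun _ => 1) (fun n =>
      (hcont.measurable.comp_aemeasurable
        (aemeasurable_riemannSum hW σ t T n)).aestronglyMeasurable)
      (integrable_const _) (fun n => ae_of_all _ fun ω => ?_) ?_
    · rw [← Complex.ofReal_mul, Complex.norm_exp_ofReal_mul_I]
    · filter_upwards [hW.cont] with ω hω
      exact (hcont.tendsto _).comp (h.tendsto_riemannSum htT hω)
  have h2 : Tendsto (fun n => charFun (P.map fun ω => riemannSum σ (fun q => W q ω) t T n) θ) atTop
      (𝓝 (charFun (gaussianReal 0 (∫ l in t..T, σ l ^ 2).toNNReal) θ)) := by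
    simp_rw [charFun_riemannSum hW σ htT, charFun_gaussianReal]
    have hpos : 0 ≤ ∫ l in t..T, σ l ^ 2 :=
      intervalIntegral.integral_nonneg htT fun l _ => sq_nonneg _
    have hcont : Continuous fun x : ℝ => Complex.exp (-(x : ℂ) * θ ^ 2 / 2) := by fun_prop
    have := (hcont.tendsto _).comp (h.sq.tendsto_riemannSum_coe h0 htT)
    rw [Real.coe_toNNReal _ hpos]
    simpa [neg_div, Function.comp_def] using this
  exact tendsto_nhds_unique h1 h2

/-- The Wiener integral over `[u, T]` is independent of the Wiener integrals up to times
`p i ≤ u`. -/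
lemma indepFun_wienerIntegral (hW : IsBrownianReal W P) (σ : ℝ → ℝ) (huT : u ≤ T)
    {ι : Type*} (p : ι → ℝ) (htp : ∀ i, t ≤ p i) (hpu : ∀ i, p i ≤ u) :
    IndepFun (fun ω => wienerIntegral σ (fun q => W q ω) u T)
      (fun ω i => wienerIntegral σ (fun q => W q ω) t (p i)) P := by
  set u' := u.toNNReal
  set φ : (ℝ≥0 → ℝ) → ℝ := fun w => wienerIntegral σ (fun q => w (q - u')) u T
  set ψ : (Iic u' → ℝ) → ι → ℝ := fun w i =>
    wienerIntegral σ (fun q => w ⟨min q u', mem_Iic.2 (min_le_right _ _)⟩) t (p i)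
  have hφ : Measurable φ :=
    measurable_wienerIntegral (fun q => measurable_pi_apply (q - u')) σ u T
  have hψ : Measurable ψ := measurable_pi_lambda _ fun i =>
    measurable_wienerIntegral (fun q => measurable_pi_apply
      (⟨min q u', mem_Iic.2 (min_le_right _ _)⟩ : Iic u'))
      σ t (p i)
  have h := (hW.indepFun_shift u').comp hφ hψ
  refine h.congr (Eventually.of_forall fun ω => ?_) (Eventually.of_forall fun ω => ?_)
  · refine wienerIntegral_congr huT fun x y hx hy => ?_
    have e : ∀ z ∈ Icc u T, u' + (z.toNNReal - u') = z.toNNReal := fun z hz =>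
      add_tsub_cancel_of_le (Real.toNNReal_mono hz.1)
    simp only [e x hx, e y hy]
    ring
  · funext i
    refine wienerIntegral_congr (htp i) fun x y hx hy => ?_
    have e : ∀ z ∈ Icc t (p i), min z.toNNReal u' = z.toNNReal := fun z hz =>
      min_eq_left (Real.toNNReal_mono (hz.2.trans (hpu i)))
    simp only [e x hx, e y hy]

end Law

end Wiener

/-! ### The reflection principle -/

section Grid

variable {Ω : Type*} {M : ℝ → Ω → ℝ} {q : ℝ → ℝ} {t T β y : ℝ}

/-- The `k`-th point of the partition of `[t, T]` into `n + 1` intervals. -/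
def gridPoint (t T : ℝ) (n k : ℕ) : ℝ := t + k * ((T - t) / (n + 1))

lemma gridPoint_zero (n : ℕ) : gridPoint t T n 0 = t := by simp [gridPoint]

lemma gridPoint_last (n : ℕ) : gridPoint t T n (n + 1) = T := by
  have : (n : ℝ) + 1 ≠ 0 := by positivity
  rw [gridPoint]
  push_cast
  field_simp
  ring

lemma gridPoint_succ (n k : ℕ) :
    gridPoint t T n (k + 1) = gridPoint t T n k + (T - t) / (n + 1) := by
  simp only [gridPoint]
  push_cast
  ring

lemma gridPoint_mono (htT : t ≤ T) (n : ℕ) : Monotone (gridPoint t T n) := by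
  refine monotone_nat_of_le_succ fun k => ?_
  rw [gridPoint_succ]
  exact le_add_of_nonneg_right (div_nonneg (by linarith) (by positivity))

lemma gridPoint_mem (htT : t ≤ T) {n k : ℕ} (hk : k ≤ n + 1) : gridPoint t T n k ∈ Icc t T := by
  constructor
  · exact (gridPoint_zero n).symm.le.trans (gridPoint_mono htT n (Nat.zero_le k))
  · exact (gridPoint_mono htT n hk).trans (gridPoint_last n).le

lemma eventually_mesh_lt (t T : ℝ) {δ : ℝ} (hδ : 0 < δ) :
    ∀ᶠ n : ℕ in atTop, (T - t) / ((n : ℝ) + 1) < δ := by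
  have h : Tendsto (fun n : ℕ => (T - t) / ((n : ℝ) + 1)) atTop (𝓝 0) :=
    tendsto_const_nhds.div_atTop
      (tendsto_atTop_add_const_right _ _ tendsto_natCast_atTop_atTop)
  exact h.eventually_lt_const hδ

/-- On a fine grid, a function that vanishes at the zeros of a continuous path is small at the first
grid point at which the path is not positive. -/
lemma eventually_abs_le_at_first_passage {x Ψ : ℝ → ℝ} (htT : t ≤ T)
    (hx : ContinuousOn x (Icc t T)) (hΨ : ContinuousOn Ψ (Icc t T))
    (hzero : ∀ u ∈ Icc t T, x u = 0 → Ψ u = 0) (hxt : 0 < x t) {ε : ℝ} (hε : 0 < ε) :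
    ∀ᶠ n : ℕ in atTop, ∀ k ≤ n + 1, (∀ j < k, 0 < x (gridPoint t T n j)) →
      x (gridPoint t T n k) ≤ 0 → |Ψ (gridPoint t T n k)| ≤ ε := by
  obtain ⟨δ, hδ, hΨδ⟩ := Metric.uniformContinuousOn_iff.1
    (isCompact_Icc.uniformContinuousOn_of_continuous hΨ) ε hε
  filter_upwards [eventually_mesh_lt t T hδ] with n hn k hk hpos hle
  obtain _ | k := k
  · rw [gridPoint_zero] at hle
    exact absurd hle hxt.not_ge
  have hm0 := gridPoint_mem htT (t := t) (T := T) (n := n) (k := k) (by omega)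
  have hm1 := gridPoint_mem htT (t := t) (T := T) (n := n) (k := k + 1) hk
  have hle' : gridPoint t T n k ≤ gridPoint t T n (k + 1) := gridPoint_mono htT n k.le_succ
  obtain ⟨u, hu, hu0⟩ := intermediate_value_Icc' hle' (hx.mono (Icc_subset_Icc hm0.1 hm1.2))
    ⟨hle, (hpos k k.lt_succ_self).le⟩
  have hu' : u ∈ Icc t T := ⟨hm0.1.trans hu.1, hu.2.trans hm1.2⟩
  have hd := hΨδ _ hm1 u hu' (by
    rw [Real.dist_eq, abs_of_nonneg (sub_nonneg.2 hu.2)]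
    have := gridPoint_succ (t := t) (T := T) n k
    linarith [hu.1])
  rw [hzero u hu' hu0, dist_zero_right] at hd
  exact hd.le

/-- A fine grid detects that a continuous path takes a negative value. -/
lemma eventually_exists_gridPoint_neg {x : ℝ → ℝ} (htT : t < T) (hx : ContinuousOn x (Icc t T))
    {u : ℝ} (hu : u ∈ Icc t T) (hneg : x u < 0) :
    ∀ᶠ n : ℕ in atTop, ∃ k < n + 2, x (gridPoint t T n k) < 0 := by
  obtain ⟨δ, hδ, hball⟩ := Metric.continuousOn_iff.1 hx u hu (-x u) (by linarith)
  filter_upwards [eventually_mesh_lt t T hδ] with n hn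
  have hm : 0 < (T - t) / ((n : ℝ) + 1) := div_pos (by linarith) (by positivity)
  set m := (T - t) / ((n : ℝ) + 1) with hmdef
  have hq : 0 ≤ (u - t) / m := div_nonneg (by linarith [hu.1]) hm.le
  set k := ⌊(u - t) / m⌋₊
  have h1 : (k : ℝ) * m ≤ u - t := (le_div_iff₀ hm).1 (Nat.floor_le hq)
  have h2 : u - t < (k + 1) * m := (div_lt_iff₀ hm).1 (Nat.lt_floor_add_one _)
  have hk : k < n + 2 := by
    by_contra! hcon
    have h3 : ((n : ℝ) + 2) ≤ k := by exact_mod_cast hcon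
    have h4 : ((n : ℝ) + 1) * m = T - t := by rw [hmdef]; field_simp
    have h5 : ((n : ℝ) + 2) * m ≤ k * m := by gcongr
    linarith [hu.2]
  have hmem := gridPoint_mem htT.le (n := n) (k := k) (by omega)
  refine ⟨k, hk, ?_⟩
  have hdist : dist (gridPoint t T n k) u < δ := by
    rw [Real.dist_eq, abs_lt]
    have : gridPoint t T n k = t + k * m := rfl
    constructor <;> linarith
  have := hball _ hmem hdist
  rw [Real.dist_eq, abs_lt] at this
  linarith [this.2]

/-- The process `y + β q(u) + M_u`. -/
def drifted (M : ℝ → Ω → ℝ) (q : ℝ → ℝ) (β y u : ℝ) (ω : Ω) : ℝ := y + β * q u + M u ω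

/-- The event that the drifted process is positive at the grid points with index below `k`. -/
def gridAlive (M : ℝ → Ω → ℝ) (q : ℝ → ℝ) (t T β y : ℝ) (n k : ℕ) : Set Ω :=
  {ω | ∀ j < k, 0 < drifted M q β y (gridPoint t T n j) ω}

lemma gridAlive_anti (n : ℕ) {k l : ℕ} (hkl : k ≤ l) :
    gridAlive M q t T β y n l ⊆ gridAlive M q t T β y n k := fun _ hω j hj => hω j (hj.trans_le hkl)

lemma gridAlive_zero (n : ℕ) : gridAlive M q t T β y n 0 = univ := by
  simp [gridAlive]

/-- Decomposition by the first grid point at which the process is not positive. -/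
lemma sum_indicator_gridAlive (n m : ℕ) (F : Ω → ℝ) (ω : Ω) :
    ∑ k ∈ Finset.range m,
      (gridAlive M q t T β y n k \ gridAlive M q t T β y n (k + 1)).indicator F ω
      = F ω - (gridAlive M q t T β y n m).indicator F ω := by
  have e : ∀ k, (gridAlive M q t T β y n k \ gridAlive M q t T β y n (k + 1)).indicator F ω
      = (gridAlive M q t T β y n k).indicator F ω
        - (gridAlive M q t T β y n (k + 1)).indicator F ω := fun k => by
    rw [indicator_sdiff (gridAlive_anti n k.le_succ)]
    rfl
  simp_rw [e]
  rw [Finset.sum_range_sub' (fun k => (gridAlive M q t T β y n k).indicator F ω), gridAlive_zero,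
    indicator_univ]

end Grid

section Reflection

variable {Ω : Type*} [MeasurableSpace Ω] {P : Measure Ω} {M : ℝ → Ω → ℝ} {q : ℝ → ℝ}
  {t T β y : ℝ} {f : ℝ → ℝ}

/-- `M` is on `[t, T]` a Brownian motion in the clock `q`, started from `0`: the part of this
structure that the reflection principle uses. -/
structure IsClockedBM (M : ℝ → Ω → ℝ) (q : ℝ → ℝ) (t T : ℝ) (P : Measure Ω) : Prop where
  lt : t < T
  clock_continuousOn : ContinuousOn q (Icc t T)
  clock_start : q t = 0
  clock_lt : ∀ u ∈ Ico t T, q u < q T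
  start : ∀ ω, M t ω = 0
  continuousOn : ∀ᵐ ω ∂P, ContinuousOn (fun u => M u ω) (Icc t T)
  aemeasurable : ∀ u ∈ Icc t T, AEMeasurable (M u) P
  hasLaw : ∀ u ∈ Icc t T,
    HasLaw (fun ω => M T ω - M u ω) (gaussianReal 0 (q T - q u).toNNReal) P
  indepFun : ∀ u ∈ Icc t T, ∀ p : ℕ → ℝ, (∀ i, p i ∈ Icc t u) →
    IndepFun (fun ω => M T ω - M u ω) (fun ω i => M (p i) ω) P

/-- `f` is an admissible terminal value: it is of exponential growth with countably many
discontinuities, and the solution of the heat equation with initial value `f` vanishes on the line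
`z = β s`. -/
structure IsReflected (f : ℝ → ℝ) (β : ℝ) : Prop where
  expGrowth : ExpGrowth f
  countable : {z | ¬ ContinuousAt f z}.Countable
  boundary : ∀ s, 0 ≤ s → heatEval f s (β * s) = 0

lemma gaussianReal_map_sqrt_mul {s : ℝ} (hs : 0 ≤ s) :
    (gaussianReal 0 1).map (fun ξ => √s * ξ) = gaussianReal 0 s.toNNReal := by
  rw [gaussianReal_map_const_mul, mul_zero]
  congr 1
  ext
  simp [Real.sq_sqrt hs, Real.coe_toNNReal s hs]

lemma integral_gaussianReal_eq_heatEval (hf : Measurable f) {s : ℝ} (hs : 0 ≤ s) (z : ℝ) :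
    ∫ ρ, f (z + ρ) ∂gaussianReal 0 s.toNNReal = heatEval f s z := by
  rw [← gaussianReal_map_sqrt_mul hs]
  exact integral_map (f := fun ρ => f (z + ρ)) (by fun_prop)
    (hf.comp (measurable_const_add z)).aestronglyMeasurable

lemma ExpGrowth.integrable_gaussianReal (hf : ExpGrowth f) {s : ℝ} (hs : 0 ≤ s) (z : ℝ) :
    Integrable (fun ρ => f (z + ρ)) (gaussianReal 0 s.toNNReal) := by
  rw [← gaussianReal_map_sqrt_mul hs]
  exact (integrable_map_measure (g := fun ρ => f (z + ρ))
    (hf.measurable.comp (measurable_const_add z)).aestronglyMeasurable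
    (by fun_prop)).2 (hf.integrable s z)

/-- Averaging over an independent Gaussian increment. -/
lemma integral_mul_comp_add_of_indepFun [IsProbabilityMeasure P] {E : Type*} [MeasurableSpace E]
    {R : Ω → ℝ} {V : Ω → E} {e m : E → ℝ} {s : ℝ} (hs : 0 ≤ s)
    (hR : HasLaw R (gaussianReal 0 s.toNNReal) P) (hV : AEMeasurable V P) (hind : IndepFun R V P)
    (hf : ExpGrowth f) (he : Measurable e) (hm : Measurable m)
    (hint : Integrable (fun ω => e (V ω) * f (m (V ω) + R ω)) P) :
    Integrable (fun ω => e (V ω) * heatEval f s (m (V ω))) P ∧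
    ∫ ω, e (V ω) * f (m (V ω) + R ω) ∂P = ∫ ω, e (V ω) * heatEval f s (m (V ω)) ∂P := by
  have hprod : P.map (fun ω => (V ω, R ω)) = (P.map V).prod (gaussianReal 0 s.toNNReal) := by
    rw [← hR.map_eq]
    exact (indepFun_iff_map_prod_eq_prod_map_map hV hR.aemeasurable).1 hind.symm
  have : IsProbabilityMeasure (P.map V) := Measure.isProbabilityMeasure_map hV
  have hVR : AEMeasurable (fun ω => (V ω, R ω)) P := hV.prodMk hR.aemeasurable
  have hφ : Measurable fun x : E × ℝ => e x.1 * f (m x.1 + x.2) :=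
    (he.comp measurable_fst).mul
      (hf.measurable.comp ((hm.comp measurable_fst).add measurable_snd))
  have hint' : Integrable (fun x : E × ℝ => e x.1 * f (m x.1 + x.2))
      ((P.map V).prod (gaussianReal 0 s.toNNReal)) := by
    rw [← hprod]
    exact (integrable_map_measure hφ.aestronglyMeasurable hVR).2 hint
  have h1 : ∫ ω, e (V ω) * f (m (V ω) + R ω) ∂P
      = ∫ x, e x.1 * f (m x.1 + x.2) ∂((P.map V).prod (gaussianReal 0 s.toNNReal)) := by
    rw [← hprod, integral_map hVR hφ.aestronglyMeasurable]
  have h2 : ∀ v, ∫ ρ, e v * f (m v + ρ) ∂gaussianReal 0 s.toNNReal = e v * heatEval f s (m v) :=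
    fun v => by rw [integral_const_mul, integral_gaussianReal_eq_heatEval hf.measurable hs]
  have h3 : AEStronglyMeasurable (fun v => e v * heatEval f s (m v)) (P.map V) := by
    simp_rw [← h2]
    exact hφ.aestronglyMeasurable.integral_prod_right'
  have h4 : Integrable (fun v => e v * heatEval f s (m v)) (P.map V) := by
    simp_rw [← h2]
    exact hint'.integral_prod_left
  refine ⟨(integrable_map_measure h3 hV).1 h4, ?_⟩
  rw [h1, integral_prod _ hint']
  simp_rw [h2]
  exact integral_map hV h3

namespace IsClockedBM

lemma isProbabilityMeasure (h : IsClockedBM M q t T P) : IsProbabilityMeasure P :=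
  (h.hasLaw T (right_mem_Icc.2 h.lt.le)).isProbabilityMeasure

lemma clock_le (h : IsClockedBM M q t T P) {u : ℝ} (hu : u ∈ Icc t T) : 0 ≤ q T - q u := by
  rcases hu.2.eq_or_lt with rfl | hlt
  · simp
  · exact sub_nonneg.2 (h.clock_lt u ⟨hu.1, hlt⟩).le

lemma clock_pos (h : IsClockedBM M q t T P) : 0 < q T := by
  simpa [h.clock_start] using h.clock_lt t ⟨le_rfl, h.lt⟩

lemma hasLaw_terminal (h : IsClockedBM M q t T P) :
    HasLaw (M T) (gaussianReal 0 (q T).toNNReal) P := by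
  have := h.hasLaw t (left_mem_Icc.2 h.lt.le)
  simpa [h.start, h.clock_start] using this

lemma integrable_terminal (h : IsClockedBM M q t T P) (hf : ExpGrowth f) (β y : ℝ) :
    Integrable (fun ω => f (drifted M q β y T ω)) P := by
  have h1 := hf.integrable_gaussianReal h.clock_pos.le (y + β * q T)
  rw [← h.hasLaw_terminal.map_eq] at h1
  exact (integrable_map_measure h1.aestronglyMeasurable h.hasLaw_terminal.aemeasurable).1 h1

lemma integral_terminal (h : IsClockedBM M q t T P) (hf : ExpGrowth f) (β y : ℝ) :
    ∫ ω, f (drifted M q β y T ω) ∂P = heatEval f (q T) (y + β * q T) := by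
  rw [← integral_gaussianReal_eq_heatEval hf.measurable h.clock_pos.le,
    ← h.hasLaw_terminal.map_eq]
  exact (integral_map (f := fun ρ => f (y + β * q T + ρ)) h.hasLaw_terminal.aemeasurable
    (hf.measurable.comp (measurable_const_add _)).aestronglyMeasurable).symm

lemma nullMeasurableSet_gridAlive (h : IsClockedBM M q t T P) (β y : ℝ) {n k : ℕ}
    (hk : k ≤ n + 2) : NullMeasurableSet (gridAlive M q t T β y n k) P := by
  have e : gridAlive M q t T β y n k
      = ⋂ j : Fin k, {ω | 0 < drifted M q β y (gridPoint t T n j) ω} := by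
    ext ω
    simp only [gridAlive, mem_ofPred_eq, mem_iInter]
    exact ⟨fun hω j => hω j j.2, fun hω j hj => hω ⟨j, hj⟩⟩
  rw [e]
  refine NullMeasurableSet.iInter fun j => nullMeasurableSet_lt aemeasurable_const ?_
  exact (h.aemeasurable _ (gridPoint_mem h.lt.le (by omega))).const_add _

/-- Conditioning at the first grid point at which the process is not positive. -/
lemma integral_indicator_firstPassage (h : IsClockedBM M q t T P) (hf : ExpGrowth f) (β y : ℝ)
    {n k : ℕ} (hk : k ≤ n + 1) :
    Integrable ((gridAlive M q t T β y n k \ gridAlive M q t T β y n (k + 1)).indicator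
      fun ω => heatEval f (q T - q (gridPoint t T n k))
        (y + β * q T + M (gridPoint t T n k) ω)) P ∧
    ∫ ω, (gridAlive M q t T β y n k \ gridAlive M q t T β y n (k + 1)).indicator
      (fun ω => f (drifted M q β y T ω)) ω ∂P
    = ∫ ω, (gridAlive M q t T β y n k \ gridAlive M q t T β y n (k + 1)).indicator
      (fun ω => heatEval f (q T - q (gridPoint t T n k))
        (y + β * q T + M (gridPoint t T n k) ω)) ω ∂P := by
  have := h.isProbabilityMeasure
  set u := gridPoint t T n k
  have hu : u ∈ Icc t T := gridPoint_mem h.lt.le hk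
  set p : ℕ → ℝ := fun i => gridPoint t T n (min i k)
  have hp : ∀ i, p i ∈ Icc t u := fun i =>
    ⟨(gridPoint_mem h.lt.le ((min_le_right i k).trans hk)).1,
      gridPoint_mono h.lt.le n (min_le_right i k)⟩
  have hpk : p k = u := by simp [p, u]
  set V : Ω → ℕ → ℝ := fun ω i => M (p i) ω
  have hV : AEMeasurable V P := aemeasurable_pi_lambda _ fun i =>
    h.aemeasurable _ ⟨(hp i).1, (hp i).2.trans hu.2⟩
  set A : Set (ℕ → ℝ) := {v | (∀ j : Fin k, 0 < y + β * q (p j) + v j) ∧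
    ¬ 0 < y + β * q (p k) + v k}
  have hA : MeasurableSet A := by
    refine MeasurableSet.inter ?_ (measurableSet_lt measurable_const
      (by fun_prop : Measurable fun v : ℕ → ℝ => y + β * q (p k) + v k)).compl
    have e : {v : ℕ → ℝ | ∀ j : Fin k, 0 < y + β * q (p j) + v j}
        = ⋂ j : Fin k, {v | 0 < y + β * q (p j) + v j} := by ext; simp
    exact (congrArg MeasurableSet e).mpr <| MeasurableSet.iInter fun j =>
      measurableSet_lt measurable_const (by fun_prop : Measurable fun v : ℕ → ℝ => y + β * q (p j) + v j)
  have hset : ∀ ω, ω ∈ gridAlive M q t T β y n k \ gridAlive M q t T β y n (k + 1) ↔ V ω ∈ A := by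
    intro ω
    have e1 : ω ∈ gridAlive M q t T β y n k ↔ ∀ j : Fin k, 0 < y + β * q (p j) + V ω j := by
      have e2 : ∀ j : Fin k, p j = gridPoint t T n j := fun j => by simp [p, j.2.le]
      simp only [V, e2]
      exact ⟨fun hω j => hω j j.2, fun hω j hj => hω ⟨j, hj⟩⟩
    have e3 : ω ∈ gridAlive M q t T β y n (k + 1) ↔
        ω ∈ gridAlive M q t T β y n k ∧ 0 < y + β * q (p k) + V ω k := by
      simp only [V, hpk]
      refine ⟨fun hω => ⟨gridAlive_anti n k.le_succ hω, hω k k.lt_succ_self⟩, fun hω j hj => ?_⟩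
      rcases (Nat.lt_succ_iff.1 hj).lt_or_eq with hj | rfl
      · exact hω.1 j hj
      · exact hω.2
    rw [Set.mem_sdiff, e3, e1]
    simp only [A, mem_ofPred_eq]
    tauto
  have hind : ∀ F : Ω → ℝ, (gridAlive M q t T β y n k \ gridAlive M q t T β y n (k + 1)).indicator F
      = fun ω => A.indicator (fun _ => 1) (V ω) * F ω := by
    intro F
    funext ω
    by_cases hω : V ω ∈ A
    · rw [indicator_of_mem ((hset ω).2 hω), indicator_of_mem hω, one_mul]
    · rw [indicator_of_notMem (fun h => hω ((hset ω).1 h)), indicator_of_notMem hω, zero_mul]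
  have hint := (h.integrable_terminal hf β y).indicator₀
    ((h.nullMeasurableSet_gridAlive β y (n := n) (k := k) (by omega)).diff
      (h.nullMeasurableSet_gridAlive β y (n := n) (k := k + 1) (by omega)))
  have hR : ∀ ω, drifted M q β y T ω = y + β * q T + V ω k + (M T ω - M u ω) := fun ω => by
    simp only [V, hpk, drifted]
    ring
  rw [hind] at hint
  simp_rw [hR] at hint
  have key := integral_mul_comp_add_of_indepFun (h.clock_le hu) (h.hasLaw u hu) hV
    (h.indepFun u hu p hp) hf (measurable_const.indicator hA)
    (m := fun v => y + β * q T + v k) (by fun_prop) hint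
  rw [hind, hind]
  simp_rw [hR]
  simp only [V, hpk] at key ⊢
  exact key

end IsClockedBM

end Reflection

section FirstPassage

variable {Ω : Type*} {M : ℝ → Ω → ℝ} {q : ℝ → ℝ} {t T β y : ℝ}

/-- The value of the `k`-th function of the family `F` at the first grid point, with index `k`, at
which the process is not positive, and `0` if there is none. -/
def firstPassageSum (M : ℝ → Ω → ℝ) (q : ℝ → ℝ) (t T β y : ℝ) (n : ℕ) (F : ℕ → Ω → ℝ) (ω : Ω) : ℝ :=
  ∑ k ∈ Finset.range (n + 2),
    (gridAlive M q t T β y n k \ gridAlive M q t T β y n (k + 1)).indicator (F k) ω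

lemma firstPassageSum_eq (M : ℝ → Ω → ℝ) (q : ℝ → ℝ) (t T β y : ℝ) (n : ℕ) (ω : Ω) :
    (∃ k ≤ n + 1, ω ∈ gridAlive M q t T β y n k \ gridAlive M q t T β y n (k + 1) ∧
      ∀ F, firstPassageSum M q t T β y n F ω = F k ω) ∨
    ∀ F, firstPassageSum M q t T β y n F ω = 0 := by
  by_cases hex : ∃ k ≤ n + 1, ω ∈ gridAlive M q t T β y n k \ gridAlive M q t T β y n (k + 1)
  · obtain ⟨k, hk, hω⟩ := hex
    refine Or.inl ⟨k, hk, hω, fun F => ?_⟩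
    rw [firstPassageSum, Finset.sum_eq_single k, indicator_of_mem hω]
    · intro l _ hlk
      refine indicator_of_notMem (fun hl => ?_) _
      rcases lt_or_gt_of_ne hlk with h | h
      · exact hl.2 (gridAlive_anti n h hω.1)
      · exact hω.2 (gridAlive_anti n h hl.1)
    · intro h
      exact absurd (Finset.mem_range.2 (by omega)) h
  · push Not at hex
    exact Or.inr fun F => Finset.sum_eq_zero fun k hk =>
      indicator_of_notMem (hex k (by have := Finset.mem_range.1 hk; omega)) _

end FirstPassage

section Limit

variable {Ω : Type*} [MeasurableSpace Ω] {P : Measure Ω} {M : ℝ → Ω → ℝ} {q : ℝ → ℝ}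
  {t T β y : ℝ} {f : ℝ → ℝ}

lemma ExpGrowth.sq_heatEval_le (hf : ExpGrowth f) (s z : ℝ) :
    heatEval f s z ^ 2 ≤ heatEval (fun x => f x ^ 2) s z := by
  have h1 := hf.integrable s z
  have h2 := hf.sq.integrable s z
  set m := heatEval f s z with hm
  have h0 : 0 ≤ ∫ ξ, (f (z + √s * ξ) - m) ^ 2 ∂gaussianReal 0 1 :=
    integral_nonneg fun _ => sq_nonneg _
  have e : ∀ ξ, (f (z + √s * ξ) - m) ^ 2
      = f (z + √s * ξ) ^ 2 - 2 * m * f (z + √s * ξ) + m ^ 2 := fun ξ => by ring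
  have h3 : ∫ ξ, f (z + √s * ξ) ∂gaussianReal 0 1 = m := rfl
  have h4 : ∫ ξ, f (z + √s * ξ) ^ 2 ∂gaussianReal 0 1 = heatEval (fun x => f x ^ 2) s z := rfl
  simp_rw [e] at h0
  have h5 : Integrable (fun ξ => f (z + √s * ξ) ^ 2 - 2 * m * f (z + √s * ξ)) (gaussianReal 0 1) :=
    h2.sub (h1.const_mul _)
  rw [integral_add h5 (integrable_const _), integral_sub h2 (h1.const_mul _), integral_const_mul,
    h3, h4] at h0
  simp only [integral_const, probReal_univ, one_smul] at h0
  nlinarith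

/-- Convergence almost everywhere and a bound in `L²` give convergence of the integrals. -/
lemma tendsto_integral_zero_of_sq_le [IsFiniteMeasure P] {Z G : ℕ → Ω → ℝ} {C : ℝ}
    (hZ : ∀ n, Integrable (Z n) P) (hG : ∀ n, Integrable (G n) P)
    (hZG : ∀ n ω, Z n ω ^ 2 ≤ G n ω) (hC : ∀ n, ∫ ω, G n ω ∂P ≤ C)
    (hlim : ∀ᵐ ω ∂P, Tendsto (fun n => Z n ω) atTop (𝓝 0)) :
    Tendsto (fun n => ∫ ω, Z n ω ∂P) atTop (𝓝 0) := by
  have hC0 : 0 ≤ C := (integral_nonneg fun ω => (sq_nonneg _).trans (hZG 0 ω)).trans (hC 0)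
  rw [Metric.tendsto_atTop]
  intro ε hε
  -- The part of `|Z n|` above the level `R` contributes at most `C / R`.
  obtain ⟨R, hR, hRC⟩ : ∃ R : ℝ, 0 < R ∧ C / R < ε / 2 := by
    refine ⟨2 * C / ε + 1, by positivity, ?_⟩
    rw [div_lt_iff₀ (by positivity)]
    have : ε / 2 * (2 * C / ε + 1) = C + ε / 2 := by field_simp
    linarith
  have hint : ∀ n, Integrable (fun ω => min |Z n ω| R) P := fun n =>
    (hZ n).abs.inf (integrable_const R)
  have hmin : Tendsto (fun n => ∫ ω, min |Z n ω| R ∂P) atTop (𝓝 (∫ _, (0 : ℝ) ∂P)) := by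
    refine tendsto_integral_of_dominated_convergence (fun _ => R)
      (fun n => (hint n).aestronglyMeasurable) (integrable_const R) (fun n => ?_) ?_
    · filter_upwards with ω
      rw [Real.norm_eq_abs, abs_of_nonneg (le_min (abs_nonneg _) hR.le)]
      exact min_le_right _ _
    · filter_upwards [hlim] with ω hω
      have h1 : Tendsto (fun n => min |Z n ω| R) atTop (𝓝 (min |(0 : ℝ)| R)) :=
        hω.abs.min tendsto_const_nhds
      rwa [abs_zero, min_eq_left hR.le] at h1
  rw [integral_zero] at hmin
  obtain ⟨N, hN⟩ := Metric.tendsto_atTop.1 hmin (ε / 2) (by linarith)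
  refine ⟨N, fun n hn => ?_⟩
  have h1 := hN n hn
  rw [Real.dist_eq, sub_zero] at h1 ⊢
  have hpt : ∀ ω, |Z n ω| ≤ min |Z n ω| R + 1 / R * G n ω := fun ω => by
    have hG0 : 0 ≤ 1 / R * G n ω :=
      mul_nonneg (by positivity) ((sq_nonneg _).trans (hZG n ω))
    rcases le_total |Z n ω| R with h | h
    · rw [min_eq_left h]
      linarith
    · rw [min_eq_right h]
      have h2 : |Z n ω| * R ≤ G n ω := by
        have := hZG n ω
        rw [← sq_abs] at this
        nlinarith [abs_nonneg (Z n ω)]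
      have h3 : |Z n ω| ≤ 1 / R * G n ω := by
        rw [one_div, ← div_eq_inv_mul, le_div_iff₀ hR]
        exact h2
      linarith
  calc |∫ ω, Z n ω ∂P| ≤ ∫ ω, |Z n ω| ∂P := abs_integral_le_integral_abs
    _ ≤ ∫ ω, (min |Z n ω| R + 1 / R * G n ω) ∂P :=
        integral_mono (hZ n).abs ((hint n).add ((hG n).const_mul _)) hpt
    _ = ∫ ω, min |Z n ω| R ∂P + 1 / R * ∫ ω, G n ω ∂P := by
        rw [integral_add (hint n) ((hG n).const_mul _), integral_const_mul]
    _ ≤ ∫ ω, min |Z n ω| R ∂P + C / R := by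
        rw [one_div, ← div_eq_inv_mul]
        gcongr
        exact hC n
    _ < ε := by linarith [le_abs_self (∫ ω, min |Z n ω| R ∂P)]

/-- The conditional expectation of the terminal value `f`, given the process up to the `k`-th grid
point. -/
def gridEval (M : ℝ → Ω → ℝ) (q : ℝ → ℝ) (t T β y : ℝ) (n : ℕ) (f : ℝ → ℝ) (k : ℕ) (ω : Ω) : ℝ :=
  heatEval f (q T - q (gridPoint t T n k)) (y + β * q T + M (gridPoint t T n k) ω)

lemma isReflected_callExt {H₁ : ℝ} (hH : 0 < H₁) (K β : ℝ) : IsReflected (callExt K H₁ β) β :=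
  ⟨expGrowth_callExt K H₁ β, countable_not_continuousAt_callExt K H₁ β,
    fun _ hs => heatEval_callExt_boundary hH hs⟩

namespace IsClockedBM

lemma integrable_firstPassageSum (h : IsClockedBM M q t T P) (hf : ExpGrowth f) (β y : ℝ) (n : ℕ) :
    Integrable (firstPassageSum M q t T β y n (gridEval M q t T β y n f)) P :=
  integrable_finsetSum _ fun k hk =>
    (h.integral_indicator_firstPassage hf β y (by have := Finset.mem_range.1 hk; omega)).1

/-- Optional stopping at the first grid point at which the process is not positive. -/
lemma integral_firstPassageSum (h : IsClockedBM M q t T P) (hf : ExpGrowth f) (β y : ℝ) (n : ℕ) :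
    ∫ ω, firstPassageSum M q t T β y n (gridEval M q t T β y n f) ω ∂P
      = heatEval f (q T) (y + β * q T) - ∫ ω, (gridAlive M q t T β y n (n + 2)).indicator
          (fun ω => f (drifted M q β y T ω)) ω ∂P := by
  have hi := h.integrable_terminal hf β y
  have hn : ∀ k ≤ n + 2, NullMeasurableSet (gridAlive M q t T β y n k) P := fun k hk =>
    h.nullMeasurableSet_gridAlive β y hk
  have hk : ∀ k ∈ Finset.range (n + 2), k ≤ n + 1 := fun k hk => by
    have := Finset.mem_range.1 hk
    omega
  have hfp := fun k hk' => h.integral_indicator_firstPassage hf β y (hk k hk')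
  calc ∫ ω, firstPassageSum M q t T β y n (gridEval M q t T β y n f) ω ∂P
      = ∑ k ∈ Finset.range (n + 2),
          ∫ ω, (gridAlive M q t T β y n k \ gridAlive M q t T β y n (k + 1)).indicator
            (gridEval M q t T β y n f k) ω ∂P :=
        integral_finsetSum _ fun k hk' => (hfp k hk').1
    _ = ∑ k ∈ Finset.range (n + 2),
          ∫ ω, (gridAlive M q t T β y n k \ gridAlive M q t T β y n (k + 1)).indicator
            (fun ω => f (drifted M q β y T ω)) ω ∂P :=
        Finset.sum_congr rfl fun k hk' => (hfp k hk').2.symm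
    _ = ∫ ω, (f (drifted M q β y T ω) - (gridAlive M q t T β y n (n + 2)).indicator
          (fun ω => f (drifted M q β y T ω)) ω) ∂P := by
        rw [← integral_finsetSum _ fun k hk' => hi.indicator₀
          ((hn k (by have := hk k hk'; omega)).diff (hn (k + 1) (by have := hk k hk'; omega)))]
        simp_rw [sum_indicator_gridAlive]
    _ = _ := by
        rw [integral_sub hi (hi.indicator₀ (hn _ le_rfl)), h.integral_terminal hf β y]

/-- Almost surely, the terminal value is continuous at the terminal point: the law of the latter has
no atoms. -/
lemma ae_continuousAt_terminal (h : IsClockedBM M q t T P) (hf : {z | ¬ ContinuousAt f z}.Countable)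
    (β y : ℝ) : ∀ᵐ ω ∂P, ContinuousAt f (drifted M q β y T ω) := by
  have : NullSingletonClass (gaussianReal 0 (q T).toNNReal) :=
    nullSingletonClass_gaussianReal (Real.toNNReal_pos.2 h.clock_pos).ne'
  have hc : {ρ | ¬ ContinuousAt f (y + β * q T + ρ)}.Countable :=
    hf.preimage (add_right_injective (y + β * q T))
  have hae := hc.ae_notMem (gaussianReal 0 (q T).toNNReal)
  rw [← h.hasLaw_terminal.map_eq] at hae
  filter_upwards [ae_of_ae_map h.hasLaw_terminal.aemeasurable hae] with ω hω
  exact not_not.1 hω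

lemma ae_tendsto_firstPassageSum (h : IsClockedBM M q t T P) (hf : IsReflected f β) (hy : 0 < y) :
    ∀ᵐ ω ∂P, Tendsto (fun n => firstPassageSum M q t T β y n (gridEval M q t T β y n f) ω) atTop
      (𝓝 0) := by
  filter_upwards [h.continuousOn, h.ae_continuousAt_terminal hf.countable β y] with ω hM hfω
  set x : ℝ → ℝ := fun u => drifted M q β y u ω
  set Ψ : ℝ → ℝ := fun u => heatEval f (q T - q u) (y + β * q T + M u ω)
  have hx : ContinuousOn x (Icc t T) :=
    (continuousOn_const.add (h.clock_continuousOn.const_mul β)).add hM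
  have hΨ : ContinuousOn Ψ (Icc t T) := by
    intro u hu
    have hcts : ContinuousWithinAt (fun u => (q T - q u, y + β * q T + M u ω)) (Icc t T) u :=
      (continuousWithinAt_const.sub (h.clock_continuousOn u hu)).prodMk
        (continuousWithinAt_const.add (hM u hu))
    refine ContinuousAt.comp_continuousWithinAt (f := fun u => (q T - q u, y + β * q T + M u ω))
      (g := fun p : ℝ × ℝ => heatEval f p.1 p.2)
      (hf.expGrowth.continuousAt_heatEval hf.countable ?_) hcts
    rcases hu.2.eq_or_lt with rfl | hlt
    · exact Or.inr hfω
    · exact Or.inl (sub_pos.2 (h.clock_lt u ⟨hu.1, hlt⟩))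
  have hzero : ∀ u ∈ Icc t T, x u = 0 → Ψ u = 0 := by
    intro u hu hxu
    have e : y + β * q T + M u ω = β * (q T - q u) := by
      simp only [x, drifted] at hxu
      linarith
    simp only [Ψ, e]
    exact hf.boundary _ (h.clock_le hu)
  have hxt : 0 < x t := by simpa [x, drifted, h.clock_start, h.start] using hy
  rw [Metric.tendsto_nhds]
  intro ε hε
  filter_upwards [eventually_abs_le_at_first_passage h.lt.le hx hΨ hzero hxt (half_pos hε)]
    with n hn
  rw [dist_zero_right, Real.norm_eq_abs]
  rcases firstPassageSum_eq M q t T β y n ω with ⟨k, hk, hω, hF⟩ | hF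
  · rw [hF]
    have hle : x (gridPoint t T n k) ≤ 0 := by
      by_contra! hcon
      refine hω.2 fun j hj => ?_
      rcases (Nat.lt_succ_iff.1 hj).lt_or_eq with hj | rfl
      · exact hω.1 j hj
      · exact hcon
    have := hn k hk (fun j hj => hω.1 j hj) hle
    exact this.trans_lt (by linarith)
  · rw [hF]
    simpa using hε

/-- The reflection principle on the grid, in the limit: the terminal value, killed at the first grid
point at which the process is not positive, has the same expectation as the terminal value. -/
lemma tendsto_integral_gridAlive (h : IsClockedBM M q t T P) (hf : IsReflected f β) (hy : 0 < y) :
    Tendsto (fun n => ∫ ω, (gridAlive M q t T β y n (n + 2)).indicator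
      (fun ω => f (drifted M q β y T ω)) ω ∂P) atTop (𝓝 (heatEval f (q T) (y + β * q T))) := by
  have := h.isProbabilityMeasure
  have h0 : Tendsto (fun n => ∫ ω, firstPassageSum M q t T β y n (gridEval M q t T β y n f) ω ∂P)
      atTop (𝓝 0) := by
    refine tendsto_integral_zero_of_sq_le
      (G := fun n => firstPassageSum M q t T β y n (gridEval M q t T β y n fun x => f x ^ 2))
      (C := heatEval (fun x => f x ^ 2) (q T) (y + β * q T))
      (fun n => h.integrable_firstPassageSum hf.expGrowth β y n)
      (fun n => h.integrable_firstPassageSum hf.expGrowth.sq β y n) (fun n ω => ?_) (fun n => ?_)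
      (h.ae_tendsto_firstPassageSum hf hy)
    · rcases firstPassageSum_eq M q t T β y n ω with ⟨k, _, _, hF⟩ | hF
      · rw [hF, hF]
        exact hf.expGrowth.sq_heatEval_le _ _
      · rw [hF, hF]
        norm_num
    · rw [h.integral_firstPassageSum hf.expGrowth.sq β y n]
      exact sub_le_self _ (integral_nonneg fun ω => indicator_nonneg (fun _ _ => sq_nonneg _) _)
  have h1 := (tendsto_const_nhds (x := heatEval f (q T) (y + β * q T))).sub h0
  rw [sub_zero] at h1
  refine h1.congr fun n => ?_
  rw [h.integral_firstPassageSum hf.expGrowth β y n, sub_sub_cancel]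

/-- The probability that a process started from `y` is positive at all grid points converges to a
continuous function of `y`. -/
lemma exists_tendsto_gridAlive (h : IsClockedBM M q t T P) (β : ℝ) :
    ∃ p : ℝ → ℝ, Continuous p ∧ ∀ y, 0 < y →
      Tendsto (fun n => P.real (gridAlive M q t T β y n (n + 2))) atTop (𝓝 (p y)) := by
  have := h.isProbabilityMeasure
  have hcont : ∀ K : ℝ, Continuous fun y => heatEval (callExt K 1 β) (q T) (y + β * q T) := by
    intro K
    rw [continuous_iff_continuousAt]
    intro y
    exact ContinuousAt.comp (f := fun y => (q T, y + β * q T))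
      (g := fun p : ℝ × ℝ => heatEval (callExt K 1 β) p.1 p.2)
      ((expGrowth_callExt K 1 β).continuousAt_heatEval
        (countable_not_continuousAt_callExt K 1 β) (Or.inl h.clock_pos)) (by fun_prop)
  refine ⟨fun y => heatEval (callExt 0 1 β) (q T) (y + β * q T)
    - heatEval (callExt 1 1 β) (q T) (y + β * q T), (hcont 0).sub (hcont 1), fun y hy => ?_⟩
  refine ((h.tendsto_integral_gridAlive (isReflected_callExt one_pos 0 β) hy).sub
    (h.tendsto_integral_gridAlive (isReflected_callExt one_pos 1 β) hy)).congr fun n => ?_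
  have hn := h.nullMeasurableSet_gridAlive β y (n := n) le_rfl
  rw [← integral_sub
    ((h.integrable_terminal (expGrowth_callExt 0 1 β) β y).indicator₀ hn)
    ((h.integrable_terminal (expGrowth_callExt 1 1 β) β y).indicator₀ hn),
    ← mul_one (P.real _), ← smul_eq_mul, ← setIntegral_const, ← integral_indicator₀ hn]
  refine integral_congr_ae (Eventually.of_forall fun ω => ?_)
  by_cases hω : ω ∈ gridAlive M q t T β y n (n + 2)
  · have hpos : 0 < drifted M q β y T ω := by
      simpa only [gridPoint_last] using hω (n + 1) (by omega)
    have h1 := Real.one_le_exp hpos.le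
    simp only [indicator_of_mem hω, callExt_of_pos one_pos hpos, one_mul, sub_zero]
    rw [max_eq_left (by linarith), max_eq_left (by linarith)]
    ring
  · simp only [indicator_of_notMem hω, sub_zero]

/-- Almost surely, the process does not touch zero without becoming negative. -/
lemma measure_touch_eq_zero (h : IsClockedBM M q t T P) (β : ℝ) (hy : 0 < y) :
    P {ω | (∀ u ∈ Icc t T, 0 ≤ drifted M q β y u ω) ∧ ∃ u ∈ Icc t T, drifted M q β y u ω = 0}
      = 0 := by
  have := h.isProbabilityMeasure
  obtain ⟨p, hp, hlim⟩ := h.exists_tendsto_gridAlive β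
  set Z := {ω | (∀ u ∈ Icc t T, 0 ≤ drifted M q β y u ω) ∧
    ∃ u ∈ Icc t T, drifted M q β y u ω = 0}
  -- Such a path survives from `y + δ` but not from `y - δ`.
  have key : ∀ δ ∈ Ioo 0 y, P.real Z ≤ p (y + δ) - p (y - δ) := by
    intro δ hδ
    set D : ℕ → Set Ω := fun n =>
      gridAlive M q t T β (y + δ) n (n + 2) \ gridAlive M q t T β (y - δ) n (n + 2)
    have hreal : ∀ n, P.real (D n) = P.real (gridAlive M q t T β (y + δ) n (n + 2))
        - P.real (gridAlive M q t T β (y - δ) n (n + 2)) := fun n => by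
      have hsub : gridAlive M q t T β (y - δ) n (n + 2)
          ⊆ gridAlive M q t T β (y + δ) n (n + 2) := by
        intro ω hω j hj
        have := hω j hj
        simp only [drifted] at this ⊢
        linarith [hδ.1]
      rw [measureReal_def, measure_sdiff hsub (h.nullMeasurableSet_gridAlive β _ le_rfl)
        (measure_ne_top P _), ENNReal.toReal_sub_of_le (measure_mono hsub) (measure_ne_top P _)]
      rfl
    have hD : Tendsto (fun n => P.real (D n)) atTop (𝓝 (p (y + δ) - p (y - δ))) := by
      simp_rw [hreal]
      exact (hlim _ (by linarith [hδ.1, hδ.2])).sub (hlim _ (by linarith [hδ.2]))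
    have hmono : Monotone fun N => ⋂ n ≥ N, D n := fun N N' hN =>
      biInter_subset_biInter_left fun n hn => hN.trans hn
    have hle : ∀ N, P.real (⋂ n ≥ N, D n) ≤ p (y + δ) - p (y - δ) := fun N => by
      refine ge_of_tendsto hD ?_
      filter_upwards [eventually_ge_atTop N] with n hn
      exact measureReal_mono (biInter_subset_of_mem hn)
    have hZ : P Z ≤ P (⋃ N, ⋂ n ≥ N, D n) := by
      refine measure_mono_ae ?_
      filter_upwards [h.continuousOn] with ω hM hω
      obtain ⟨hnn, u, hu, hu0⟩ := hω
      have hcts : ContinuousOn (fun u => drifted M q β (y - δ) u ω) (Icc t T) :=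
        (continuousOn_const.add (h.clock_continuousOn.const_mul β)).add hM
      obtain ⟨N, hN⟩ := eventually_atTop.1 (eventually_exists_gridPoint_neg h.lt hcts hu (by
        simp only [drifted] at hu0 ⊢
        linarith [hδ.1]))
      refine mem_iUnion.2 ⟨N, mem_iInter₂.2 fun n hn => ⟨fun j hj => ?_, fun hcon => ?_⟩⟩
      · have := hnn _ (gridPoint_mem h.lt.le (n := n) (k := j) (by omega))
        simp only [drifted] at this ⊢
        linarith [hδ.1]
      · obtain ⟨k, hk, hneg⟩ := hN n hn
        exact (hcon k hk).not_ge hneg.le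
    refine ENNReal.toReal_le_of_le_ofReal (measureReal_nonneg.trans (hle 0)) (hZ.trans ?_)
    rw [hmono.measure_iUnion]
    refine iSup_le fun N => ?_
    rw [← ofReal_measureReal]
    exact ENNReal.ofReal_le_ofReal (hle N)
  have hcts : Tendsto (fun δ => p (y + δ) - p (y - δ)) (𝓝[>] 0) (𝓝 0) := by
    have : Continuous fun δ => p (y + δ) - p (y - δ) := by fun_prop
    have h0 := this.tendsto 0
    simp only [add_zero, sub_zero, sub_self] at h0
    exact h0.mono_left nhdsWithin_le_nhds
  have hle : P.real Z ≤ 0 := ge_of_tendsto hcts (by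
    filter_upwards [Ioo_mem_nhdsGT hy] with δ hδ
    exact key δ hδ)
  exact (measureReal_eq_zero_iff).1 (hle.antisymm measureReal_nonneg)

/-- The reflection principle: killing the process at zero does not change the expectation of a
reflected terminal value. -/
theorem integral_indicator_pos (h : IsClockedBM M q t T P) (hf : IsReflected f β) (hy : 0 < y) :
    Integrable ({ω | ∀ u ∈ Icc t T, 0 < drifted M q β y u ω}.indicator
      fun ω => f (drifted M q β y T ω)) P ∧
    ∫ ω, {ω | ∀ u ∈ Icc t T, 0 < drifted M q β y u ω}.indicator
      (fun ω => f (drifted M q β y T ω)) ω ∂P = heatEval f (q T) (y + β * q T) := by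
  set F : Ω → ℝ := fun ω => f (drifted M q β y T ω)
  set A := {ω | ∀ u ∈ Icc t T, 0 < drifted M q β y u ω}
  have hF : Integrable F P := h.integrable_terminal hf.expGrowth β y
  have hn : ∀ n, AEStronglyMeasurable ((gridAlive M q t T β y n (n + 2)).indicator F) P :=
    fun n => (hF.indicator₀ (h.nullMeasurableSet_gridAlive β y le_rfl)).aestronglyMeasurable
  have hlim : ∀ᵐ ω ∂P, Tendsto (fun n => (gridAlive M q t T β y n (n + 2)).indicator F ω) atTop
      (𝓝 (A.indicator F ω)) := by
    filter_upwards [h.continuousOn, measure_eq_zero_iff_ae_notMem.1 (h.measure_touch_eq_zero β hy)]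
      with ω hM hω
    by_cases hA : ω ∈ A
    · refine tendsto_const_nhds.congr fun n => ?_
      rw [indicator_of_mem hA, indicator_of_mem]
      exact fun j hj => hA _ (gridPoint_mem h.lt.le (by omega))
    · have hneg : ∃ u ∈ Icc t T, drifted M q β y u ω < 0 := by
        by_contra! hcon
        simp only [A, mem_ofPred_eq, not_forall, not_lt] at hA
        obtain ⟨u, hu, hle⟩ := hA
        exact hω ⟨hcon, u, hu, hle.antisymm (hcon u hu)⟩
      obtain ⟨u, hu, hneg⟩ := hneg
      have hcts : ContinuousOn (fun u => drifted M q β y u ω) (Icc t T) :=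
        (continuousOn_const.add (h.clock_continuousOn.const_mul β)).add hM
      rw [indicator_of_notMem hA]
      refine tendsto_const_nhds.congr' ?_
      filter_upwards [eventually_exists_gridPoint_neg h.lt hcts hu hneg] with n hn
      obtain ⟨k, hk, hk0⟩ := hn
      rw [indicator_of_notMem]
      exact fun hcon => (hcon k hk).not_ge hk0.le
  have hm : AEStronglyMeasurable (A.indicator F) P :=
    aestronglyMeasurable_of_tendsto_ae atTop hn hlim
  refine ⟨hF.mono hm (Eventually.of_forall fun ω => norm_indicator_le_norm_self F ω), ?_⟩
  refine tendsto_nhds_unique (tendsto_integral_of_dominated_convergence (fun ω => ‖F ω‖) hn hF.norm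
    (fun n => Eventually.of_forall fun ω => norm_indicator_le_norm_self F ω) hlim) ?_
  exact h.tendsto_integral_gridAlive hf hy

end IsClockedBM

end Limit

/-! ### The martingale approach -/

section Price

variable {Ω : Type*} {W : ℝ≥0 → Ω → ℝ} {a c r T K H₁ β t x v u : ℝ}

/-- The martingale part of the logarithm of the price. -/
def logMartingale (a c : ℝ) (W : ℝ≥0 → Ω → ℝ) (t v u : ℝ) (ω : Ω) : ℝ :=
  wienerIntegral (fun l => Real.exp (logVol a c t v l)) (fun s => W s ω) t u

/-- In units of the barrier, the price is the exponential of a Brownian motion with drift `β`, both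
run in the clock `γ²`. -/
lemma price_eq_barrier_mul_exp (ha : 0 < a) (hc : 0 < c) (hH : 0 < H₁) (htu : t ≤ u) (huT : u ≤ T)
    (hx : 0 < x) (ω : Ω) :
    price a c r W t x v u ω = barrier a c r T H₁ β u (logVol a c t v u) *
      Real.exp (drifted (logMartingale a c W t v) (fun u => gammaSq a c t u v) β
        (Real.log (x / barrier a c r T H₁ β t v)) u ω) := by
  have hb := barrier_pos (a := a) (c := c) (r := r) (T := T) (β := β) hH t v
  have e : Real.exp (drifted (logMartingale a c W t v) (fun u => gammaSq a c t u v) β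
      (Real.log (x / barrier a c r T H₁ β t v)) u ω)
      = x / barrier a c r T H₁ β t v *
        Real.exp (β * gammaSq a c t u v + logMartingale a c W t v u ω) := by
    rw [drifted, add_assoc, Real.exp_add, Real.exp_log (div_pos hx hb)]
  have hexp : Real.exp (r * (u - t) - 1 / 2 * gammaSq a c t u v + logMartingale a c W t v u ω)
      * barrier a c r T H₁ β t v = barrier a c r T H₁ β u (logVol a c t v u)
        * Real.exp (β * gammaSq a c t u v + logMartingale a c W t v u ω) := by
    rw [barrier, barrier, gammaSq_logVol ha hc htu huT, mul_left_comm, mul_assoc, ← Real.exp_add,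
      ← Real.exp_add]
    ring_nf
  rw [e, price, ← logMartingale, mul_left_comm, ← hexp]
  field_simp

lemma log_div_barrier_pos (hH : 0 < H₁) (hx : barrier a c r T H₁ β t v < x) :
    0 < Real.log (x / barrier a c r T H₁ β t v) :=
  Real.log_pos ((one_lt_div (barrier_pos hH t v)).2 hx)

/-- The option is alive at maturity if and only if the price has stayed above the barrier before
maturity. -/
lemma le_hitTime_iff {ω : Ω} : (T : EReal) ≤ hitTime a c r T H₁ β W t x v ω ↔
    ∀ u ∈ Ico t T, barrier a c r T H₁ β u (logVol a c t v u) < price a c r W t x v u ω := by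
  simp only [hitTime, le_sInf_iff, forall_mem_image, EReal.coe_le_coe_iff, mem_ofPred_eq]
  refine ⟨fun h u hu => ?_, fun h u hu => ?_⟩
  · by_contra! hcon
    exact (h ⟨hu.1, hu.2.le, hcon⟩).not_gt hu.2
  · by_contra! hcon
    exact (h u ⟨hu.1, hcon⟩).not_ge hu.2.2

/-- For an option issued at maturity, no time before maturity remains at which the barrier could be
hit. -/
lemma payoff_terminal (ω : Ω) :
    payoff a c r T K H₁ β W T x v ω = max (x - K) 0 := by
  have hhit : ω ∈ {ω | (T : EReal) ≤ hitTime a c r T H₁ β W T x v ω} :=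
    le_hitTime_iff.2 fun u hu => absurd hu.2 hu.1.not_gt
  rw [payoff, indicator_of_mem hhit]
  simp [price, wienerIntegral_self, gammaSq_self]

end Price

section Martingale

variable {Ω : Type*} [MeasurableSpace Ω] {P : Measure Ω} {W : ℝ≥0 → Ω → ℝ}
  {a c r T K H₁ β t x v u : ℝ} {σ σ' : ℝ → ℝ}

/-- A Wiener integral is a Brownian motion in the clock `∫ σ²`. -/
lemma IsC1On.isClockedBM (h : IsC1On σ σ' t T) (h0 : 0 ≤ t) (htT : t < T)
    (hσ : ∀ l ∈ Icc t T, 0 < σ l) (hW : IsBrownianReal W P) :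
    IsClockedBM (fun u ω => wienerIntegral σ (fun s => W s ω) t u)
      (fun u => ∫ l in t..u, σ l ^ 2) t T P := by
  have hint : ∀ p ∈ Icc t T, ∀ p' ∈ Icc t T,
      IntervalIntegrable (fun l => σ l ^ 2) volume p p' := fun p hp p' hp' =>
    (h.sq.continuousOn.mono (uIcc_subset_Icc hp hp')).intervalIntegrable
  have hl : t ∈ Icc t T := left_mem_Icc.2 htT.le
  have hr : T ∈ Icc t T := right_mem_Icc.2 htT.le
  have hclock : ∀ u ∈ Icc t T,
      (∫ l in t..T, σ l ^ 2) - ∫ l in t..u, σ l ^ 2 = ∫ l in u..T, σ l ^ 2 := fun u hu =>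
    intervalIntegral.integral_interval_sub_left (hint t hl T hr) (hint t hl u hu)
  have hincr : ∀ u ∈ Icc t T, (fun ω => wienerIntegral σ (fun s => W s ω) u T) =ᵐ[P]
      fun ω => wienerIntegral σ (fun s => W s ω) t T - wienerIntegral σ (fun s => W s ω) t u := by
    intro u hu
    filter_upwards [hW.cont] with ω hω
    rw [← h.wienerIntegral_add hu.1 hu.2 hω, add_sub_cancel_left]
  constructor
  case lt => exact htT
  case clock_continuousOn =>
    have := intervalIntegral.continuousOn_primitive_interval' (hint t hl T hr) left_mem_uIcc
    rwa [uIcc_of_le htT.le] at this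
  case clock_start => exact intervalIntegral.integral_same
  case clock_lt =>
    intro u hu
    rw [← sub_pos, hclock u ⟨hu.1, hu.2.le⟩]
    exact intervalIntegral.intervalIntegral_pos_of_pos_on (hint u ⟨hu.1, hu.2.le⟩ T hr)
      (fun l hl => pow_pos (hσ l ⟨hu.1.trans hl.1.le, hl.2.le⟩) 2) hu.2
  case start => exact fun ω => wienerIntegral_self _ _ _
  case continuousOn =>
    filter_upwards [hW.cont] with ω hω
    exact h.continuousOn_wienerIntegral hω
  case aemeasurable =>
    exact fun u hu => (h.mono le_rfl hu.2).aemeasurable_wienerIntegral hu.1 hW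
  case hasLaw =>
    intro u hu
    simp only [hclock u hu]
    exact ((h.mono hu.1 le_rfl).hasLaw_wienerIntegral (h0.trans hu.1) hu.2 hW).congr
      (hincr u hu).symm
  case indepFun =>
    intro u hu p hp
    exact (indepFun_wienerIntegral hW σ hu.2 p (fun i => (hp i).1) fun i => (hp i).2).congr
      (hincr u hu) Filter.EventuallyEq.rfl

lemma isClockedBM_logMartingale (ha : 0 < a) (hc : 0 < c) (h0 : 0 ≤ t) (htT : t < T) (v : ℝ)
    (hW : IsBrownianReal W P) :
    IsClockedBM (logMartingale a c W t v) (fun u => gammaSq a c t u v) t T P := by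
  have hV : ContinuousOn (logVol a c t v) (Icc t T) :=
    (continuousOn_logVol ha hc t v).mono Icc_subset_Ici_self
  have h : IsC1On (fun l => Real.exp (logVol a c t v l)) (fun l => Real.exp (logVol a c t v l) *
      (a - c / 2 * Real.exp (2 * logVol a c t v l))) t T :=
    ⟨fun l hl => (hasDerivAt_logVol ha hc hl.1 v).exp, by fun_prop⟩
  have e : (fun u => gammaSq a c t u v)
      = fun u => ∫ l in t..u, Real.exp (logVol a c t v l) ^ 2 := by
    funext u
    simp only [gammaSq, ← Real.exp_nat_mul, Nat.cast_ofNat]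
  rw [e]
  exact h.isClockedBM h0 htT (fun l _ => Real.exp_pos _) hW

/-- Almost surely, the payoff is a function of the drifted Brownian motion at maturity, killed when
this Brownian motion reaches zero. -/
lemma payoff_ae_eq (ha : 0 < a) (hc : 0 < c) (hH : 0 < H₁) (h0 : 0 ≤ t) (htT : t < T)
    (hx : barrier a c r T H₁ β t v < x) (hW : IsBrownianReal W P) :
    payoff a c r T K H₁ β W t x v =ᵐ[P]
      {ω | ∀ u ∈ Icc t T, 0 < drifted (logMartingale a c W t v) (fun u => gammaSq a c t u v) β
        (Real.log (x / barrier a c r T H₁ β t v)) u ω}.indicator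
      fun ω => callExt K H₁ β (drifted (logMartingale a c W t v) (fun u => gammaSq a c t u v) β
        (Real.log (x / barrier a c r T H₁ β t v)) T ω) := by
  have hBM := isClockedBM_logMartingale ha hc h0 htT v hW
  have hy := log_div_barrier_pos hH hx
  have hx0 : 0 < x := (barrier_pos hH t v).trans hx
  set X := drifted (logMartingale a c W t v) (fun u => gammaSq a c t u v) β
    (Real.log (x / barrier a c r T H₁ β t v)) with hX
  have hprice : ∀ u ∈ Icc t T, ∀ ω, price a c r W t x v u ω
      = barrier a c r T H₁ β u (logVol a c t v u) * Real.exp (X u ω) := fun u hu ω =>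
    price_eq_barrier_mul_exp ha hc hH hu.1 hu.2 hx0 ω
  have hlt : ∀ u ∈ Icc t T, ∀ ω,
      barrier a c r T H₁ β u (logVol a c t v u) < price a c r W t x v u ω ↔ 0 < X u ω := by
    intro u hu ω
    rw [hprice u hu, lt_mul_iff_one_lt_right (barrier_pos hH u _), Real.one_lt_exp_iff]
  have hT : T ∈ Icc t T := right_mem_Icc.2 htT.le
  filter_upwards [hBM.continuousOn,
    measure_eq_zero_iff_ae_notMem.1 (hBM.measure_touch_eq_zero β hy)] with ω hM hω
  have hcts : ContinuousOn (fun u => X u ω) (Icc t T) :=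
    (continuousOn_const.add (hBM.clock_continuousOn.const_mul β)).add hM
  by_cases hpos : ∀ u ∈ Icc t T, 0 < X u ω
  · have hhit : ω ∈ {ω | (T : EReal) ≤ hitTime a c r T H₁ β W t x v ω} :=
      le_hitTime_iff.2 fun u hu => (hlt u ⟨hu.1, hu.2.le⟩ ω).2 (hpos u ⟨hu.1, hu.2.le⟩)
    have hA : ω ∈ {ω | ∀ u ∈ Icc t T, 0 < X u ω} := hpos
    rw [payoff, indicator_of_mem hhit, indicator_of_mem hA, callExt_of_pos hH (hpos T hT),
      hprice T hT, barrier_terminal]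
  · have hA : ω ∉ {ω | ∀ u ∈ Icc t T, 0 < X u ω} := hpos
    rw [indicator_of_notMem hA, payoff]
    refine indicator_of_notMem (fun hhit => ?_) _
    have hIco : ∀ u ∈ Ico t T, 0 < X u ω := fun u hu =>
      (hlt u ⟨hu.1, hu.2.le⟩ ω).1 (le_hitTime_iff.1 hhit u hu)
    -- By continuity the process would be zero at maturity without having been negative.
    have hT0 : 0 ≤ X T ω := by
      have h1 : Tendsto (fun u => X u ω) (𝓝[<] T) (𝓝 (X T ω)) :=
        (hcts T hT).tendsto.mono_left
          (nhdsWithin_le_of_mem (mem_of_superset (Ico_mem_nhdsLT htT) Ico_subset_Icc_self))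
      refine ge_of_tendsto h1 ?_
      filter_upwards [Ico_mem_nhdsLT htT] with u hu using (hIco u hu).le
    have hTle : X T ω ≤ 0 := by
      by_contra! hcon
      refine hpos fun u hu => ?_
      rcases hu.2.eq_or_lt with rfl | h
      · exact hcon
      · exact hIco u ⟨hu.1, h⟩
    refine hω ⟨fun u hu => ?_, T, hT, hTle.antisymm hT0⟩
    rcases hu.2.eq_or_lt with rfl | h
    · exact hT0
    · exact (hIco u ⟨hu.1, h⟩).le

lemma integrable_payoff (ha : 0 < a) (hc : 0 < c) (hH : 0 < H₁) (h0 : 0 ≤ t) (htT : t ≤ T)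
    (hx : barrier a c r T H₁ β t v < x) (hW : IsBrownianReal W P) :
    Integrable (payoff a c r T K H₁ β W t x v) P := by
  have : IsProbabilityMeasure P := hW.isGaussianProcess.isProbabilityMeasure
  rcases htT.eq_or_lt with rfl | htT
  · rw [funext (payoff_terminal (W := W))]
    exact integrable_const _
  · refine Integrable.congr ?_ (payoff_ae_eq ha hc hH h0 htT hx hW).symm
    exact ((isClockedBM_logMartingale ha hc h0 htT v hW).integral_indicator_pos
      (isReflected_callExt hH K β) (log_div_barrier_pos hH hx)).1

lemma martingalePrice_eq_zeroOrderTerm (ha : 0 < a) (hc : 0 < c) (hH : 0 < H₁) (h0 : 0 ≤ t)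
    (htT : t < T) (hx : barrier a c r T H₁ β t v < x) (hW : IsBrownianReal W P) :
    martingalePrice a c r T K H₁ β W P t x v = zeroOrderTerm a c r T K H₁ β t x v := by
  rw [martingalePrice, integral_congr_ae (payoff_ae_eq ha hc hH h0 htT hx hW),
    ((isClockedBM_logMartingale ha hc h0 htT v hW).integral_indicator_pos
      (isReflected_callExt hH K β) (log_div_barrier_pos hH hx)).2, zeroOrderTerm, heatLift,
    heatCoord_eq (β := β) hH ((barrier_pos hH t v).trans hx)]

lemma isGivenByClosedForm_martingalePrice (ha : 0 < a) (hc : 0 < c) (hT : 0 < T) (hH : 0 < H₁)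
    (hW : IsBrownianReal W P) :
    IsGivenByClosedForm a c r T K H₁ β (martingalePrice a c r T K H₁ β W P) := by
  have : IsProbabilityMeasure P := hW.isGaussianProcess.isProbabilityMeasure
  refine ⟨fun t x v h0 htT hx => ?_, fun x v hx => ?_⟩
  · rw [martingalePrice_eq_zeroOrderTerm ha hc hH h0 htT hx hW,
      zeroOrderTerm_eq_closedForm ha hc hH htT ((barrier_pos hH t v).trans hx)]
  · have e : martingalePrice a c r T K H₁ β W P T x v = max (x - K) 0 := by
      simp [martingalePrice, funext (payoff_terminal (W := W))]
    rw [e]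
    exact tendsto_closedForm ha hc hT hH hx

end Martingale

end

end SmallVolOfVol

theorem mainTheorem3 (a c r T K H₁ β : ℝ) (ha : 0 < a) (hc : 0 < c) (hT : 0 < T) (hH : 0 < H₁) :
    -- the terminal and boundary value problem has a solution
    (∃ f : ℝ → ℝ → ℝ → ℝ, SmallVolOfVol.IsZeroOrderTerm a c r T K H₁ β f) ∧
    -- every solution is given by the closed form
    (∀ f : ℝ → ℝ → ℝ → ℝ, SmallVolOfVol.IsZeroOrderTerm a c r T K H₁ β f →
      SmallVolOfVol.IsGivenByClosedForm a c r T K H₁ β f) ∧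
    -- and so is the price of the martingale approach
    (∀ {Ω : Type*} [MeasurableSpace Ω] (P : Measure Ω) (W : ℝ≥0 → Ω → ℝ), IsBrownianReal W P →
      (∀ t x v : ℝ, 0 ≤ t → t ≤ T → SmallVolOfVol.barrier a c r T H₁ β t v < x →
        Integrable (SmallVolOfVol.payoff a c r T K H₁ β W t x v) P) ∧
      SmallVolOfVol.IsGivenByClosedForm a c r T K H₁ β
        (SmallVolOfVol.martingalePrice a c r T K H₁ β W P)) := by
  refine ⟨⟨_, SmallVolOfVol.isZeroOrderTerm_zeroOrderTerm ha hc hH⟩,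
    fun f hf => hf.isGivenByClosedForm ha hc hT hH, fun P W hW => ⟨fun t x v h0 htT hx => ?_, ?_⟩⟩
  · exact SmallVolOfVol.integrable_payoff ha hc hH h0 htT hx hW
  · exact SmallVolOfVol.isGivenByClosedForm_martingalePrice ha hc hT hH hW
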